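/- Let $m,n\ge 1$ be integers, $1<p,p',r<\infty$ with $1/p+1/p'=1$, $0\le s<\infty$, and let $\mathbb M=\mathbb R^{m\times n}$ carry the scalar product $A:B$ and the Frobenius norm $|A|$. Let $c_1,c_2,c_3>0$ and $c_4,c_5\ge0$. Consider energy densities $W\in C^1(\mathbb M)$ such that for all $A,B\in\mathbb M$ $$c_1|A|^p-c_4\le W(A)\le c_2|A|^p+c_5,$$ $$|DW(A)-DW(B)|^r\le c_3(1+|A|^s+|B|^s)\big(W(B)-W(A)-DW(A):(B-A)\big).$$ Let $\Omega\subset\mathbb R^n$ be a bounded open set with $\Omega=\operatorname{int}\overline\Omega$ (for instance a bounded polyhedral Lipschitz domain). A regular triangulation $\mathcal T$ of $\Omega$ is a finite set of closed $n$-simplices of positive volume with union $\overline\Omega$ such that two distinct simplices are either disjoint or share exactly one common lower-dimensional subsimplex. It is called $\gamma$-shape-regular if each $T\in\mathcal T$ contains a ball of some radius $\rho>0$ with $\operatorname{diam}T\le\gamma\rho$. Let $\mathcal F$ be the set of all sides (hyperfaces) of the simplices and $\mathcal F(\Omega)$ the set of interior sides, i.e. those not contained in $\partial\Omega$. Let $P_j(K)$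 denote the polynomials of total degree at most $j$ on $K$, and fix one of the two choices * $k=\ell\ge0$ and $\Sigma(\mathcal T)$ is the space of $\tau:\Omega\to\mathbb M$ whose rows restricted to each $T$ are in the Raviart-Thomas space $P_k(T;\mathbb R^n)+xP_k(T)$; * $k=\ell+1\ge1$ and $\Sigma(\mathcal T)$ is the space of $\tau:\Omega\to\mathbb M$ whose rows restricted to each $T$ are in the Brezzi-Douglas-Marini space $P_k(T;\mathbb R^n)$. Let $V_h=P_\ell(\mathcal T;\mathbb R^m)\times P_k(\mathcal F(\Omega);\mathbb R^m)$ be the space of pairs $v_h=(v_{\mathcal T},v_{\mathcal F})$ of piecewise polynomials on $\mathcal T$ and on $\mathcal F$, with $v_F=0$ on the sides $F\subset\partial\Omega$. The gradient reconstruction $Rv_h\in\Sigma(\mathcal T)$ of $v_h\in V_h$ is defined by $$\int_\Omega Rv_h:\tau_h\,dx=-\int_\Omega v_{\mathcal T}\cdot\operatorname{div}_{pw}\tau_h\,dx+\sum_{F\in\mathcal F}\int_F v_F\cdot[\tau_h\nu_F]_F\,ds\qquad\text{for all }\tau_h\in\Sigma(\mathcal T),$$ where $\operatorname{div}_{pw}$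 is the piecewise row-wise divergence and $[\tau_h\nu_F]_F$ is the jump of the normal component across $F$. Let $\Pi_{\mathcal T}^\ell$ and $\Pi_{\Sigma(\mathcal T)}$ be the $L^2$ projections onto $P_\ell(\mathcal T;\mathbb R^m)$ and $\Sigma(\mathcal T)$. For $f\in L^{p'}(\Omega;\mathbb R^m)$ the discrete energy is $$E_h(v_h)=\int_\Omega W(Rv_h)\,dx-\int_\Omega f\cdot v_{\mathcal T}\,dx,\qquad v_h\in V_h.$$ **Theorem.** For all $\gamma,M\in\mathbb R$ there exist positive constants $C_1,C_2$, depending only on $m,n,p,r,s,c_1,\dots,c_5,k,\ell$, the choice of $\Sigma$, $\Omega,\gamma$ and $M$, such that for every $\gamma$-shape-regular triangulation $\mathcal T$ of $\Omega$, every $W$ as above and every $f\in L^{p'}(\Omega;\mathbb R^m)$ with $\|f\|_{L^{p'}(\Omega)}\le M$ the following holds. The reconstruction $Rv_h$ and the projections $\Pi_{\mathcal T}^\ell f$ and $\Pi_{\Sigma(\mathcal T)}DW(Rv_h)$ are well defined for every $v_h\in V_h$. The minimum of $E_h$ over $V_h$ is attained. Any discrete minimizer $u_h\in V_h$ and the discrete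 stress $\sigma_h=\Pi_{\Sigma(\mathcal T)}DW(Ru_h)$ satisfy (a)–(c). * (a) If $u_1,u_2\in V_h$ minimize $E_h$ in $V_h$, then $DW(Ru_1)=DW(Ru_2)$ a.e. in $\Omega$. In particular, $\sigma_h$ does not depend on the choice of the minimizer $u_h$. * (b) $\sigma_h\in Q(f,\mathcal T)=\{\tau_h\in\Sigma(\mathcal T)\cap W^{p'}(\operatorname{div},\Omega;\mathbb M):\operatorname{div}\tau_h=-\Pi_{\mathcal T}^\ell f\}$, where $W^{p'}(\operatorname{div},\Omega;\mathbb M)$ consists of all $\tau\in L^{p'}(\Omega;\mathbb M)$ with row-wise weak divergence in $L^{p'}(\Omega;\mathbb R^m)$. * (c) $\|Ru_h\|_{L^p(\Omega)}\le C_1$ and $\|\sigma_h\|_{L^{p'}(\Omega)}\le C_2$. -/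

import Mathlib

open MeasureTheory Set
open scoped ContDiff

noncomputable section

namespace HHO

/-- Points and vectors in `ℝⁿ` with the Euclidean norm. -/
abbrev Vec (n : ℕ) := EuclideanSpace ℝ (Fin n)

/-- Real `m × n` matrices, stored as `m` rows in `ℝⁿ`. As an `ℓ²` product of Euclidean spaces it
carries the scalar product `A : B = ∑ i j, A i j * B i j` and the Frobenius norm. -/
abbrev Mat (m n : ℕ) := PiLp 2 (fun _ : Fin m => Vec n)

/-! ### Energy densities -/

/-- The derivative `DW` of the energy density, as a matrix field: the gradient of `W` with respect
to the scalar product `A : B`. -/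
def DW {m n : ℕ} (W : Mat m n → ℝ) (A : Mat m n) : Mat m n := gradient W A

/-- Two-sided growth of order `p`:
`c₁ |A|^p - c₄ ≤ W A ≤ c₂ |A|^p + c₅`. -/
def TwoSidedGrowth {m n : ℕ} (p c₁ c₂ c₄ c₅ : ℝ) (W : Mat m n → ℝ) : Prop :=
  ∀ A : Mat m n, c₁ * ‖A‖ ^ p - c₄ ≤ W A ∧ W A ≤ c₂ * ‖A‖ ^ p + c₅

/-- Convexity control with parameters `r`, `s` and constant `c₃`. -/
def ConvexityControl {m n : ℕ} (r s c₃ : ℝ) (W : Mat m n → ℝ) : Prop :=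
  ∀ A B : Mat m n, ‖DW W A - DW W B‖ ^ r ≤
    c₃ * (1 + ‖A‖ ^ s + ‖B‖ ^ s) * (W B - W A - inner ℝ (DW W A) (B - A))

/-! ### Triangulations -/

/-- The closed simplex (an `n`-simplex or a side) spanned by a finite set of vertices. -/
def cell {n : ℕ} (T : Finset (Vec n)) : Set (Vec n) := convexHull ℝ (T : Set (Vec n))

/-- A regular triangulation of `Ω` in the sense of Ciarlet. Simplices are given by
their sets of vertices; `n + 1` affinely independent vertices span a closed simplex of positive
volume. -/
structure IsTriangulation {n : ℕ} (Ω : Set (Vec n)) (𝒯 : Finset (Finset (Vec n))) : Prop where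
  card_eq : ∀ T ∈ 𝒯, T.card = n + 1
  affineIndependent : ∀ T ∈ 𝒯, AffineIndependent ℝ ((↑) : T → Vec n)
  /-- two simplices are disjoint or share the common subsimplex spanned by their common vertices -/
  inter_eq : ∀ T ∈ 𝒯, ∀ T' ∈ 𝒯,
    cell T ∩ cell T' = convexHull ℝ ((T : Set (Vec n)) ∩ (T' : Set (Vec n)))
  covers : ⋃ T ∈ 𝒯, cell T = closure Ω

/-- Shape regularity with parameter `γ`: every simplex `T` contains a ball of some radius `ρ > 0`
with `diam T ≤ γ ρ`. -/
def ShapeRegular {n : ℕ} (γ : ℝ) (𝒯 : Finset (Finset (Vec n))) : Prop :=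
  ∀ T ∈ 𝒯, ∃ (x : Vec n) (ρ : ℝ), 0 < ρ ∧ Metric.closedBall x ρ ⊆ cell T ∧
    Metric.diam (cell T) ≤ γ * ρ

open Classical in
/-- The set of all sides: the hyperfaces of `T ∈ 𝒯`, spanned by `n` of the `n + 1` vertices. -/
def sides {n : ℕ} (𝒯 : Finset (Finset (Vec n))) : Finset (Finset (Vec n)) :=
  𝒯.biUnion fun T => T.powersetCard n

open Classical in
/-- The interior sides: those that are not contained in the boundary of `Ω`. -/
def interiorSides {n : ℕ} (Ω : Set (Vec n)) (𝒯 : Finset (Finset (Vec n))) :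
    Finset (Finset (Vec n)) :=
  (sides 𝒯).filter fun F => ¬ cell F ⊆ frontier Ω

/-- Barycentre of a finite set of vertices. -/
def barycentre {n : ℕ} (T : Finset (Vec n)) : Vec n := (T.card : ℝ)⁻¹ • ∑ x ∈ T, x

/-- The outer unit normal of the simplex `T` along its side `F`: the component orthogonal to `F`
of the vector from the barycentre of `T` to the barycentre of `F`, normalised. -/
def outerNormal {n : ℕ} (T F : Finset (Vec n)) : Vec n :=
  let d : Vec n :=
    (vectorSpan ℝ (F : Set (Vec n)))ᗮ.starProjection (barycentre F - barycentre T)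
  ‖d‖⁻¹ • d

/-! ### Polynomial spaces

A function defined on a set `K` (a simplex or a side) is represented by its extension by zero to
`ℝⁿ`. -/

/-- `P_k(K)`: polynomials of total degree at most `k`, regarded as functions on `K`. -/
def poly {n : ℕ} (k : ℕ) (K : Set (Vec n)) : Submodule ℝ (Vec n → ℝ) where
  carrier := {g | ∃ q : MvPolynomial (Fin n) ℝ, q.totalDegree ≤ k ∧
    g = K.indicator fun x => MvPolynomial.eval (fun i => x i) q}
  zero_mem' := ⟨0, by simp, by ext x; simp⟩
  add_mem' := by
    rintro _ _ ⟨q, hq, rfl⟩ ⟨q', hq', rfl⟩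
    refine ⟨q + q', (MvPolynomial.totalDegree_add q q').trans (max_le hq hq'), ?_⟩
    ext x
    by_cases hx : x ∈ K <;> simp [hx]
  smul_mem' := by
    rintro c _ ⟨q, hq, rfl⟩
    refine ⟨c • q, (MvPolynomial.totalDegree_smul_le c q).trans hq, ?_⟩
    ext x
    by_cases hx : x ∈ K <;> simp [hx]

/-- `P_k(K; ℝᵐ)`, componentwise. -/
def polyVec {n : ℕ} (m k : ℕ) (K : Set (Vec n)) : Submodule ℝ (Vec n → Vec m) where
  carrier := {g | ∀ i, (fun x => g x i) ∈ poly k K}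
  zero_mem' := fun _ => (poly k K).zero_mem
  add_mem' := fun ha hb i => (poly k K).add_mem (ha i) (hb i)
  smul_mem' := fun c _ ha i => (poly k K).smul_mem c (ha i)

/-- Raviart-Thomas functions `RT_k(K) = P_k(K; ℝⁿ) + x P_k(K)`. -/
def raviartThomas {n : ℕ} (k : ℕ) (K : Set (Vec n)) : Submodule ℝ (Vec n → Vec n) where
  carrier := {τ | ∃ a ∈ polyVec n k K, ∃ b ∈ poly k K, τ = fun x => a x + b x • x}
  zero_mem' := ⟨0, Submodule.zero_mem _, 0, Submodule.zero_mem _, by ext x; simp⟩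
  add_mem' := by
    rintro _ _ ⟨a, ha, b, hb, rfl⟩ ⟨a', ha', b', hb', rfl⟩
    refine ⟨a + a', add_mem ha ha', b + b', add_mem hb hb', ?_⟩
    funext x
    simp only [Pi.add_apply, add_smul]
    abel
  smul_mem' := by
    rintro c _ ⟨a, ha, b, hb, rfl⟩
    refine ⟨c • a, Submodule.smul_mem _ c ha, c • b, Submodule.smul_mem _ c hb, ?_⟩
    funext x
    simp only [Pi.smul_apply, smul_add, smul_smul, smul_eq_mul]

/-- The two pairings of ansatz space and reconstruction space: `rt` stands for `k = ℓ` with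
Raviart-Thomas functions, `bdm` for `k = ℓ + 1` with Brezzi-Douglas-Marini functions. -/
inductive Pairing where
  | rt
  | bdm

/-- The polynomial degree `k` on the sides, in terms of the degree `ℓ` in the simplices. -/
def Pairing.k : Pairing → ℕ → ℕ
  | .rt, ℓ => ℓ
  | .bdm, ℓ => ℓ + 1

/-- The rows of the reconstruction space on a simplex: `RT_k(K)` with `k = ℓ`, or
`BDM_k(K) = P_k(K; ℝⁿ)` with `k = ℓ + 1`. -/
def Pairing.rowSpace {n : ℕ} (P : Pairing) (ℓ : ℕ) (K : Set (Vec n)) :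
    Submodule ℝ (Vec n → Vec n) :=
  match P with
  | .rt => raviartThomas (Pairing.rt.k ℓ) K
  | .bdm => polyVec n (Pairing.bdm.k ℓ) K

/-- Matrix-valued local reconstruction space: each of the `m` rows is in the row space. -/
def Pairing.matSpace {n : ℕ} (P : Pairing) (m ℓ : ℕ) (K : Set (Vec n)) :
    Submodule ℝ (Vec n → Mat m n) where
  carrier := {τ | ∀ i, (fun x => τ x i) ∈ P.rowSpace ℓ K}
  zero_mem' := fun _ => (P.rowSpace ℓ K).zero_mem
  add_mem' := fun ha hb i => (P.rowSpace ℓ K).add_mem (ha i) (hb i)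
  smul_mem' := fun c _ ha i => (P.rowSpace ℓ K).smul_mem c (ha i)

/-! ### Discrete spaces -/

/-- `P_ℓ(𝒯; ℝᵐ)`: one polynomial for each simplex. -/
abbrev PolyPw {n : ℕ} (m ℓ : ℕ) (𝒯 : Finset (Finset (Vec n))) :=
  (T : 𝒯) → polyVec m ℓ (cell T.1)

/-- `P_k(ℱ(Ω); ℝᵐ)`: one polynomial for each interior side. The value on every boundary side is
zero by convention and is not stored. -/
abbrev PolySides {n : ℕ} (m k : ℕ) (Ω : Set (Vec n)) (𝒯 : Finset (Finset (Vec n))) :=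
  (F : interiorSides Ω 𝒯) → polyVec m k (cell F.1)

/-- The ansatz space `V_h = P_ℓ(𝒯; ℝᵐ) × P_k(ℱ(Ω); ℝᵐ)`. -/
abbrev Vh {n : ℕ} (m : ℕ) (P : Pairing) (ℓ : ℕ) (Ω : Set (Vec n))
    (𝒯 : Finset (Finset (Vec n))) :=
  PolyPw m ℓ 𝒯 × PolySides m (P.k ℓ) Ω 𝒯

/-- The space `Σ(𝒯)` of piecewise Raviart-Thomas or Brezzi-Douglas-Marini functions. -/
abbrev SigmaPw {n : ℕ} (m : ℕ) (P : Pairing) (ℓ : ℕ) (𝒯 : Finset (Finset (Vec n))) :=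
  (T : 𝒯) → P.matSpace m ℓ (cell T.1)

/-- The function on `ℝⁿ` with the given restrictions to the simplices: as these are extended by
zero, it is their sum. (Its values on the skeleton, a null set, are immaterial.) -/
def glue {n : ℕ} {G : Type*} [AddCommGroup G] [Module ℝ G] {𝒯 : Finset (Finset (Vec n))}
    {S : 𝒯 → Submodule ℝ (Vec n → G)} (q : (T : 𝒯) → S T) (x : Vec n) : G :=
  ∑ T : 𝒯, (q T : Vec n → G) x

/-- `q` is the `L²(Ω)` projection of `g` onto the piecewise functions with restrictions in
`S T`, tested with all these functions (this makes sense also if `g` is not square integrable). -/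
def IsL2Proj {n : ℕ} {G : Type*} [NormedAddCommGroup G] [InnerProductSpace ℝ G]
    {𝒯 : Finset (Finset (Vec n))} (S : 𝒯 → Submodule ℝ (Vec n → G)) (Ω : Set (Vec n))
    (g : Vec n → G) (q : (T : 𝒯) → S T) : Prop :=
  ∀ φ : (T : 𝒯) → S T, ∫ x in Ω, inner ℝ (g x - glue q x) (glue φ x) = 0

/-- The `L²` projection `Π_𝒯^ℓ` onto `P_ℓ(𝒯; ℝᵐ)`. -/
def projPoly {n m : ℕ} (ℓ : ℕ) (Ω : Set (Vec n)) (𝒯 : Finset (Finset (Vec n)))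
    (g : Vec n → Vec m) : PolyPw m ℓ 𝒯 :=
  Classical.epsilon fun q => IsL2Proj (fun T : 𝒯 => polyVec m ℓ (cell T.1)) Ω g q

/-- The `L²` projection `Π_Σ` onto `Σ(𝒯)`. -/
def projSigma {n m : ℕ} (P : Pairing) (ℓ : ℕ) (Ω : Set (Vec n)) (𝒯 : Finset (Finset (Vec n)))
    (g : Vec n → Mat m n) : SigmaPw m P ℓ 𝒯 :=
  Classical.epsilon fun q => IsL2Proj (fun T : 𝒯 => P.matSpace m ℓ (cell T.1)) Ω g q

/-! ### Gradient reconstruction -/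

/-- Row-wise divergence of a matrix field. -/
def matDiv {m n : ℕ} (τ : Vec n → Mat m n) (x : Vec n) : Vec m :=
  WithLp.toLp 2 fun i => ∑ j, fderiv ℝ (fun y => τ y i j) x (EuclideanSpace.single j 1)

/-- Piecewise divergence. -/
def divPw {m n : ℕ} {P : Pairing} {ℓ : ℕ} {𝒯 : Finset (Finset (Vec n))}
    (τ : SigmaPw m P ℓ 𝒯) (x : Vec n) : Vec m :=
  ∑ T : 𝒯, (interior (cell T.1)).indicator (matDiv (τ T : Vec n → Mat m n)) x

open Classical in
/-- The normal jump `[τ ν_F]_F` across the side `F`. For an interior side `F = T₊ ∩ T₋` with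
`ν_F = ν_{T₊} = -ν_{T₋}` it is `τ|_{T₊} ν_F - τ|_{T₋} ν_F = τ|_{T₊} ν_{T₊} + τ|_{T₋} ν_{T₋}`: the sum
of `τ|_T ν_T` over all `T` with the side `F`, independently of the orientation. -/
def normalJump {m n : ℕ} {P : Pairing} {ℓ : ℕ} {𝒯 : Finset (Finset (Vec n))}
    (τ : SigmaPw m P ℓ 𝒯) (F : Finset (Vec n)) (x : Vec n) : Vec m :=
  ∑ T : 𝒯, if F ⊆ T.1 then
    WithLp.toLp 2 fun i => inner ℝ ((τ T : Vec n → Mat m n) x i) (outerNormal T.1 F)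
  else 0

/-- `ρ ∈ Σ(𝒯)` is the gradient reconstruction of `v ∈ V_h`. Surface integrals are with respect to
the `(n-1)`-dimensional surface measure `μHE[n - 1]`; boundary sides do not contribute, because
`v_F = 0` there. -/
def IsGradRec {m n : ℕ} {P : Pairing} {ℓ : ℕ} {Ω : Set (Vec n)} {𝒯 : Finset (Finset (Vec n))}
    (v : Vh m P ℓ Ω 𝒯) (ρ : SigmaPw m P ℓ 𝒯) : Prop :=
  ∀ τ : SigmaPw m P ℓ 𝒯,
    (∫ x in Ω, inner ℝ (glue ρ x) (glue τ x)) =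
      - (∫ x in Ω, inner ℝ (glue v.1 x) (divPw τ x))
      + ∑ F : interiorSides Ω 𝒯,
          (∫ x in cell F.1, inner ℝ ((v.2 F : Vec n → Vec m) x) (normalJump τ F.1 x) ∂μHE[n - 1])

/-- The gradient reconstruction `R : V_h → Σ(𝒯)`. -/
def R {m n : ℕ} {P : Pairing} {ℓ : ℕ} {Ω : Set (Vec n)} {𝒯 : Finset (Finset (Vec n))}
    (v : Vh m P ℓ Ω 𝒯) : SigmaPw m P ℓ 𝒯 :=
  Classical.epsilon fun ρ => IsGradRec v ρ

/-! ### Discrete energy, discrete stress, weak divergence -/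

/-- The discrete energy `E_h(v_h) = ∫_Ω W(R v_h) dx - ∫_Ω f · v_𝒯 dx`. -/
def discreteEnergy {m n : ℕ} {P : Pairing} {ℓ : ℕ} {Ω : Set (Vec n)}
    {𝒯 : Finset (Finset (Vec n))} (W : Mat m n → ℝ) (f : Vec n → Vec m)
    (v : Vh m P ℓ Ω 𝒯) : ℝ :=
  (∫ x in Ω, W (glue (R v) x)) - ∫ x in Ω, inner ℝ (f x) (glue v.1 x)

/-- `u` minimises `E_h` in `V_h`. -/
def IsDiscreteMinimizer {m n : ℕ} {P : Pairing} {ℓ : ℕ} {Ω : Set (Vec n)}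
    {𝒯 : Finset (Finset (Vec n))} (W : Mat m n → ℝ) (f : Vec n → Vec m)
    (u : Vh m P ℓ Ω 𝒯) : Prop :=
  ∀ v : Vh m P ℓ Ω 𝒯, discreteEnergy W f u ≤ discreteEnergy W f v

/-- The discrete stress `Π_Σ DW(R u_h)`. -/
def discreteStress {m n : ℕ} {P : Pairing} {ℓ : ℕ} {Ω : Set (Vec n)}
    {𝒯 : Finset (Finset (Vec n))} (W : Mat m n → ℝ) (u : Vh m P ℓ Ω 𝒯) : SigmaPw m P ℓ 𝒯 :=
  projSigma P ℓ Ω 𝒯 fun x => DW W (glue (R u) x)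

/-- `g` is the row-wise weak (distributional) divergence of `τ` in `Ω`. -/
def HasWeakDiv {m n : ℕ} (Ω : Set (Vec n)) (τ : Vec n → Mat m n) (g : Vec n → Vec m) : Prop :=
  ∀ (i : Fin m) (φ : Vec n → ℝ), ContDiff ℝ ∞ φ → HasCompactSupport φ → tsupport φ ⊆ Ω →
    ∫ x in Ω, inner ℝ (τ x i) (gradient φ x) = - ∫ x in Ω, g x i * φ x

/-- `τ ∈ W^q(div, Ω; 𝕄)`: `τ` and its weak divergence are in `L^q(Ω)`. -/
def MemWDiv {m n : ℕ} (q : ℝ) (Ω : Set (Vec n)) (τ : Vec n → Mat m n) : Prop :=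
  MemLp τ (ENNReal.ofReal q) (volume.restrict Ω) ∧
    ∃ g : Vec n → Vec m, MemLp g (ENNReal.ofReal q) (volume.restrict Ω) ∧ HasWeakDiv Ω τ g

/-- `Q(f, 𝒯)`: all `τ ∈ Σ(𝒯) ∩ W^q(div, Ω; 𝕄)` with `div τ = -Π_𝒯^ℓ f`. -/
def Q {m n : ℕ} (P : Pairing) (ℓ : ℕ) (q : ℝ) (Ω : Set (Vec n)) (𝒯 : Finset (Finset (Vec n)))
    (f : Vec n → Vec m) : Set (SigmaPw m P ℓ 𝒯) :=
  {τ | MemWDiv q Ω (glue τ) ∧ HasWeakDiv Ω (glue τ) (fun x => - glue (projPoly ℓ Ω 𝒯 f) x)}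

end HHO

end

namespace HHO

section

/-! ### Polynomial functions -/

/-! The problem is a finite-dimensional convex minimisation; the difficulty is that the constants
must not depend on the triangulation. They rest on a discrete Poincaré inequality, which bounds the
L^p norm of v_𝒯 by that of R v (`exists_poincare`, `exists_poincare_norm`).

Local stability. After integration by parts on a simplex T, the restriction of R v to T represents
the functional that maps σ to ∫_T ∇v·σ plus the side integrals of (v_F - v)(σ·ν)
(`localIdentity_R`). Two kinds of test functions in the Raviart-Thomas or Brezzi-Douglas-Marini
space exploit this. The field ∑_a λ_a (∇v·(a - x)) (a - x), with barycentric coordinates λ_a, has no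
normal trace on any side and controls ∇v (`exists_gradient_bound`). A lift of v_F - v from one side,
with zero normal trace on the others (`exists_normal_lift`), controls that difference by diam T
(`exists_local_bound`). The constants come from equivalence of norms on polynomials over the unit
simplex, transported by affine charts; shape regularity enters through the inscribed ball.

Poincaré inequality. Gauss' theorem for x_0 |v|^p in the direction of the coordinate x_0 expresses
∫_T |v|^p by side integrals and by ∫_T x_0 ∂_0 |v|^p. If v is replaced by v_F on the sides, the sum
of the side integrals over all simplices vanishes: the outer normals along an interior side add up
to zero (`sum_outerNormal_eq_zero`), and v_F = 0 on the boundary. The errors are controlled by local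
stability, and part of them is absorbed. Gauss' theorem on a simplex (`integral_fderiv_cell`)
follows from the fundamental theorem of calculus along the edges.

Minimisers. The lower growth of W and the Poincaré inequality make the energy coercive in R v, which
gives existence and the bound for R u_h. Convexity control makes W convex, whence the Euler-Lagrange
equations. For two minimisers they force the integral of W(B) - W(A) - DW(A):(B - A) to vanish, and
convexity control turns this into equality of the derivatives, which is (a).

Equilibrium. The Euler-Lagrange equations and the definition of R say that σ_h satisfies the
discrete equilibrium tested with V_h. The degrees match: normal jumps are polynomials of degree k on
the sides and the piecewise divergence has degree ℓ. So the jumps may be tested with themselves and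
vanish, and the divergence equals -Π f; this gives (b). The remaining bound in (c) combines |DW(A)|
≤ K (1 + |A|)^(p-1) with the maximum norm stability of the local L² projection
(`exists_projection_bound`). -/

lemma mem_poly_univ {n k : ℕ} {u : Vec n → ℝ} :
    u ∈ poly k univ ↔ ∃ q : MvPolynomial (Fin n) ℝ, q.totalDegree ≤ k ∧
      u = fun x => MvPolynomial.eval (fun i => x i) q := by
  constructor
  · rintro ⟨q, hq, rfl⟩
    exact ⟨q, hq, Set.indicator_univ _⟩
  · rintro ⟨q, hq, rfl⟩
    exact ⟨q, hq, (Set.indicator_univ _).symm⟩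

lemma mem_poly_iff {n k : ℕ} {K : Set (Vec n)} {g : Vec n → ℝ} :
    g ∈ poly k K ↔ ∃ u ∈ poly k univ, g = K.indicator u := by
  constructor
  · rintro ⟨q, hq, rfl⟩
    exact ⟨_, mem_poly_univ.2 ⟨q, hq, rfl⟩, rfl⟩
  · rintro ⟨u, hu, rfl⟩
    obtain ⟨q, hq, rfl⟩ := mem_poly_univ.1 hu
    exact ⟨q, hq, rfl⟩

lemma poly_mono {n k l : ℕ} (h : k ≤ l) {u : Vec n → ℝ} (hu : u ∈ poly k univ) :
    u ∈ poly l univ := by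
  obtain ⟨q, hq, rfl⟩ := mem_poly_univ.1 hu
  exact mem_poly_univ.2 ⟨q, hq.trans h, rfl⟩

lemma poly_const {n k : ℕ} (c : ℝ) : (fun _ : Vec n => c) ∈ poly k univ :=
  mem_poly_univ.2 ⟨MvPolynomial.C c, by simp, by simp⟩

lemma poly_coord {n : ℕ} (i : Fin n) : (fun x : Vec n => x i) ∈ poly 1 univ :=
  mem_poly_univ.2 ⟨MvPolynomial.X i, by simp, by simp⟩

lemma poly_mul {n k l : ℕ} {u w : Vec n → ℝ} (hu : u ∈ poly k univ) (hw : w ∈ poly l univ) :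
    (fun x => u x * w x) ∈ poly (k + l) univ := by
  obtain ⟨q, hq, rfl⟩ := mem_poly_univ.1 hu
  obtain ⟨r, hr, rfl⟩ := mem_poly_univ.1 hw
  exact mem_poly_univ.2 ⟨q * r, (MvPolynomial.totalDegree_mul q r).trans (by omega), by simp⟩

lemma poly_sum {n k : ℕ} {ι : Type*} (s : Finset ι) {u : ι → Vec n → ℝ}
    (hu : ∀ i ∈ s, u i ∈ poly k univ) : (fun x => ∑ i ∈ s, u i x) ∈ poly k univ := by
  have := Submodule.sum_mem (poly k univ) hu
  convert this using 1
  ext x; simp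

lemma poly_prod_pow {n : ℕ} {ι : Type*} (s : Finset ι) {u : ι → Vec n → ℝ}
    (hu : ∀ i ∈ s, u i ∈ poly 1 univ) (e : ι → ℕ) :
    (fun x => ∏ i ∈ s, u i x ^ e i) ∈ poly (∑ i ∈ s, e i) univ := by
  classical
  induction s using Finset.induction_on with
  | empty => simpa using poly_const (k := 0) 1
  | insert a s ha ih =>
    simp only [Finset.prod_insert ha, Finset.sum_insert ha]
    refine poly_mul ?_ (ih fun i hi => hu i (Finset.mem_insert_of_mem hi))
    have h1 := hu a (Finset.mem_insert_self a s)
    generalize e a = N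
    induction N with
    | zero => simpa using poly_const (k := 0) 1
    | succ N ihN =>
      simp only [pow_succ]
      exact poly_mul ihN h1

lemma poly_eq_sum {n : ℕ} (q : MvPolynomial (Fin n) ℝ) (x : Fin n → ℝ) :
    MvPolynomial.eval x q = ∑ e ∈ q.support, q.coeff e * ∏ i, x i ^ e i :=
  MvPolynomial.eval_eq' x q

lemma sum_le_totalDegree {n : ℕ} {q : MvPolynomial (Fin n) ℝ} {e : Fin n →₀ ℕ}
    (he : e ∈ q.support) : ∑ i, e i ≤ q.totalDegree := by
  have := MvPolynomial.le_totalDegree he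
  rwa [Finsupp.sum_fintype _ _ (fun _ => rfl)] at this

/-- Affine substitutions do not raise the degree. Hence polynomials on any simplex pull back to one
fixed space on the unit simplex. -/
lemma poly_comp {n d k : ℕ} {u : Vec n → ℝ} (hu : u ∈ poly k univ) {φ : Vec d → Vec n}
    (hφ : ∀ i, (fun y => φ y i) ∈ poly 1 univ) : (fun y => u (φ y)) ∈ poly k univ := by
  obtain ⟨q, hq, rfl⟩ := mem_poly_univ.1 hu
  simp only [poly_eq_sum]
  refine poly_sum _ fun e he => ?_
  refine (poly k univ).smul_mem (q.coeff e) (poly_mono ?_ (poly_prod_pow Finset.univ (fun i _ => hφ i) e))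
  exact (sum_le_totalDegree he).trans hq

lemma poly_contDiff {n k : ℕ} {u : Vec n → ℝ} (hu : u ∈ poly k univ) {N : WithTop ℕ∞} :
    ContDiff ℝ N u := by
  obtain ⟨q, hq, rfl⟩ := mem_poly_univ.1 hu
  simp only [poly_eq_sum]
  refine ContDiff.sum fun e _ => contDiff_const.mul (contDiff_prod fun i _ => ContDiff.pow ?_ _)
  fun_prop

lemma poly_continuous {n k : ℕ} {u : Vec n → ℝ} (hu : u ∈ poly k univ) : Continuous u :=
  (poly_contDiff (N := 0) hu).continuous

lemma poly_differentiable {n k : ℕ} {u : Vec n → ℝ} (hu : u ∈ poly k univ) :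
    Differentiable ℝ u :=
  (poly_contDiff (N := 1) hu).differentiable (by simp)

lemma poly_affine {n : ℕ} (L : Vec n →ᵃ[ℝ] ℝ) : (fun x => L x) ∈ poly 1 univ := by
  have h : (fun x => L x) = fun x : Vec n =>
      ∑ i, (L.linear (EuclideanSpace.single i 1)) * x i + L 0 := by
    funext x
    have h1 : L x = L.linear x + L 0 := by
      have := L.map_vadd 0 x
      simpa using this
    have h2 : x = ∑ i, x i • EuclideanSpace.single i (1 : ℝ) := by
      ext j
      simp [Finset.sum_apply, Pi.single_apply]
    rw [h1]
    conv_lhs => rw [h2]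
    simp [map_sum, mul_comm]
  rw [h]
  refine (poly 1 univ).add_mem (x := fun x : Vec n => ∑ i, (L.linear (EuclideanSpace.single i 1)) * x i) (poly_sum _ fun i _ => ?_) (poly_const _)
  exact (poly 1 univ).smul_mem _ (poly_coord i)

lemma poly_inner {n k : ℕ} {g : Vec n → Vec n} (hg : ∀ i, (fun x => g x i) ∈ poly k univ)
    (e : Vec n) : (fun x => inner ℝ (g x) e) ∈ poly k univ := by
  simp only [PiLp.inner_apply]
  refine poly_sum _ fun i _ => ?_
  exact (poly k univ).smul_mem (e i) (hg i)

lemma totalDegree_pderiv_le {n : ℕ} (q : MvPolynomial (Fin n) ℝ) (i : Fin n) {k : ℕ}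
    (hq : q.totalDegree ≤ k + 1) : (MvPolynomial.pderiv i q).totalDegree ≤ k := by
  conv_lhs => rw [q.as_sum]
  rw [map_sum]
  refine MvPolynomial.totalDegree_finsetSum_le fun e he => ?_
  rw [MvPolynomial.pderiv_monomial]
  by_cases h0 : e i = 0
  · simp [h0]
  refine (MvPolynomial.totalDegree_monomial_le _ _).trans ?_
  have h1 := (sum_le_totalDegree he).trans hq
  rw [Finsupp.sum_fintype _ _ (fun _ => rfl)]
  rw [← Finset.add_sum_erase _ _ (Finset.mem_univ i)] at h1 ⊢
  have h2 : ∑ x ∈ Finset.univ.erase i, (e - Finsupp.single i 1 : Fin n →₀ ℕ) x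
      ≤ ∑ x ∈ Finset.univ.erase i, e x :=
    Finset.sum_le_sum fun x _ => by simp
  have h3 : (e - Finsupp.single i 1 : Fin n →₀ ℕ) i = e i - 1 := by simp
  simp only [id] at *
  omega

lemma hasFDerivAt_eval {n : ℕ} (q : MvPolynomial (Fin n) ℝ) (x : Vec n) :
    HasFDerivAt (fun x : Vec n => MvPolynomial.eval (fun i => x i) q)
      (∑ i, MvPolynomial.eval (fun i => x i) (MvPolynomial.pderiv i q) •
        (EuclideanSpace.proj i : Vec n →L[ℝ] ℝ)) x := by
  induction q using MvPolynomial.induction_on with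
  | C a => simpa using hasFDerivAt_const a x
  | add p q hp hq =>
    simp only [map_add, add_smul, Finset.sum_add_distrib]
    exact hp.add hq
  | mul_X p j hp =>
    have hX : HasFDerivAt (fun x : Vec n => x j) (EuclideanSpace.proj j : Vec n →L[ℝ] ℝ) x :=
      (EuclideanSpace.proj j : Vec n →L[ℝ] ℝ).hasFDerivAt
    have := hp.mul hX
    simp only [map_mul, MvPolynomial.eval_X]
    refine this.congr_fderiv ?_
    ext y
    simp [Derivation.leibniz, Finset.mul_sum, Finset.sum_add_distrib, add_mul, mul_assoc,
      MvPolynomial.pderiv_X, Pi.single_apply, apply_ite, ite_mul]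

lemma poly_fderiv {n k : ℕ} {u : Vec n → ℝ} (hu : u ∈ poly (k + 1) univ) (e : Vec n) :
    (fun x => fderiv ℝ u x e) ∈ poly k univ := by
  obtain ⟨q, hq, rfl⟩ := mem_poly_univ.1 hu
  simp only [(hasFDerivAt_eval q _).fderiv]
  simp only [FunLike.coe_sum, Finset.sum_apply, FunLike.coe_smul,
    Pi.smul_apply, smul_eq_mul]
  refine poly_sum _ fun i _ => ?_
  simp only [mul_comm _ ((EuclideanSpace.proj i : Vec n →L[ℝ] ℝ) e)]
  exact (poly k univ).smul_mem _ (mem_poly_univ.2 ⟨_, totalDegree_pderiv_le q i hq, rfl⟩)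

lemma fderiv_poly_zero {n : ℕ} {u : Vec n → ℝ} (hu : u ∈ poly 0 univ) (x : Vec n) :
    fderiv ℝ u x = 0 := by
  obtain ⟨q, hq, rfl⟩ := mem_poly_univ.1 hu
  rw [MvPolynomial.totalDegree_eq_zero_iff_eq_C.1 (Nat.le_zero.1 hq)]
  simp

instance poly_finite {n k : ℕ} (K : Set (Vec n)) : Module.Finite ℝ (poly k K) := by
  let f : MvPolynomial.restrictTotalDegree (Fin n) ℝ k →ₗ[ℝ] (Vec n → ℝ) :=
    { toFun := fun q => K.indicator fun x => MvPolynomial.eval (fun i => x i) q.1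
      map_add' := by
        intro a b; ext x; by_cases hx : x ∈ K <;> simp [hx]
      map_smul' := by
        intro a b; ext x; by_cases hx : x ∈ K <;> simp [hx] }
  have : poly k K = LinearMap.range f := by
    ext g
    constructor
    · rintro ⟨q, hq, rfl⟩
      exact ⟨⟨q, (MvPolynomial.mem_restrictTotalDegree _ _ _).2 hq⟩, rfl⟩
    · rintro ⟨q, rfl⟩
      exact ⟨q.1, (MvPolynomial.mem_restrictTotalDegree _ _ _).1 q.2, rfl⟩
  rw [this]
  infer_instance

/-- This is the identity theorem for analytic functions. It makes integrals over simplices definite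
on polynomial spaces. -/
lemma poly_eq_zero_of_open {n k : ℕ} {u : Vec n → ℝ} (hu : u ∈ poly k univ) {U : Set (Vec n)}
    (hU : IsOpen U) (hne : U.Nonempty) (h0 : ∀ x ∈ U, u x = 0) : u = 0 := by
  obtain ⟨q, hq, rfl⟩ := mem_poly_univ.1 hu
  obtain ⟨x₀, hx₀⟩ := hne
  have han : AnalyticOnNhd ℝ (fun x : Vec n => MvPolynomial.eval (fun i => x i) q) univ :=
    AnalyticOnNhd.eval_linearMap' (fun i => (EuclideanSpace.proj i : Vec n →L[ℝ] ℝ).toLinearMap) q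
  refine han.eq_of_eventuallyEq (g := 0) (fun x _ => analyticAt_const) (z₀ := x₀) ?_
  filter_upwards [hU.mem_nhds hx₀] with x hx using h0 x hx

end

section

/-! ### Bounds on the reference simplex -/

/-- Linear maps on a finite-dimensional normed space are bounded. The norm axioms are hypotheses on
`N` because the norm will be an integral that varies with the application. -/
lemma exists_repr_bound {V : Type*} [AddCommGroup V] [Module ℝ V] [FiniteDimensional ℝ V]
    (N : V → ℝ) (hN0 : ∀ v, 0 ≤ N v) (hsmul : ∀ (c : ℝ) v, N (c • v) = |c| * N v)
    (hadd : ∀ v w, N (v + w) ≤ N v + N w) (hdef : ∀ v, N v = 0 → v = 0) :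
    ∃ C : ℝ, 0 ≤ C ∧ ∀ v j, |(Module.finBasis ℝ V).repr v j| ≤ C * N v := by
  let _ : Norm V := ⟨N⟩
  have core : NormedSpace.Core ℝ V :=
    { norm_nonneg := hN0
      norm_smul := fun c x => hsmul c x
      norm_triangle := hadd
      norm_eq_zero_iff := fun x => ⟨hdef x, by
        rintro rfl
        have := hsmul 0 0
        rw [zero_smul, abs_zero, zero_mul] at this
        exact this⟩ }
  let _ : NormedAddCommGroup V := NormedAddCommGroup.ofCore core
  let _ : NormedSpace ℝ V := NormedSpace.ofCore core
  let f : V →L[ℝ] (Fin (Module.finrank ℝ V) → ℝ) :=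
    (Module.finBasis ℝ V).equivFun.toLinearMap.toContinuousLinearMap
  refine ⟨‖f‖, norm_nonneg _, fun v j => ?_⟩
  calc |(Module.finBasis ℝ V).repr v j| = ‖f v j‖ := rfl
    _ ≤ ‖f v‖ := norm_le_pi_norm _ _
    _ ≤ ‖f‖ * ‖v‖ := f.le_opNorm v

/-- The unit simplex in `ℝᵈ`. -/
def refSimplex (d : ℕ) : Set (Vec d) := {y | (∀ i, 0 ≤ y i) ∧ ∑ i, y i ≤ 1}

/-- The interior of the unit simplex. -/
def refOpen (d : ℕ) : Set (Vec d) := {y | (∀ i, 0 < y i) ∧ ∑ i, y i < 1}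

lemma refOpen_subset (d : ℕ) : refOpen d ⊆ refSimplex d :=
  fun _ hy => ⟨fun i => (hy.1 i).le, hy.2.le⟩

lemma isClosed_refSimplex (d : ℕ) : IsClosed (refSimplex d) := by
  have h : refSimplex d = (⋂ i, {y : Vec d | 0 ≤ y i}) ∩ {y | ∑ i, y i ≤ 1} := by
    ext y; simp [refSimplex]
  rw [h]
  refine (isClosed_iInter fun i => isClosed_le continuous_const (by fun_prop)).inter
    (isClosed_le (by fun_prop) continuous_const)

lemma isOpen_refOpen (d : ℕ) : IsOpen (refOpen d) := by
  have h : refOpen d = (⋂ i, {y : Vec d | 0 < y i}) ∩ {y | ∑ i, y i < 1} := by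
    ext y; simp [refOpen]
  rw [h]
  refine (isOpen_iInter_of_finite fun i => isOpen_lt continuous_const (by fun_prop)).inter
    (isOpen_lt (by fun_prop) continuous_const)

lemma refOpen_nonempty (d : ℕ) : (refOpen d).Nonempty := by
  refine ⟨WithLp.toLp 2 fun _ => ((d : ℝ) + 1)⁻¹, fun i => by simp; positivity, ?_⟩
  simp only [Finset.sum_const, Finset.card_univ, Fintype.card_fin, nsmul_eq_mul]
  rw [mul_inv_lt_iff₀ (by positivity)]
  linarith

lemma le_one_of_mem_refSimplex {d : ℕ} {y : Vec d} (hy : y ∈ refSimplex d) (i : Fin d) :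
    y i ≤ 1 :=
  (Finset.single_le_sum (fun j _ => hy.1 j) (Finset.mem_univ i)).trans hy.2

lemma isCompact_refSimplex (d : ℕ) : IsCompact (refSimplex d) := by
  refine Metric.isCompact_of_isClosed_isBounded (isClosed_refSimplex d) ?_
  refine (Metric.isBounded_closedBall (x := (0 : Vec d)) (r := d)).subset fun y hy => ?_
  rw [mem_closedBall_zero_iff, EuclideanSpace.norm_eq]
  refine Real.sqrt_le_iff.2 ⟨by positivity, ?_⟩
  calc ∑ i, ‖y i‖ ^ 2 ≤ ∑ i : Fin d, (1 : ℝ) := by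
        refine Finset.sum_le_sum fun i _ => ?_
        rw [Real.norm_eq_abs, sq_abs]
        have := hy.1 i
        have := le_one_of_mem_refSimplex hy i
        nlinarith
    _ = d := by simp
    _ ≤ (d : ℝ) ^ 2 := by exact_mod_cast Nat.le_self_pow (by norm_num) d

lemma convex_refSimplex (d : ℕ) : Convex ℝ (refSimplex d) := by
  intro x hx y hy a b ha hb hab
  refine ⟨fun i => ?_, ?_⟩
  · have := hx.1 i
    have := hy.1 i
    simp only [PiLp.add_apply, PiLp.smul_apply, smul_eq_mul]
    positivity
  · simp only [PiLp.add_apply, PiLp.smul_apply, smul_eq_mul, Finset.sum_add_distrib,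
      ← Finset.mul_sum]
    have := hx.2
    have := hy.2
    nlinarith

lemma volume_refSimplex_pos (d : ℕ) : 0 < (volume : Measure (Vec d)).real (refSimplex d) := by
  have h1 : 0 < volume (refSimplex d) :=
    ((isOpen_refOpen d).measure_pos volume (refOpen_nonempty d)).trans_le
      (measure_mono (refOpen_subset d))
  exact ENNReal.toReal_pos h1.ne' (isCompact_refSimplex d).measure_lt_top.ne

/-- The weighted integral is a norm: where it vanishes, the polynomial vanishes on the open simplex,
on which the weight is positive. Its coordinates with respect to a fixed basis are therefore bounded
by this norm. -/
lemma exists_coeff_bound (d k : ℕ) {β : Vec d → ℝ} (hβ : Continuous β)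
    (hβ0 : ∀ y ∈ refSimplex d, 0 ≤ β y) (hβpos : ∀ y ∈ refOpen d, 0 < β y) :
    ∃ (N : ℕ) (b : Fin N → Vec d → ℝ) (C : ℝ), 0 ≤ C ∧ (∀ j, b j ∈ poly k univ) ∧
      ∀ u ∈ poly k univ, ∃ c : Fin N → ℝ, (∀ y, u y = ∑ j, c j * b j y) ∧
        ∀ j, |c j| ≤ C * ∫ y in refSimplex d, β y * |u y| := by
  have hint : ∀ u : poly k (univ : Set (Vec d)),
      IntegrableOn (fun y => β y * |u.1 y|) (refSimplex d) := fun u =>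
    (hβ.mul (poly_continuous u.2).abs).continuousOn.integrableOn_compact (isCompact_refSimplex d)
  have hms := (isClosed_refSimplex d).measurableSet
  obtain ⟨C, hC, h⟩ := exists_repr_bound (V := poly k (univ : Set (Vec d)))
    (fun u => ∫ y in refSimplex d, β y * |u.1 y|)
    (fun u => setIntegral_nonneg hms fun y hy => mul_nonneg (hβ0 y hy) (abs_nonneg _))
    (fun c u => by
      rw [← integral_const_mul]
      congr 1
      ext y
      simp [abs_mul]
      ring)
    (fun u w => by
      rw [← integral_add (hint u) (hint w)]
      refine setIntegral_mono_on (hint (u + w)) ((hint u).add (hint w)) hms fun y hy => ?_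
      rw [← mul_add]
      exact mul_le_mul_of_nonneg_left (abs_add_le _ _) (hβ0 y hy))
    (fun u hu => by
      have h0 := (setIntegral_eq_zero_iff_of_nonneg_ae
        ((ae_restrict_iff' hms).2 (Filter.Eventually.of_forall fun y hy =>
          mul_nonneg (hβ0 y hy) (abs_nonneg _))) (hint u)).1 hu
      have h1 : EqOn (fun y => β y * |u.1 y|) 0 (refOpen d) :=
        Measure.eqOn_open_of_ae_eq (ae_restrict_of_ae_restrict_of_subset (refOpen_subset d) h0)
          (isOpen_refOpen d) (hβ.mul (poly_continuous u.2).abs).continuousOn continuousOn_const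
      refine Subtype.ext (poly_eq_zero_of_open u.2 (isOpen_refOpen d) (refOpen_nonempty d) ?_)
      intro y hy
      have h2 := h1 hy
      simpa [(hβpos y hy).ne'] using h2)
  refine ⟨_, fun j => (Module.finBasis ℝ (poly k (univ : Set (Vec d))) j).1, C, hC,
    fun j => (Module.finBasis ℝ (poly k (univ : Set (Vec d))) j).2, fun u hu =>
    ⟨fun j => (Module.finBasis ℝ (poly k (univ : Set (Vec d)))).repr ⟨u, hu⟩ j,
      fun y => ?_, fun j => h ⟨u, hu⟩ j⟩⟩
  have h3 := congrFun (congrArg (poly k (univ : Set (Vec d))).subtype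
    ((Module.finBasis ℝ (poly k (univ : Set (Vec d)))).sum_repr ⟨u, hu⟩)) y
  rw [map_sum, Finset.sum_apply] at h3
  exact h3.symm

lemma exists_bound_refSimplex {d N : ℕ} {b : Fin N → Vec d → ℝ} (hb : ∀ j, Continuous (b j)) :
    ∃ K : ℝ, 0 ≤ K ∧ ∀ j, ∀ y ∈ refSimplex d, |b j y| ≤ K := by
  have h : ∀ j, ∃ K : ℝ, ∀ y ∈ refSimplex d, |b j y| ≤ K := fun j => by
    obtain ⟨K, hK⟩ := (isCompact_refSimplex d).exists_bound_of_continuousOn (hb j).continuousOn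
    exact ⟨K, fun y hy => hK y hy⟩
  choose K hK using h
  refine ⟨∑ j, |K j|, Finset.sum_nonneg fun _ _ => abs_nonneg _, fun j y hy => ?_⟩
  exact (hK j y hy).trans ((le_abs_self _).trans
    (Finset.single_le_sum (f := fun j => |K j|) (fun _ _ => abs_nonneg _) (Finset.mem_univ j)))

lemma exists_sup_le_weighted (d k : ℕ) {β : Vec d → ℝ} (hβ : Continuous β)
    (hβ0 : ∀ y ∈ refSimplex d, 0 ≤ β y) (hβpos : ∀ y ∈ refOpen d, 0 < β y) :
    ∃ C : ℝ, 0 ≤ C ∧ ∀ u ∈ poly k univ, ∀ y ∈ refSimplex d,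
      |u y| ≤ C * ∫ y in refSimplex d, β y * |u y| := by
  obtain ⟨N, b, C, hC, hb, h⟩ := exists_coeff_bound d k hβ hβ0 hβpos
  obtain ⟨K, hK0, hK⟩ := exists_bound_refSimplex fun j => poly_continuous (hb j)
  refine ⟨N * K * C, by positivity, fun u hu y hy => ?_⟩
  obtain ⟨c, hc, hcb⟩ := h u hu
  rw [hc y]
  calc |∑ j, c j * b j y| ≤ ∑ j, |c j| * |b j y| := by
        simpa [abs_mul] using Finset.abs_sum_le_sum_abs (fun j => c j * b j y) Finset.univ
    _ ≤ ∑ j : Fin N, (C * ∫ y in refSimplex d, β y * |u y|) * K := by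
        refine Finset.sum_le_sum fun j _ => ?_
        exact mul_le_mul (hcb j) (hK j y hy) (abs_nonneg _) ((abs_nonneg _).trans (hcb j))
    _ = _ := by simp; ring

/-- On the unit simplex, the pointwise values of polynomials are controlled by weighted `Lᵖ`
norms. -/
lemma exists_rpow_le_weighted (d k : ℕ) {β : Vec d → ℝ} (hβ : Continuous β)
    (hβ0 : ∀ y ∈ refSimplex d, 0 ≤ β y) (hβpos : ∀ y ∈ refOpen d, 0 < β y) {p : ℝ} (hp : 1 ≤ p) :
    ∃ C : ℝ, 0 < C ∧ ∀ u ∈ poly k univ, ∀ y ∈ refSimplex d,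
      |u y| ^ p ≤ C * ∫ y in refSimplex d, β y * |u y| ^ p := by
  obtain ⟨C, hC, h⟩ := exists_sup_le_weighted d k hβ hβ0 hβpos
  have hms := (isClosed_refSimplex d).measurableSet
  set B := ∫ y in refSimplex d, β y with hB
  have hB0 : 0 ≤ B := setIntegral_nonneg hms hβ0
  -- The summand 1 only makes the constant positive.
  refine ⟨(C * (B + 1)) ^ p + 1, by positivity, fun u hu y hy => ?_⟩
  have hp0 : 0 < p := by linarith
  have hu' := poly_continuous hu
  set A := ∫ y in refSimplex d, β y * |u y| ^ p with hA
  have hA0 : 0 ≤ A := setIntegral_nonneg hms fun y hy => mul_nonneg (hβ0 y hy) (by positivity)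
  have hiA : IntegrableOn (fun y => β y * |u y| ^ p) (refSimplex d) :=
    (hβ.mul (hu'.abs.rpow_const fun _ => Or.inr hp0.le)).continuousOn.integrableOn_compact
      (isCompact_refSimplex d)
  have hiB : IntegrableOn β (refSimplex d) :=
    hβ.continuousOn.integrableOn_compact (isCompact_refSimplex d)
  have hi1 : IntegrableOn (fun y => β y * |u y|) (refSimplex d) :=
    (hβ.mul hu'.abs).continuousOn.integrableOn_compact (isCompact_refSimplex d)
  -- The pointwise bound |u| ≤ s + s^(1-p) |u|^p, by comparison of |u| with s, takes the place of
  -- Hölder's inequality. The parameter s tends to zero if A = 0.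
  have key : ∀ s : ℝ, 0 < s → |u y| ≤ C * (s * B + s ^ (1 - p) * A) := by
    intro s hs
    refine (h u hu y hy).trans (mul_le_mul_of_nonneg_left ?_ hC)
    rw [hB, hA, ← integral_const_mul, ← integral_const_mul,
      ← integral_add (hiB.const_mul s) (hiA.const_mul _)]
    refine setIntegral_mono_on hi1 ((hiB.const_mul s).add (hiA.const_mul _)) hms fun z hz => ?_
    have hz0 := hβ0 z hz
    have : |u z| ≤ s + s ^ (1 - p) * |u z| ^ p := by
      rcases le_total (|u z|) s with h1 | h1
      · have : 0 ≤ s ^ (1 - p) * |u z| ^ p := by positivity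
        linarith
      · have hpos : 0 < |u z| := hs.trans_le h1
        have h2 : |u z| ^ (1 - p) ≤ s ^ (1 - p) :=
          Real.rpow_le_rpow_of_nonpos hs h1 (by linarith)
        have h3 : |u z| = |u z| ^ (1 - p) * |u z| ^ p := by
          rw [← Real.rpow_add hpos]; simp
        have h4 : |u z| ^ (1 - p) * |u z| ^ p ≤ s ^ (1 - p) * |u z| ^ p :=
          mul_le_mul_of_nonneg_right h2 (by positivity)
        linarith
    nlinarith [mul_le_mul_of_nonneg_left this hz0]
  rcases hA0.eq_or_lt with h0 | hpos
  · have : |u y| ≤ 0 := by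
      refine le_of_forall_pos_le_add fun ε hε => ?_
      have := key (ε / (C * B + 1)) (by positivity)
      rw [← h0, mul_zero, add_zero] at this
      refine this.trans ?_
      rw [zero_add, ← mul_assoc, mul_comm C, mul_assoc, div_mul_eq_mul_div, div_le_iff₀ (by positivity)]
      nlinarith
    rw [le_antisymm this (abs_nonneg _), Real.zero_rpow hp0.ne', ← h0, mul_zero]
  -- With s = A^(1/p) both terms are multiples of A^(1/p).
  · have h1 := key (A ^ (1 / p)) (by positivity)
    have h2 : (A ^ (1 / p)) ^ (1 - p) * A = A ^ (1 / p) := by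
      rw [← Real.rpow_mul hpos.le]
      nth_rewrite 2 [← Real.rpow_one A]
      rw [← Real.rpow_add hpos]
      congr 1
      field_simp
      ring
    rw [h2] at h1
    have h3 : |u y| ≤ C * (B + 1) * A ^ (1 / p) := by linarith
    calc |u y| ^ p ≤ (C * (B + 1) * A ^ (1 / p)) ^ p :=
          Real.rpow_le_rpow (abs_nonneg _) h3 hp0.le
      _ = (C * (B + 1)) ^ p * A := by
          rw [Real.mul_rpow (by positivity) (by positivity), ← Real.rpow_mul hpos.le]
          congr 2
          rw [one_div, inv_mul_cancel₀ hp0.ne', Real.rpow_one]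
      _ ≤ _ := by nlinarith

/-- It suffices to treat monomials. The constant 1 is the sum of all barycentric coordinates, and
any other monomial contains a variable that can be split off. The factorisation is needed for the
lift in the Brezzi-Douglas-Marini case, where each barycentric coordinate is paired with an edge
vector. -/
lemma exists_barycentric_decomp {d l : ℕ} {u : Vec d → ℝ} (hu : u ∈ poly (l + 1) univ) :
    ∃ (w₀ : Vec d → ℝ) (w : Fin d → Vec d → ℝ), w₀ ∈ poly l univ ∧ (∀ i, w i ∈ poly l univ) ∧
      ∀ y, u y = (1 - ∑ i, y i) * w₀ y + ∑ i, y i * w i y := by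
  obtain ⟨q, hq, rfl⟩ := mem_poly_univ.1 hu
  have hmono : ∀ e : Fin d →₀ ℕ, e ∈ q.support →
      ∃ (w₀ : Vec d → ℝ) (w : Fin d → Vec d → ℝ), w₀ ∈ poly l univ ∧ (∀ i, w i ∈ poly l univ) ∧
      ∀ y : Vec d, ∏ i, y i ^ e i = (1 - ∑ i, y i) * w₀ y + ∑ i, y i * w i y := by
    intro e he
    have hdeg := (sum_le_totalDegree he).trans hq
    by_cases h0 : ∀ i, e i = 0
    · refine ⟨fun _ => 1, fun _ _ => 1, poly_const 1, fun _ => poly_const 1, fun y => ?_⟩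
      simp [h0]
    · push Not at h0
      obtain ⟨i, hi⟩ := h0
      refine ⟨0, Pi.single i fun y => ∏ j, y j ^ (Function.update e i (e i - 1) j),
        Submodule.zero_mem _, fun j => ?_, fun y => ?_⟩
      · by_cases hj : j = i
        · subst hj
          simp only [Pi.single_eq_same]
          refine poly_mono ?_ (poly_prod_pow Finset.univ (fun i _ => poly_coord i) _)
          rw [← Finset.add_sum_erase _ _ (Finset.mem_univ j)] at hdeg ⊢
          have : ∑ x ∈ Finset.univ.erase j, Function.update (⇑e) j (e j - 1) x
              = ∑ x ∈ Finset.univ.erase j, e x :=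
            Finset.sum_congr rfl fun x hx => by
              rw [Function.update_of_ne (Finset.ne_of_mem_erase hx)]
          rw [this, Function.update_self]
          omega
        · rw [Pi.single_eq_of_ne hj]
          exact Submodule.zero_mem _
      · have hsum : ∀ g : Vec d → ℝ,
            ∑ j, y j * (Pi.single i g : Fin d → Vec d → ℝ) j y = y i * g y := by
          intro g
          rw [Finset.sum_eq_single_of_mem i (Finset.mem_univ i), Pi.single_eq_same]
          intro j _ hj
          rw [Pi.single_eq_of_ne hj]
          simp
        rw [hsum, Pi.zero_apply, mul_zero, zero_add,
          ← Finset.mul_prod_erase _ _ (Finset.mem_univ i),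
          ← Finset.mul_prod_erase _ (fun j => y j ^ (Function.update (⇑e) i (e i - 1) j))
            (Finset.mem_univ i), Function.update_self, ← mul_assoc, ← pow_succ',
          Nat.sub_add_cancel (Nat.one_le_iff_ne_zero.2 hi)]
        congr 1
        exact Finset.prod_congr rfl fun x hx => by
          rw [Function.update_of_ne (Finset.ne_of_mem_erase hx)]
  choose! w₀ w h₀ h₁ h₂ using hmono
  refine ⟨fun y => ∑ e ∈ q.support, q.coeff e * w₀ e y,
    fun i y => ∑ e ∈ q.support, q.coeff e * w e i y,
    poly_sum _ fun e he => (poly l univ).smul_mem _ (h₀ e he),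
    fun i => poly_sum _ fun e he => (poly l univ).smul_mem _ (h₁ e he i), fun y => ?_⟩
  refine (poly_eq_sum q _).trans ?_
  rw [Finset.sum_congr rfl fun e he => by rw [h₂ e he y]]
  simp only [mul_add, Finset.sum_add_distrib, Finset.mul_sum]
  congr 1
  · exact Finset.sum_congr rfl fun e _ => by ring
  · rw [Finset.sum_comm]
    exact Finset.sum_congr rfl fun e _ => Finset.sum_congr rfl fun e _ => by ring

/-- Only a fixed basis is decomposed, so the factors are linear in the coefficients of u, and these
are controlled by the integral of |u|, hence by s. -/
lemma exists_barycentric_decomp_bound (d l : ℕ) :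
    ∃ C : ℝ, 0 ≤ C ∧ ∀ u ∈ poly (l + 1) univ, ∀ s : ℝ, (∀ y ∈ refSimplex d, |u y| ≤ s) →
    ∃ (w₀ : Vec d → ℝ) (w : Fin d → Vec d → ℝ), w₀ ∈ poly l univ ∧ (∀ i, w i ∈ poly l univ) ∧
      (∀ y, u y = (1 - ∑ i, y i) * w₀ y + ∑ i, y i * w i y) ∧
      ∀ y ∈ refSimplex d, |w₀ y| ≤ C * s ∧ ∀ i, |w i y| ≤ C * s := by
  obtain ⟨N, b, C, hC, hb, h⟩ := exists_coeff_bound d (l + 1) (β := fun _ => 1) continuous_const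
    (fun _ _ => zero_le_one) (fun _ _ => zero_lt_one)
  choose w₀ w hw₀ hw hdec using fun j => exists_barycentric_decomp (hb j)
  obtain ⟨K₀, hK₀0, hK₀⟩ := exists_bound_refSimplex fun j => poly_continuous (hw₀ j)
  choose K hK0 hK using fun i => exists_bound_refSimplex fun j => poly_continuous (hw j i)
  set V := (volume : Measure (Vec d)).real (refSimplex d)
  have hKs : ∀ i, K i ≤ K₀ + ∑ i, K i := fun i =>
    (Finset.single_le_sum (f := K) (fun i _ => hK0 i) (Finset.mem_univ i)).trans (by linarith)
  have hKt : 0 ≤ ∑ i, K i := Finset.sum_nonneg fun i _ => hK0 i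
  refine ⟨N * (C * V) * (K₀ + ∑ i, K i), by positivity, fun u hu s hs => ?_⟩
  obtain ⟨c, hc, hcb⟩ := h u hu
  have hI : ∫ y in refSimplex d, 1 * |u y| ≤ V * s := by
    calc ∫ y in refSimplex d, 1 * |u y| ≤ ∫ y in refSimplex d, s := by
          refine setIntegral_mono_on ?_ ?_ (isClosed_refSimplex d).measurableSet fun y hy => by
            simpa using hs y hy
          · exact (continuous_const.mul (poly_continuous hu).abs).continuousOn.integrableOn_compact
              (isCompact_refSimplex d)
          · exact continuousOn_const.integrableOn_compact (isCompact_refSimplex d)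
      _ = V * s := by simp [V]
  have hcb' : ∀ j, |c j| ≤ C * V * s := fun j =>
    (hcb j).trans (by rw [mul_assoc]; exact mul_le_mul_of_nonneg_left hI hC)
  have hbound : ∀ (g : Fin N → Vec d → ℝ) (κ : ℝ), κ ≤ K₀ + ∑ i, K i →
      (∀ j, ∀ y ∈ refSimplex d, |g j y| ≤ κ) →
      ∀ y ∈ refSimplex d, |∑ j, c j * g j y| ≤ N * (C * V) * (K₀ + ∑ i, K i) * s := by
    intro g κ hκ hg y hy
    calc |∑ j, c j * g j y| ≤ ∑ j, |c j| * |g j y| := by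
          simpa [abs_mul] using Finset.abs_sum_le_sum_abs (fun j => c j * g j y) Finset.univ
      _ ≤ ∑ j : Fin N, (C * V * s) * (K₀ + ∑ i, K i) :=
          Finset.sum_le_sum fun j _ => mul_le_mul (hcb' j) ((hg j y hy).trans hκ) (abs_nonneg _)
            ((abs_nonneg _).trans (hcb' j))
      _ = _ := by simp; ring
  refine ⟨fun y => ∑ j, c j * w₀ j y, fun i y => ∑ j, c j * w j i y,
    poly_sum _ fun j _ => (poly l univ).smul_mem _ (hw₀ j),
    fun i => poly_sum _ fun j _ => (poly l univ).smul_mem _ (hw j i), fun y => ?_,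
    fun y hy => ⟨hbound _ K₀ (by linarith) hK₀ y hy,
      fun i => hbound _ (K i) (hKs i) (hK i) y hy⟩⟩
  rw [hc y, Finset.sum_congr rfl fun j _ => by rw [hdec j y]]
  simp only [mul_add, Finset.sum_add_distrib, Finset.mul_sum]
  congr 1
  · exact Finset.sum_congr rfl fun e _ => by ring
  · rw [Finset.sum_comm]
    exact Finset.sum_congr rfl fun e _ => Finset.sum_congr rfl fun e _ => by ring

end

section

/-! ### Parametrised simplices -/

/-- The linear map sending the `i`-th unit vector to `t i`. -/
noncomputable def edgeMap {d n : ℕ} (t : Fin d → Vec n) : Vec d →ₗ[ℝ] Vec n where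
  toFun y := ∑ i, y i • t i
  map_add' x y := by simp [add_smul, Finset.sum_add_distrib]
  map_smul' c y := by simp [mul_smul, Finset.smul_sum]

lemma edgeMap_apply {d n : ℕ} (t : Fin d → Vec n) (y : Vec d) : edgeMap t y = ∑ i, y i • t i := rfl

/-- The affine map of the unit simplex onto the simplex with vertices `z` and `x i`. -/
noncomputable def chart {d n : ℕ} (z : Vec n) (x : Fin d → Vec n) (y : Vec d) : Vec n :=
  z + edgeMap (fun i => x i - z) y

lemma chart_apply {d n : ℕ} (z : Vec n) (x : Fin d → Vec n) (y : Vec d) :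
    chart z x y = z + ∑ i, y i • (x i - z) := rfl

lemma chart_eq {d n : ℕ} (z : Vec n) (x : Fin d → Vec n) (y : Vec d) :
    chart z x y = (1 - ∑ i, y i) • z + ∑ i, y i • x i := by
  simp only [chart_apply, smul_sub, Finset.sum_sub_distrib, ← Finset.sum_smul, sub_smul, one_smul]
  abel

lemma continuous_chart {d n : ℕ} (z : Vec n) (x : Fin d → Vec n) : Continuous (chart z x) := by
  unfold chart
  exact continuous_const.add (LinearMap.continuous_of_finiteDimensional _)

lemma chart_coord {d n : ℕ} (z : Vec n) (x : Fin d → Vec n) (i : Fin n) :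
    (fun y => chart z x y i) ∈ poly 1 univ := by
  simp only [chart_apply, PiLp.add_apply, WithLp.ofLp_sum, Finset.sum_apply, PiLp.smul_apply,
    smul_eq_mul]
  refine (poly 1 univ).add_mem (poly_const (z i)) (poly_sum _ fun j _ => ?_)
  have := (poly 1 univ).smul_mem ((x j - z) i) (poly_coord (n := d) j)
  convert this using 1
  ext y
  simp [mul_comm]

lemma convexHull_eq_image_chart {d n : ℕ} (z : Vec n) (x : Fin d → Vec n) :
    convexHull ℝ (insert z (range x)) = chart z x '' refSimplex d := by
  apply Subset.antisymm
  · refine convexHull_min ?_ ?_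
    · rintro _ (rfl | ⟨i, rfl⟩)
      · exact ⟨0, ⟨fun i => by simp, by simp⟩, by simp [chart_apply]⟩
      · refine ⟨EuclideanSpace.single i 1, ⟨fun j => ?_, ?_⟩, ?_⟩
        · simp only [PiLp.single_apply]
          split_ifs <;> norm_num
        · simp
        · simp [chart_apply]
    · rintro _ ⟨y, hy, rfl⟩ _ ⟨y', hy', rfl⟩ a b ha hb hab
      refine ⟨a • y + b • y', convex_refSimplex d hy hy' ha hb hab, ?_⟩
      simp only [chart, map_add, map_smul, smul_add]
      have : a • z + b • z = z := by rw [← add_smul, hab, one_smul]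
      rw [add_add_add_comm, this]
  · rintro _ ⟨y, hy, rfl⟩
    rw [chart_eq]
    have h0 : 0 ≤ 1 - ∑ i, y i := sub_nonneg.2 hy.2
    have := (convex_convexHull ℝ (insert z (range x))).sum_mem (t := Finset.univ)
      (w := fun o : Option (Fin d) => o.elim (1 - ∑ i, y i) fun i => y i)
      (z := fun o : Option (Fin d) => o.elim z x)
      (fun o _ => by cases o with
        | none => exact h0
        | some i => exact hy.1 i)
      (by simp [Fintype.sum_option])
      (fun o _ => subset_convexHull ℝ _ (by cases o <;> simp))
    simpa [Fintype.sum_option] using this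

lemma measurableEmbedding_chart {d n : ℕ} {z : Vec n} {x : Fin d → Vec n}
    (hx : Function.Injective (edgeMap fun i => x i - z)) : MeasurableEmbedding (chart z x) :=
  (continuous_chart z x).measurableEmbedding fun y y' h => hx (by simpa [chart] using h)

/-- A linear image has its Hausdorff measure scaled by `normDet`, and the translation is an
isometry. The two dimensions are independent, so that simplices and their sides are covered
together. -/
lemma restrict_chart_image {d n : ℕ} {z : Vec n} {x : Fin d → Vec n}
    (hx : Function.Injective (edgeMap fun i => x i - z)) {S : Set (Vec d)} (hS : MeasurableSet S) :
    (μHE[d] : Measure (Vec n)).restrict (chart z x '' S) =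
      ENNReal.ofReal (edgeMap fun i => x i - z).normDet •
        (volume.restrict S).map (chart z x) := by
  have hme := measurableEmbedding_chart hx
  ext s hs
  rw [Measure.restrict_apply hs, Measure.smul_apply, hme.map_apply, smul_eq_mul,
    Measure.restrict_apply (hme.measurable hs)]
  have h1 : s ∩ chart z x '' S
      = (fun v => z + v) '' ((edgeMap fun i => x i - z) '' (chart z x ⁻¹' s ∩ S)) := by
    rw [image_image]
    change _ = chart z x '' _
    rw [image_preimage_inter]
  have h2 := (edgeMap fun i => x i - z).euclideanHausdorffMeasure_image_eq_normDet_mul_volume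
    (chart z x ⁻¹' s ∩ S)
  rw [finrank_euclideanSpace_fin] at h2
  rw [h1, ← h2]
  exact (IsometryEquiv.addLeft z).isometry.euclideanHausdorffMeasure_image _

lemma integral_chart_image {d n : ℕ} {z : Vec n} {x : Fin d → Vec n}
    (hx : Function.Injective (edgeMap fun i => x i - z)) {S : Set (Vec d)} (hS : MeasurableSet S)
    (u : Vec n → ℝ) :
    ∫ v in chart z x '' S, u v ∂μHE[d] =
      (edgeMap fun i => x i - z).normDet * ∫ y in S, u (chart z x y) := by
  rw [restrict_chart_image hx hS, integral_smul_measure,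
    (measurableEmbedding_chart hx).integral_map, ENNReal.toReal_ofReal (LinearMap.normDet_nonneg _),
    smul_eq_mul]

/-- Gluing a scalar in front of a vector. -/
noncomputable def consVec {d : ℕ} (s : ℝ) (y : Vec d) : Vec (d + 1) :=
  WithLp.toLp 2 (Fin.cons s y.ofLp : Fin (d + 1) → ℝ)

@[simp] lemma consVec_zero {d : ℕ} (s : ℝ) (y : Vec d) : consVec s y 0 = s := rfl
@[simp] lemma consVec_succ {d : ℕ} (s : ℝ) (y : Vec d) (i : Fin d) :
    consVec s y i.succ = y i := rfl

lemma measurePreserving_consVec (d : ℕ) :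
    MeasurePreserving (fun q : ℝ × Vec d => consVec q.1 q.2) ∧
      MeasurableEmbedding (fun q : ℝ × Vec d => consVec q.1 q.2) := by
  have h1 : MeasurePreserving (Prod.map (id : ℝ → ℝ) (MeasurableEquiv.toLp 2 (Fin d → ℝ)).symm) :=
    (MeasurePreserving.id volume).prod (PiLp.volume_preserving_ofLp (Fin d))
  have h2 := (volume_preserving_piFinSuccAbove (fun _ : Fin (d + 1) => ℝ) 0).symm
  have h3 := PiLp.volume_preserving_toLp (Fin (d + 1))
  have heq : (fun q : ℝ × Vec d => consVec q.1 q.2) =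
      (MeasurableEquiv.toLp 2 (Fin (d + 1) → ℝ)) ∘
      (MeasurableEquiv.piFinSuccAbove (fun _ : Fin (d + 1) => ℝ) 0).symm ∘
      (Prod.map (id : ℝ → ℝ) (MeasurableEquiv.toLp 2 (Fin d → ℝ)).symm) := by
    funext q
    simp [consVec]
    rfl
  rw [heq]
  refine ⟨h3.comp (h2.comp h1), ?_⟩
  refine (MeasurableEquiv.measurableEmbedding _).comp
    ((MeasurableEquiv.measurableEmbedding _).comp ?_)
  exact ((MeasurableEquiv.refl ℝ).prodCongr
    (MeasurableEquiv.toLp 2 (Fin d → ℝ)).symm).measurableEmbedding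

lemma consVec_mem_refSimplex {d : ℕ} {s : ℝ} {y : Vec d} :
    consVec s y ∈ refSimplex (d + 1) ↔ y ∈ refSimplex d ∧ s ∈ Icc 0 (1 - ∑ i, y i) := by
  simp only [refSimplex, mem_setOf_eq, Fin.forall_fin_succ, Fin.sum_univ_succ, consVec_zero,
    consVec_succ, mem_Icc]
  constructor
  · rintro ⟨⟨h1, h2⟩, h3⟩
    exact ⟨⟨h2, by linarith⟩, h1, by linarith⟩
  · rintro ⟨⟨h1, h2⟩, h3, h4⟩
    exact ⟨⟨h3, h1⟩, by linarith⟩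

/-- Fubini's theorem and the fundamental theorem of calculus on the segments parallel to the first
axis. Their end points lie on the faces of the unit simplex opposite the origin and opposite the
first unit vector. -/
lemma integral_refSimplex_succ {d : ℕ} {u : Vec (d + 1) → ℝ} (hu : ContDiff ℝ 1 u) :
    ∫ y in refSimplex (d + 1), fderiv ℝ u y (EuclideanSpace.single 0 1) =
      ∫ y in refSimplex d, (u (consVec (1 - ∑ i, y i) y) - u (consVec 0 y)) := by
  obtain ⟨hmp, hme⟩ := measurePreserving_consVec d
  set g : Vec (d + 1) → ℝ := fun y => fderiv ℝ u y (EuclideanSpace.single 0 1) with hg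
  have hgc : Continuous g := (hu.continuous_fderiv one_ne_zero).clm_apply continuous_const
  have hms := (isClosed_refSimplex (d + 1)).measurableSet
  have hint : IntegrableOn g (refSimplex (d + 1)) :=
    hgc.continuousOn.integrableOn_compact (isCompact_refSimplex _)
  have hint' : Integrable (fun q : ℝ × Vec d =>
      (refSimplex (d + 1)).indicator g (consVec q.1 q.2)) (volume.prod volume) := by
    exact (hmp.integrable_comp_emb hme).2 ((integrable_indicator_iff hms).2 hint)
  rw [← integral_indicator hms, ← hmp.integral_comp hme, Measure.volume_eq_prod,
    integral_prod_symm _ hint', ← integral_indicator (isClosed_refSimplex d).measurableSet]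
  refine integral_congr_ae (Filter.Eventually.of_forall fun y => ?_)
  by_cases hy : y ∈ refSimplex d
  · have h0 : 0 ≤ 1 - ∑ i, y i := sub_nonneg.2 hy.2
    have h1 : (fun s : ℝ => (refSimplex (d + 1)).indicator g (consVec s y)) =
        (Icc 0 (1 - ∑ i, y i)).indicator fun s => g (consVec s y) := by
      funext s
      by_cases hs : s ∈ Icc 0 (1 - ∑ i, y i)
      · rw [indicator_of_mem hs, indicator_of_mem (consVec_mem_refSimplex.2 ⟨hy, hs⟩)]
      · rw [indicator_of_notMem hs,
          indicator_of_notMem fun h => hs (consVec_mem_refSimplex.1 h).2]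
    simp only [h1]
    rw [integral_indicator measurableSet_Icc, integral_Icc_eq_integral_Ioc,
      ← intervalIntegral.integral_of_le h0, indicator_of_mem hy]
    have hline : ∀ s : ℝ, consVec s y = consVec 0 y + s • EuclideanSpace.single 0 1 := by
      intro s
      ext i
      simp only [PiLp.add_apply, PiLp.smul_apply, PiLp.single_apply, smul_eq_mul]
      refine Fin.cases ?_ (fun i => ?_) i
      · rw [consVec_zero, consVec_zero, if_pos rfl]; ring
      · rw [consVec_succ, consVec_succ, if_neg (Fin.succ_ne_zero i)]; ring
    have hder : ∀ s : ℝ, HasDerivAt (fun s : ℝ => consVec s y)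
        (EuclideanSpace.single (0 : Fin (d + 1)) (1 : ℝ)) s := by
      intro s
      rw [show (fun s : ℝ => consVec s y) = fun s => consVec 0 y + s • EuclideanSpace.single 0 1
        from funext hline]
      simpa using ((hasDerivAt_id s).smul_const
        (EuclideanSpace.single (0 : Fin (d + 1)) (1 : ℝ))).const_add (consVec 0 y)
    have hcont : Continuous fun s : ℝ => consVec s y :=
      continuous_iff_continuousAt.2 fun s => (hder s).continuousAt
    refine intervalIntegral.integral_eq_sub_of_hasDerivAt (f := fun s => u (consVec s y))
      (fun s _ => ?_) ((hgc.comp hcont).intervalIntegrable _ _)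
    exact ((hu.differentiable one_ne_zero _).hasFDerivAt).comp_hasDerivAt s (hder s)
  · rw [indicator_of_notMem hy]
    refine integral_eq_zero_of_ae (Filter.Eventually.of_forall fun s => ?_)
    exact indicator_of_notMem (fun h => hy (consVec_mem_refSimplex.1 h).1) _

/-- Integration by parts on a parametrised simplex, in the direction of an edge. -/
lemma integral_chart_edge {d n : ℕ} (a b : Vec n) (x : Fin d → Vec n) {u : Vec n → ℝ}
    (hu : ContDiff ℝ 1 u) :
    ∫ y in refSimplex (d + 1), fderiv ℝ u (chart a (Fin.cons b x : Fin (d + 1) → Vec n) y) (b - a) =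
      (∫ y in refSimplex d, u (chart b x y)) - ∫ y in refSimplex d, u (chart a x y) := by
  set φ := chart a (Fin.cons b x : Fin (d + 1) → Vec n) with hφ
  set L := edgeMap fun i => (Fin.cons b x : Fin (d + 1) → Vec n) i - a with hL
  have hφd : ∀ y, HasFDerivAt φ L.toContinuousLinearMap y := fun y =>
    (L.toContinuousLinearMap.hasFDerivAt).const_add a
  have hφc : ContDiff ℝ 1 φ := contDiff_const.add L.toContinuousLinearMap.contDiff
  have h1 := integral_refSimplex_succ (hu.comp hφc)
  have h2 : ∀ y, fderiv ℝ (u ∘ φ) y (EuclideanSpace.single 0 1) = fderiv ℝ u (φ y) (b - a) := by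
    intro y
    rw [(((hu.differentiable one_ne_zero _).hasFDerivAt).comp y (hφd y)).fderiv]
    simp [hL, edgeMap_apply]
  simp only [h2] at h1
  -- First coordinate 1 - ∑ y i gives a point of the face spanned by b and x, first coordinate 0 a
  -- point of the face spanned by a and x.
  rw [h1, integral_sub]
  · congr 1
    · congr 1
      funext y
      simp only [Function.comp, hφ]
      congr 1
      rw [chart_eq, chart_eq, Fin.sum_univ_succ, Fin.sum_univ_succ]
      simp
    · congr 1
      funext y
      simp only [Function.comp, hφ]
      congr 1
      rw [chart_eq, chart_eq, Fin.sum_univ_succ, Fin.sum_univ_succ]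
      simp
  · have : Continuous fun y : Vec d => consVec (1 - ∑ i, y i) y := by
      unfold consVec
      refine (PiLp.continuous_toLp 2 _).comp (continuous_pi fun i => ?_)
      refine Fin.cases ?_ (fun i => ?_) i
      · simp only [Fin.cons_zero]; fun_prop
      · simp only [Fin.cons_succ]; fun_prop
    exact (((hu.continuous.comp hφc.continuous).comp this).continuousOn).integrableOn_compact
      (isCompact_refSimplex d)
  · have : Continuous fun y : Vec d => consVec 0 y := by
      unfold consVec
      refine (PiLp.continuous_toLp 2 _).comp (continuous_pi fun i => ?_)
      refine Fin.cases ?_ (fun i => ?_) i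
      · simp only [Fin.cons_zero]; fun_prop
      · simp only [Fin.cons_succ]; fun_prop
    exact (((hu.continuous.comp hφc.continuous).comp this).continuousOn).integrableOn_compact
      (isCompact_refSimplex d)

/-- Volume is base times height. The map factors through a lower triangular one with diagonal (c, 1,
..., 1), which also absorbs the tangential part of the new edge. Prepending a unit normal does not
change the Gram determinant. -/
lemma normDet_edgeMap_cons {d n : ℕ} (t : Fin d → Vec n) {ν : Vec n} (hν : ‖ν‖ = 1)
    (ht : ∀ i, inner ℝ ν (t i) = 0) (c : ℝ) (a : Fin d → ℝ) :
    (edgeMap (Fin.cons (c • ν + ∑ i, a i • t i) t : Fin (d + 1) → Vec n)).normDet =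
      |c| * (edgeMap t).normDet := by
  set s : Fin (d + 1) → Vec (d + 1) := Fin.cons
    (consVec c (WithLp.toLp 2 a)) fun i => EuclideanSpace.single i.succ 1 with hs
  have hcomp : edgeMap (Fin.cons (c • ν + ∑ i, a i • t i) t : Fin (d + 1) → Vec n) =
      edgeMap (Fin.cons ν t : Fin (d + 1) → Vec n) ∘ₗ edgeMap s := by
    refine (EuclideanSpace.basisFun (Fin (d + 1)) ℝ).toBasis.ext fun j => ?_
    have e1 : ∀ {N : ℕ} (r : Fin (d + 1) → Vec N) (j), edgeMap r (EuclideanSpace.single j 1) = r j := by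
      intro N r j
      simp [edgeMap_apply]
    simp only [OrthonormalBasis.coe_toBasis, EuclideanSpace.basisFun_apply, LinearMap.comp_apply, e1]
    refine Fin.cases ?_ (fun j => ?_) j
    · simp [hs, edgeMap_apply, Fin.sum_univ_succ]
    · simp only [hs, Fin.cons_succ, e1]
  have h1 : (edgeMap s).normDet = |c| := by
    rw [LinearMap.normDet_eq_abs_det, ← LinearMap.det_toMatrix
      (EuclideanSpace.basisFun (Fin (d + 1)) ℝ).toBasis, Matrix.det_of_isLowerTriangular]
    · simp [LinearMap.toMatrix_apply, Fin.prod_univ_succ, edgeMap_apply, hs]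
    · intro i j hij
      simp only [LinearMap.toMatrix_apply, OrthonormalBasis.coe_toBasis,
        EuclideanSpace.basisFun_apply, edgeMap_apply, OrthonormalBasis.coe_toBasis_repr_apply,
        EuclideanSpace.basisFun_repr]
      have hij' : i < j := by simpa using hij
      obtain ⟨j, rfl⟩ := Fin.exists_succ_eq.2 (Fin.ne_zero_of_lt hij')
      simp [hs, hij'.ne]
  have h2 : (edgeMap (Fin.cons ν t : Fin (d + 1) → Vec n)).normDet = (edgeMap t).normDet := by
    have e1 : ∀ {N : ℕ} (r : Fin N → Vec n) (j), edgeMap r (EuclideanSpace.single j 1) = r j := by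
      intro N r j
      simp [edgeMap_apply]
    have h3 := (edgeMap (Fin.cons ν t : Fin (d + 1) → Vec n)).normDet_sq_eq_det_gram
      (EuclideanSpace.basisFun (Fin (d + 1)) ℝ)
    have h4 := (edgeMap t).normDet_sq_eq_det_gram (EuclideanSpace.basisFun (Fin d) ℝ)
    simp only [EuclideanSpace.basisFun_apply, e1] at h3 h4
    rw [Matrix.det_succ_row_zero, Fin.sum_univ_succ] at h3
    have h5 : (edgeMap (Fin.cons ν t : Fin (d + 1) → Vec n)).normDet ^ 2
        = (edgeMap t).normDet ^ 2 := by
      have h6 : ((edgeMap (Fin.cons ν t : Fin (d + 1) → Vec n)).normDet ^ 2 : ℝ)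
          = ((Matrix.gram ℝ t).det : ℝ) := by
        refine h3.trans ?_
        have : (Matrix.gram ℝ (Fin.cons ν t : Fin (d + 1) → Vec n)).submatrix Fin.succ
            (Fin.succAbove 0) = Matrix.gram ℝ t := by
          ext i j; simp [Matrix.gram]
        rw [this]
        simp [Matrix.gram, ht, hν]
      rw [h6]; exact h4.symm
    exact (sq_eq_sq₀ (LinearMap.normDet_nonneg _) (LinearMap.normDet_nonneg _)).1 h5
  rw [hcomp, LinearMap.normDet_comp_of_finrank_eq _ _ rfl, h1, h2]
  ring

end

section

/-! ### Geometry of a simplex -/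

/-- `T` is the vertex set of a simplex of positive volume. -/
structure IsSimplex {d : ℕ} (T : Finset (Vec (d + 1))) : Prop where
  card_eq : T.card = d + 2
  affineIndependent : AffineIndependent ℝ ((↑) : T → Vec (d + 1))

variable {d : ℕ} {T : Finset (Vec (d + 1))}

/-- The vertices of a simplex as an affine basis. -/
noncomputable def affBasis (hT : IsSimplex T) : AffineBasis T ℝ (Vec (d + 1)) where
  toFun := (↑)
  ind' := hT.affineIndependent
  tot' := hT.affineIndependent.affineSpan_eq_top_iff_card_eq_finrank_add_one.2
    (by simp [hT.card_eq])

@[simp] lemma affBasis_apply (hT : IsSimplex T) (a : T) : affBasis hT a = a.1 := rfl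

/-- Barycentric coordinates. -/
noncomputable def bc (hT : IsSimplex T) (a : T) : Vec (d + 1) →ᵃ[ℝ] ℝ := (affBasis hT).coord a

lemma bc_self (hT : IsSimplex T) (a : T) : bc hT a a.1 = 1 :=
  (affBasis hT).coord_apply_eq a

lemma bc_ne (hT : IsSimplex T) {a b : T} (h : a ≠ b) : bc hT a b.1 = 0 :=
  (affBasis hT).coord_apply_ne h

lemma sum_bc (hT : IsSimplex T) (x : Vec (d + 1)) : ∑ a, bc hT a x = 1 :=
  (affBasis hT).sum_coord_apply_eq_one x

lemma sum_bc_smul (hT : IsSimplex T) (x : Vec (d + 1)) : ∑ a : T, bc hT a x • a.1 = x :=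
  (affBasis hT).linear_combination_coord_eq_self x

lemma sum_bc_smul_sub (hT : IsSimplex T) (x z : Vec (d + 1)) :
    ∑ a : T, bc hT a x • (a.1 - z) = x - z := by
  simp only [smul_sub, Finset.sum_sub_distrib, ← Finset.sum_smul, sum_bc, one_smul, sum_bc_smul]

lemma mem_cell_iff (hT : IsSimplex T) {x : Vec (d + 1)} :
    x ∈ cell T ↔ ∀ a, 0 ≤ bc hT a x := by
  have h := (affBasis hT).convexHull_eq_nonneg_coord
  have hr : range (affBasis hT) = (T : Set (Vec (d + 1))) := by
    ext y; simp
  rw [hr] at h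
  unfold cell
  rw [h]; rfl

lemma mem_interior_cell_iff (hT : IsSimplex T) {x : Vec (d + 1)} :
    x ∈ interior (cell T) ↔ ∀ a, 0 < bc hT a x := by
  have h := (affBasis hT).interior_convexHull
  have hr : range (affBasis hT) = (T : Set (Vec (d + 1))) := by
    ext y; simp
  rw [hr] at h
  unfold cell
  rw [h]; rfl

lemma bc_le_one (hT : IsSimplex T) {x : Vec (d + 1)} (hx : x ∈ cell T) (a : T) :
    bc hT a x ≤ 1 := by
  rw [← sum_bc hT x]
  exact Finset.single_le_sum (f := fun a => bc hT a x) (fun b _ => (mem_cell_iff hT).1 hx b)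
    (Finset.mem_univ a)

lemma cell_erase_subset {n : ℕ} (T : Finset (Vec n)) (a : Vec n) : cell (T.erase a) ⊆ cell T :=
  convexHull_mono (by exact_mod_cast Finset.erase_subset a T)

lemma bc_eq_zero_of_mem_side (hT : IsSimplex T) (a : T) {x : Vec (d + 1)}
    (hx : x ∈ cell (T.erase a.1)) : bc hT a x = 0 := by
  have hc : Convex ℝ {x | bc hT a x = 0} := by
    have : {x | bc hT a x = 0} = bc hT a ⁻¹' {0} := rfl
    rw [this]
    exact (convex_singleton 0).affine_preimage _
  refine convexHull_min (s := ((T.erase a.1 : Finset _) : Set (Vec (d + 1)))) ?_ hc hx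
  intro b hb
  simp only [Finset.coe_erase, mem_diff, Finset.mem_coe, mem_singleton_iff] at hb
  exact bc_ne hT (a := a) (b := ⟨b, hb.1⟩) fun h => hb.2 (by rw [h])

lemma isCompact_cell {n : ℕ} (T : Finset (Vec n)) : IsCompact (cell T) :=
  Set.Finite.isCompact_convexHull (𝕜 := ℝ) T.finite_toSet

lemma measurableSet_cell {n : ℕ} (T : Finset (Vec n)) : MeasurableSet (cell T) :=
  (isCompact_cell T).isClosed.measurableSet

lemma nonempty_interior_cell (hT : IsSimplex T) : (interior (cell T)).Nonempty := by
  have := (affBasis hT).centroid_mem_interior_convexHull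
  have hr : range (affBasis hT) = (T : Set (Vec (d + 1))) := by
    ext y; simp
  rw [hr] at this
  exact ⟨_, this⟩

/-! ### Charts of simplices and sides -/

lemma range_edgeMap {k n : ℕ} (z : Vec n) (x : Fin k → Vec n) :
    LinearMap.range (edgeMap fun i => x i - z) = vectorSpan ℝ (insert z (range x)) := by
  rw [vectorSpan_eq_span_vsub_set_right ℝ (mem_insert z _), image_insert_eq, vsub_eq_sub, sub_self,
    Submodule.span_insert_zero, ← range_comp]
  ext v
  rw [Submodule.mem_span_range_iff_exists_fun]
  constructor
  · rintro ⟨y, rfl⟩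
    exact ⟨y, rfl⟩
  · rintro ⟨c, hc⟩
    exact ⟨WithLp.toLp 2 c, hc⟩

lemma edgeMap_injective {k n : ℕ} {S : Finset (Vec n)} (hcard : S.card = k + 1)
    (hS : AffineIndependent ℝ ((↑) : S → Vec n)) {z : Vec n} {x : Fin k → Vec n}
    (h : (S : Set (Vec n)) = insert z (range x)) :
    Function.Injective (edgeMap fun i => x i - z) := by
  have h1 : Module.finrank ℝ (vectorSpan ℝ (S : Set (Vec n))) = k := by
    have := hS.finrank_vectorSpan (n := k) (by simp [hcard])
    rwa [show range ((↑) : S → Vec n) = (S : Set (Vec n)) by ext; simp] at this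
  rw [h, ← range_edgeMap] at h1
  have h2 := LinearMap.finrank_range_add_finrank_ker (edgeMap fun i => x i - z)
  rw [h1, finrank_euclideanSpace_fin] at h2
  rw [← LinearMap.ker_eq_bot, ← Submodule.finrank_eq_zero (R := ℝ)]
  omega

lemma cell_eq_image_chart {k n : ℕ} {S : Finset (Vec n)} {z : Vec n} {x : Fin k → Vec n}
    (h : (S : Set (Vec n)) = insert z (range x)) : cell S = chart z x '' refSimplex k := by
  rw [cell, h, convexHull_eq_image_chart]

lemma exists_enum {n k : ℕ} {S : Finset (Vec n)} (hcard : S.card = k + 1) {z : Vec n} (hz : z ∈ S) :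
    ∃ x : Fin k → Vec n, Function.Injective x ∧ z ∉ range x ∧
      (S : Set (Vec n)) = insert z (range x) ∧
      ∀ {M : Type} [AddCommGroup M] (f : Vec n → M), ∑ v ∈ S, f v = f z + ∑ i, f (x i) := by
  classical
  have h1 : (S.erase z).card = k := by rw [Finset.card_erase_of_mem hz, hcard]; rfl
  let e := ((S.erase z).equivFinOfCardEq h1).symm
  have hr : range (fun i => (e i).1) = (S.erase z : Set (Vec n)) := by
    ext v
    constructor
    · rintro ⟨i, rfl⟩; exact_mod_cast (e i).2
    · intro hv
      exact ⟨e.symm ⟨v, by exact_mod_cast hv⟩, by simp⟩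
  refine ⟨fun i => (e i).1, fun i j h => e.injective (Subtype.ext h), ?_, ?_, ?_⟩
  · rw [hr]; simp
  · rw [hr, Finset.coe_erase, insert_sdiff_singleton, insert_eq_of_mem (by exact_mod_cast hz)]
  · intro M _ f
    rw [← Finset.add_sum_erase _ _ hz, ← Finset.sum_coe_sort (S.erase z),
      ← e.sum_comp (fun v => f v.1)]

/-- The common Jacobian of all charts of a simplex. -/
noncomputable def jac (T : Finset (Vec (d + 1))) : ℝ :=
  volume.real (cell T) / (volume : Measure (Vec (d + 1))).real (refSimplex (d + 1))

lemma jac_eq_normDet (hT : IsSimplex T) {z : Vec (d + 1)} {x : Fin (d + 1) → Vec (d + 1)}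
    (h : (T : Set (Vec (d + 1))) = insert z (range x)) :
    jac T = (edgeMap fun i => x i - z).normDet := by
  have h1 := integral_chart_image (edgeMap_injective hT.card_eq hT.affineIndependent h)
    (isClosed_refSimplex (d + 1)).measurableSet fun _ => 1
  rw [← cell_eq_image_chart h, EuclideanSpace.euclideanHausdorffMeasure_eq_volume] at h1
  simp only [integral_const, smul_eq_mul, mul_one, measureReal_restrict_apply MeasurableSet.univ,
    univ_inter] at h1
  rw [jac, h1, mul_div_assoc, div_self (volume_refSimplex_pos _).ne', mul_one]

lemma integral_cell (hT : IsSimplex T) {z : Vec (d + 1)} {x : Fin (d + 1) → Vec (d + 1)}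
    (h : (T : Set (Vec (d + 1))) = insert z (range x)) (u : Vec (d + 1) → ℝ) :
    ∫ v in cell T, u v = jac T * ∫ y in refSimplex (d + 1), u (chart z x y) := by
  have h1 := integral_chart_image (edgeMap_injective hT.card_eq hT.affineIndependent h)
    (isClosed_refSimplex (d + 1)).measurableSet u
  rw [← cell_eq_image_chart h, EuclideanSpace.euclideanHausdorffMeasure_eq_volume,
    ← jac_eq_normDet hT h] at h1
  exact h1

lemma jac_pos (hT : IsSimplex T) : 0 < jac T := by
  refine div_pos ?_ (volume_refSimplex_pos _)
  refine ENNReal.toReal_pos ?_ (isCompact_cell T).measure_lt_top.ne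
  exact ((isOpen_interior.measure_pos volume (nonempty_interior_cell hT)).trans_le
    (measure_mono interior_subset)).ne'

lemma erase_affineIndependent (hT : IsSimplex T) (a : Vec (d + 1)) :
    AffineIndependent ℝ ((↑) : ↥(T.erase a) → Vec (d + 1)) :=
  hT.affineIndependent.mono (t := ((T : Finset _) : Set (Vec (d + 1))))
    (s := ((T.erase a : Finset _) : Set (Vec (d + 1)))) (by simp)

lemma erase_card (hT : IsSimplex T) (a : T) : (T.erase a.1).card = d + 1 := by
  rw [Finset.card_erase_of_mem a.2, hT.card_eq]; rfl

/-- The distance of a vertex from the hyperplane of the opposite side. -/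
noncomputable def height (T : Finset (Vec (d + 1))) (a : Vec (d + 1)) : ℝ :=
  inner ℝ (barycentre (T.erase a) - a) (outerNormal T (T.erase a))

/-- Differences of points of the side F lie in its direction space, so z - a has the same orthogonal
component D for all vertices z of F. The vector from the barycentre of T to that of F is the
(d+2)-th part of the one from a to the barycentre of F, so the outer normal is D normalised. Affine
independence excludes D = 0. -/
lemma normal_spec (hT : IsSimplex T) (a : T) :
    0 < height T a ∧ ‖outerNormal T (T.erase a.1)‖ = 1 ∧
      ∀ z ∈ T.erase a.1, inner ℝ (z - a.1) (outerNormal T (T.erase a.1)) = height T a := by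
  set F := T.erase a.1 with hF
  have hcF : F.card = d + 1 := erase_card hT a
  set V := vectorSpan ℝ (F : Set (Vec (d + 1))) with hV
  set D := Vᗮ.starProjection (barycentre F - a.1) with hD
  have hbar : ∀ z ∈ F, z - barycentre F ∈ V := by
    intro z hz
    have : z - barycentre F = (F.card : ℝ)⁻¹ • ∑ x ∈ F, (z - x) := by
      rw [barycentre, Finset.sum_sub_distrib, Finset.sum_const, smul_sub, ← Nat.cast_smul_eq_nsmul ℝ,
        smul_smul, inv_mul_cancel₀ (by rw [hcF]; positivity), one_smul]
    rw [this]
    exact V.smul_mem _ (V.sum_mem fun x hx =>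
      vsub_mem_vectorSpan ℝ (by exact_mod_cast hz) (by exact_mod_cast hx))
  have hproj : ∀ z ∈ F, Vᗮ.starProjection (z - a.1) = D := by
    intro z hz
    have h1 : z - a.1 = (z - barycentre F) + (barycentre F - a.1) := by abel
    rw [h1, map_add, Submodule.starProjection_orthogonal_apply_eq_zero (hbar z hz), zero_add]
  have hbT : barycentre F - barycentre T = ((d : ℝ) + 2)⁻¹ • (barycentre F - a.1) := by
    have h1 : ∑ x ∈ T, x = a.1 + ∑ x ∈ F, x := (Finset.add_sum_erase T id a.2).symm
    have h2 : ∑ x ∈ F, x = ((d : ℝ) + 1) • barycentre F := by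
      rw [barycentre, hcF, smul_smul]
      push_cast
      rw [mul_inv_cancel₀ (by positivity), one_smul]
    have h3 : barycentre T = ((d : ℝ) + 2)⁻¹ • (a.1 + ((d : ℝ) + 1) • barycentre F) := by
      rw [barycentre, h1, h2, hT.card_eq]
      push_cast; rfl
    rw [h3, smul_add, smul_smul, smul_sub]
    have h4 : barycentre F = ((d : ℝ) + 2)⁻¹ • barycentre F
        + (((d : ℝ) + 2)⁻¹ * ((d : ℝ) + 1)) • barycentre F := by
      rw [← add_smul]
      have : ((d : ℝ) + 2)⁻¹ + ((d : ℝ) + 2)⁻¹ * ((d : ℝ) + 1) = 1 := by field_simp; ring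
      rw [this, one_smul]
    nth_rewrite 1 [h4]
    abel
  have hne : D ≠ 0 := by
    intro h0
    obtain ⟨z, hz⟩ : F.Nonempty := Finset.card_pos.1 (by omega)
    have h1 : z - a.1 ∈ V := by
      have h2 := hproj z hz
      rw [h0, Submodule.starProjection_apply_eq_zero_iff, Submodule.orthogonal_orthogonal] at h2
      exact h2
    have h2 : a.1 ∈ affineSpan ℝ (F : Set (Vec (d + 1))) := by
      have h3 := vadd_mem_affineSpan_of_mem_affineSpan_of_mem_vectorSpan (k := ℝ)
        (mem_affineSpan ℝ (s := (F : Set (Vec (d + 1)))) (by exact_mod_cast hz)) (V.neg_mem h1)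
      simpa using h3
    have h4 := hT.affineIndependent.notMem_affineSpan_sdiff a univ
    refine h4 ?_
    convert h2 using 2
    ext v
    simp only [mem_image, mem_diff, mem_univ, mem_singleton_iff, true_and, hF, Finset.coe_erase,
      Finset.mem_coe]
    constructor
    · rintro ⟨b, hb, rfl⟩
      exact ⟨b.2, fun h => hb (Subtype.ext h)⟩
    · rintro ⟨h1, h2⟩
      exact ⟨⟨v, h1⟩, fun h => h2 (by rw [← h]), rfl⟩
  have hν : outerNormal T F = ‖D‖⁻¹ • D := by
    simp only [outerNormal]
    rw [hbT, map_smul, norm_smul, ← hD, smul_smul, Real.norm_of_nonneg (by positivity)]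
    congr 1
    field_simp
  have hz : ∀ v, Vᗮ.starProjection v = D → inner ℝ v (outerNormal T F) = ‖D‖ := by
    intro v hv
    have hDm : Vᗮ.starProjection D = D := by
      rw [Submodule.starProjection_eq_self_iff, hD]
      exact Submodule.starProjection_apply_mem _ _
    rw [hν, inner_smul_right, ← hDm, ← Submodule.inner_starProjection_left_eq_right, hv, hDm,
      real_inner_self_eq_norm_mul_norm, inv_mul_cancel_left₀ (norm_ne_zero_iff.2 hne)]
  have hh : height T a = ‖D‖ := hz _ rfl
  refine ⟨by rw [hh]; exact norm_pos_iff.2 hne, ?_, fun z hzF => by rw [hh]; exact hz _ (hproj z hzF)⟩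
  rw [hν, norm_smul, norm_inv, norm_norm, inv_mul_cancel₀ (norm_ne_zero_iff.2 hne)]

lemma height_pos (hT : IsSimplex T) (a : T) : 0 < height T a := (normal_spec hT a).1

lemma norm_outerNormal (hT : IsSimplex T) (a : T) : ‖outerNormal T (T.erase a.1)‖ = 1 :=
  (normal_spec hT a).2.1

/-- Both sides are affine in x, and by `normal_spec` they agree at the vertices. -/
lemma inner_sub_outerNormal (hT : IsSimplex T) (a : T) (x : Vec (d + 1)) :
    inner ℝ (x - a.1) (outerNormal T (T.erase a.1)) = height T a * (1 - bc hT a x) := by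
  rw [← sum_bc_smul_sub hT, sum_inner, ← sum_bc hT x, ← Finset.add_sum_erase _ _ (Finset.mem_univ a),
    ← Finset.add_sum_erase _ (fun b => bc hT b x) (Finset.mem_univ a), sub_self, smul_zero, inner_zero_left,
    zero_add, add_sub_cancel_left, Finset.mul_sum]
  refine Finset.sum_congr rfl fun b hb => ?_
  rw [real_inner_smul_left, (normal_spec hT a).2.2 b.1, mul_comm]
  exact Finset.mem_erase.2 ⟨fun h => (Finset.ne_of_mem_erase hb) (Subtype.ext h), b.2⟩

lemma inner_sub_normal_of_side (hT : IsSimplex T) (a : T) {x : Vec (d + 1)}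
    (hx : x ∈ cell (T.erase a.1)) :
    inner ℝ (x - a.1) (outerNormal T (T.erase a.1)) = height T a := by
  rw [inner_sub_outerNormal hT, bc_eq_zero_of_mem_side hT a hx, sub_zero, mul_one]

lemma inner_sub_normal_eq_zero (hT : IsSimplex T) (a : T) {x y : Vec (d + 1)}
    (hx : bc hT a x = 0) (hy : bc hT a y = 0) :
    inner ℝ (x - y) (outerNormal T (T.erase a.1)) = 0 := by
  have h1 := inner_sub_outerNormal hT a x
  have h2 := inner_sub_outerNormal hT a y
  have h3 : x - y = (x - a.1) - (y - a.1) := by abel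
  rw [h3, inner_sub_left, h1, h2, hx, hy, sub_self]

/-- In a chart of T based at a vertex z of the side, the edge towards a is `-height T a` times the
normal plus a tangential vector; then `normDet_edgeMap_cons` applies. -/
lemma normDet_side (hT : IsSimplex T) (a : T) {z : Vec (d + 1)} {x : Fin d → Vec (d + 1)}
    (h : ((T.erase a.1 : Finset _) : Set (Vec (d + 1))) = insert z (range x)) :
    jac T = height T a * (edgeMap fun i => x i - z).normDet := by
  set ν := outerNormal T (T.erase a.1)
  have hmem : ∀ v, v ∈ insert z (range x) → v ∈ T.erase a.1 := fun v hv => by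
    rw [← h] at hv; exact_mod_cast hv
  have hz := hmem z (mem_insert _ _)
  have hTe : (T : Set (Vec (d + 1))) =
      insert z (range (Fin.cons a.1 x : Fin (d + 1) → Vec (d + 1))) := by
    rw [Fin.range_cons, insert_comm, ← h, Finset.coe_erase, insert_sdiff_singleton,
      insert_eq_of_mem (by exact_mod_cast a.2)]
  have horth : ∀ i, inner ℝ ν (x i - z) = 0 := by
    intro i
    have h1 := (normal_spec hT a).2.2 _ (hmem _ (mem_insert_of_mem _ (mem_range_self i)))
    have h2 := (normal_spec hT a).2.2 _ hz
    rw [real_inner_comm, show x i - z = (x i - a.1) - (z - a.1) by abel, inner_sub_left, h1, h2,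
      sub_self]
  -- The orthogonal complement of the direction space of the side is the line spanned by ν. The
  -- vector on the right is orthogonal to ν, hence tangential.
  have hspan : ∃ c : Fin d → ℝ, ∑ i, c i • (x i - z) = a.1 - z + height T a • ν := by
    have h1 : a.1 - z + height T a • ν ∈ (vectorSpan ℝ ((T.erase a.1 : Finset _) : Set (Vec (d + 1)))) := by
      have hnν := norm_outerNormal hT a
      rw [← Submodule.orthogonal_orthogonal (vectorSpan ℝ ((T.erase a.1 : Finset _) : Set (Vec (d + 1))))]
      set V := vectorSpan ℝ ((T.erase a.1 : Finset _) : Set (Vec (d + 1))) with hV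
      have hrank : Module.finrank ℝ Vᗮ = 1 := by
        have h3 : Module.finrank ℝ V = d := by
          have := (erase_affineIndependent hT a.1).finrank_vectorSpan (n := d) (by
            rw [Fintype.card_coe, erase_card hT a])
          rwa [show range ((↑) : ↥(T.erase a.1) → Vec (d + 1)) =
            ((T.erase a.1 : Finset _) : Set (Vec (d + 1))) by ext; simp [and_comm]] at this
        have h4 := V.finrank_add_finrank_orthogonal
        rw [h3, finrank_euclideanSpace_fin] at h4
        omega
      have hνV : ν ∈ Vᗮ := by
        rw [Submodule.mem_orthogonal']
        intro v hv
        rw [hV, h, ← range_edgeMap] at hv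
        obtain ⟨y, rfl⟩ := hv
        rw [edgeMap_apply, inner_sum]
        exact Finset.sum_eq_zero fun i _ => by rw [inner_smul_right, horth, mul_zero]
      rw [Submodule.mem_orthogonal']
      intro w hw
      have hν0 : (⟨ν, hνV⟩ : Vᗮ) ≠ 0 := by
        intro h0
        have : outerNormal T (T.erase a.1) = 0 := congrArg Subtype.val h0
        rw [this] at hnν; simp at hnν
      obtain ⟨c, hc⟩ := (finrank_eq_one_iff_of_nonzero' _ hν0).1 hrank ⟨w, hw⟩
      have hc' : c • ν = w := congrArg Subtype.val hc
      have h2 := (normal_spec hT a).2.2 _ hz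
      rw [← hc', inner_smul_right, inner_add_left, real_inner_smul_left,
        real_inner_self_eq_norm_sq, hnν, show a.1 - z = -(z - a.1) by abel, inner_neg_left, h2]
      ring
    rw [h, ← range_edgeMap] at h1
    obtain ⟨y, hy⟩ := h1
    exact ⟨y, hy⟩
  obtain ⟨c, hc⟩ := hspan
  rw [jac_eq_normDet hT hTe]
  have h5 : (fun i => (Fin.cons a.1 x : Fin (d + 1) → Vec (d + 1)) i - z) =
      (Fin.cons ((-height T a) • ν + ∑ i, c i • (x i - z)) (fun i => x i - z) :
        Fin (d + 1) → Vec (d + 1)) := by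
    funext i
    refine Fin.cases ?_ (fun i => ?_) i
    · simp only [Fin.cons_zero, hc, neg_smul]; abel
    · simp
  rw [h5, normDet_edgeMap_cons _ (norm_outerNormal hT a) horth, abs_neg,
    abs_of_pos (height_pos hT a)]

/-- The factor `height T a` stays on the left so that the simplex and all its sides scale with the
same factor `jac T`. -/
lemma integral_side (hT : IsSimplex T) (a : T) {z : Vec (d + 1)} {x : Fin d → Vec (d + 1)}
    (h : ((T.erase a.1 : Finset _) : Set (Vec (d + 1))) = insert z (range x))
    (u : Vec (d + 1) → ℝ) :
    height T a * ∫ v in cell (T.erase a.1), u v ∂μHE[d] =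
      jac T * ∫ y in refSimplex d, u (chart z x y) := by
  have h1 := integral_chart_image (edgeMap_injective (erase_card hT a)
    (erase_affineIndependent hT a.1) h) (isClosed_refSimplex d).measurableSet u
  rw [← cell_eq_image_chart h] at h1
  rw [h1, normDet_side hT a h, mul_assoc]

lemma measure_side_lt_top (hT : IsSimplex T) (a : T) :
    (μHE[d] : Measure (Vec (d + 1))) (cell (T.erase a.1)) < ⊤ := by
  obtain ⟨z, hz⟩ : (T.erase a.1).Nonempty := Finset.card_pos.1 (by rw [erase_card hT a]; omega)
  obtain ⟨x, -, -, h, -⟩ := exists_enum (erase_card hT a) hz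
  have hinj := edgeMap_injective (erase_card hT a) (erase_affineIndependent hT a.1) h
  have h1 := congrArg (fun μ => μ univ)
    (restrict_chart_image hinj (isClosed_refSimplex d).measurableSet)
  simp only [Measure.restrict_apply_univ, Measure.smul_apply, smul_eq_mul] at h1
  rw [cell_eq_image_chart h, h1, (measurableEmbedding_chart hinj).map_apply]
  refine ENNReal.mul_lt_top ENNReal.ofReal_lt_top ?_
  rw [preimage_univ, Measure.restrict_apply_univ]
  exact (isCompact_refSimplex d).measure_lt_top

lemma integrableOn_side (hT : IsSimplex T) (a : T) {u : Vec (d + 1) → ℝ} (hu : Continuous u) :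
    IntegrableOn u (cell (T.erase a.1)) μHE[d] := by
  obtain ⟨C, hC⟩ := (isCompact_cell (T.erase a.1)).exists_bound_of_continuousOn hu.continuousOn
  exact IntegrableOn.of_bound (measure_side_lt_top hT a) hu.aestronglyMeasurable C
    ((ae_restrict_iff' (measurableSet_cell _)).2 (Filter.Eventually.of_forall hC))

lemma integrableOn_cell {n : ℕ} (T : Finset (Vec n)) {u : Vec n → ℝ} (hu : Continuous u) :
    IntegrableOn u (cell T) :=
  hu.continuousOn.integrableOn_compact (isCompact_cell T)

/-- In the chart based at a with b as first vertex, the edge direction is the first axis. The two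
end faces are then the sides opposite a and b, and the common Jacobian turns into the heights by
`integral_side`. -/
lemma integral_edge (hT : IsSimplex T) {a b : T} (hab : a ≠ b) {u : Vec (d + 1) → ℝ}
    (hu : ContDiff ℝ 1 u) :
    ∫ x in cell T, fderiv ℝ u x (b.1 - a.1) =
      height T a * (∫ x in cell (T.erase a.1), u x ∂μHE[d]) -
      height T b * (∫ x in cell (T.erase b.1), u x ∂μHE[d]) := by
  have hbF : b.1 ∈ T.erase a.1 := Finset.mem_erase.2 ⟨fun h => hab (Subtype.ext h).symm, b.2⟩
  obtain ⟨x, -, hbx, h, -⟩ := exists_enum (erase_card hT a) hbF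
  have hT' : (T : Set (Vec (d + 1))) =
      insert a.1 (range (Fin.cons b.1 x : Fin (d + 1) → Vec (d + 1))) := by
    rw [Fin.range_cons, ← h, Finset.coe_erase, insert_sdiff_singleton,
      insert_eq_of_mem (by exact_mod_cast a.2)]
  have hax : a.1 ∉ range x := fun hh => by
    have : a.1 ∈ ((T.erase a.1 : Finset _) : Set (Vec (d + 1))) := by
      rw [h]; exact mem_insert_of_mem _ hh
    simp at this
  have h' : ((T.erase b.1 : Finset _) : Set (Vec (d + 1))) = insert a.1 (range x) := by
    rw [Finset.coe_erase, hT', Fin.range_cons, insert_comm, insert_diff_of_mem _ (by simp)]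
    refine diff_singleton_eq_self ?_
    rintro (h1 | h1)
    · exact hab (Subtype.ext h1.symm)
    · exact hbx h1
  rw [integral_side hT a h, integral_side hT b h', ← mul_sub, ← integral_chart_edge _ _ _ hu,
    integral_cell hT hT']

/-- The Gauss divergence theorem on a simplex. -/
theorem integral_fderiv_cell (hT : IsSimplex T) {u : Vec (d + 1) → ℝ} (hu : ContDiff ℝ 1 u)
    (e : Vec (d + 1)) :
    ∫ x in cell T, fderiv ℝ u x e =
      ∑ a : T, (∫ x in cell (T.erase a.1), u x ∂μHE[d]) *
        inner ℝ (outerNormal T (T.erase a.1)) e := by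
  have hc : Continuous (fderiv ℝ u) := hu.continuous_fderiv one_ne_zero
  obtain ⟨a, ha⟩ : T.Nonempty := Finset.card_pos.1 (by rw [hT.card_eq]; omega)
  set a : T := ⟨a, ha⟩
  -- By linearity it suffices to consider the edge vectors that emanate from one vertex a.
  have he : e = ∑ b : T, (bc hT b (e + a.1)) • (b.1 - a.1) := by
    rw [sum_bc_smul_sub]; abel
  -- Among all normals only those of the sides opposite a and b have a component along b - a, namely
  -- `height T a` and `-height T b`; these are the factors in `integral_edge`.
  have key : ∀ b : T, ∫ x in cell T, fderiv ℝ u x (b.1 - a.1) =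
      ∑ c : T, (∫ x in cell (T.erase c.1), u x ∂μHE[d]) *
        inner ℝ (outerNormal T (T.erase c.1)) (b.1 - a.1) := by
    intro b
    by_cases hab : a = b
    · simp [← hab]
    rw [integral_edge hT hab hu]
    rw [← Finset.add_sum_erase _ _ (Finset.mem_univ a), ← Finset.add_sum_erase _ _
      (Finset.mem_erase.2 ⟨fun h => hab h.symm, Finset.mem_univ b⟩)]
    rw [Finset.sum_eq_zero, real_inner_comm, inner_sub_outerNormal hT,
      bc_ne hT hab, sub_zero, mul_one]
    · have h1 := inner_sub_outerNormal hT b a.1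
      rw [bc_ne hT (fun h => hab h.symm), sub_zero, mul_one] at h1
      have h2 : inner ℝ (b.1 - a.1) (outerNormal T (T.erase b.1)) = -height T b := by
        rw [← neg_sub a.1 b.1, inner_neg_left, h1]
      rw [real_inner_comm, h2]
      ring
    · intro c hc
      simp only [Finset.mem_erase, Finset.mem_univ, and_true] at hc
      rw [real_inner_comm, inner_sub_normal_eq_zero hT c (bc_ne hT hc.1) (bc_ne hT hc.2), mul_zero]
  have h1 : ∀ x, fderiv ℝ u x e = ∑ b : T, (bc hT b (e + a.1)) * fderiv ℝ u x (b.1 - a.1) := by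
    intro x
    conv_lhs => rw [he]
    simp [map_sum]
  simp only [h1]
  rw [integral_finsetSum _ fun b _ =>
    (integrableOn_cell T (hc.clm_apply continuous_const)).const_mul _]
  simp only [integral_const_mul, key]
  conv_rhs => rw [he]
  simp only [inner_sum, inner_smul_right, Finset.mul_sum]
  rw [Finset.sum_comm]
  exact Finset.sum_congr rfl fun _ _ => Finset.sum_congr rfl fun _ _ => by ring

end

section

variable {d : ℕ} {T : Finset (Vec (d + 1))}

/-! ### Local polynomial bounds -/

lemma affine_chart {n k : ℕ} (L : Vec n →ᵃ[ℝ] ℝ) (z : Vec n) (x : Fin k → Vec n) (y : Vec k) :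
    L (chart z x y) = L z + ∑ i, y i * (L (x i) - L z) := by
  have h1 : L (chart z x y) = L.linear (∑ i, y i • (x i - z)) + L z := by
    rw [chart_apply, add_comm z]
    exact L.map_vadd z _
  rw [h1, map_sum, add_comm]
  congr 1
  refine Finset.sum_congr rfl fun i _ => ?_
  rw [map_smul, smul_eq_mul]
  congr 1
  exact L.linearMap_vsub (x i) z

/-- Polynomials are bounded by their `Lᵖ` norms, uniformly in the simplex. -/
lemma exists_cell_bound (d k : ℕ) {p : ℝ} (hp : 1 ≤ p) :
    ∃ C : ℝ, 0 < C ∧ ∀ T : Finset (Vec (d + 1)), IsSimplex T → ∀ u ∈ poly k univ,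
      ∀ x ∈ cell T, jac T * |u x| ^ p ≤ C * ∫ x in cell T, |u x| ^ p := by
  obtain ⟨C, hC, h⟩ := exists_rpow_le_weighted (d + 1) k (β := fun _ => 1) continuous_const
    (fun _ _ => zero_le_one) (fun _ _ => zero_lt_one) hp
  refine ⟨C, hC, fun T hT u hu x hx => ?_⟩
  obtain ⟨z, hz⟩ : T.Nonempty := Finset.card_pos.1 (by rw [hT.card_eq]; omega)
  obtain ⟨e, -, -, he, -⟩ := exists_enum hT.card_eq hz
  rw [integral_cell hT he]
  rw [cell_eq_image_chart he] at hx
  obtain ⟨y, hy, rfl⟩ := hx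
  -- The constant belongs to the unit simplex; the shape of T enters only through the Jacobian.
  have := h (fun y => u (chart z e y)) (poly_comp hu (chart_coord z e)) y hy
  simp only [one_mul] at this
  nlinarith [mul_le_mul_of_nonneg_left this (jac_pos hT).le]

/-- Square-integral bound with a barycentric coordinate as weight. -/
lemma exists_weighted_cell_bound (d k : ℕ) :
    ∃ C : ℝ, 0 < C ∧ ∀ T : Finset (Vec (d + 1)), ∀ hT : IsSimplex T, ∀ u ∈ poly k univ,
      ∀ a : T, ∀ x ∈ cell T, jac T * u x ^ 2 ≤ C * ∫ x in cell T, bc hT a x * u x ^ 2 := by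
  -- The product of all barycentric coordinates of the unit simplex lies below each of them, so a
  -- single weight serves all vertices.
  set β : Vec (d + 1) → ℝ := fun y => (1 - ∑ i, y i) * ∏ i, y i with hβ
  have hβc : Continuous β := by fun_prop
  have hβ0 : ∀ y ∈ refSimplex (d + 1), 0 ≤ β y := fun y hy =>
    mul_nonneg (sub_nonneg.2 hy.2) (Finset.prod_nonneg fun i _ => hy.1 i)
  obtain ⟨C, hC, h⟩ := exists_rpow_le_weighted (d + 1) k (β := β) hβc hβ0
    (fun y hy => mul_pos (sub_pos.2 hy.2) (Finset.prod_pos fun i _ => hy.1 i)) one_le_two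
  refine ⟨C, hC, fun T hT u hu a x hx => ?_⟩
  obtain ⟨z, hz⟩ : T.Nonempty := Finset.card_pos.1 (by rw [hT.card_eq]; omega)
  obtain ⟨e, hinj, hze, he, -⟩ := exists_enum hT.card_eq hz
  rw [integral_cell hT he]
  rw [cell_eq_image_chart he] at hx
  obtain ⟨y, hy, rfl⟩ := hx
  have h1 := h (fun y => u (chart z e y)) (poly_comp hu (chart_coord z e)) y hy
  simp only [Real.rpow_two, sq_abs] at h1
  have hcell : ∀ y ∈ refSimplex (d + 1), chart z e y ∈ cell T := fun y hy => by
    rw [cell_eq_image_chart he]; exact mem_image_of_mem _ hy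
  have hle : ∀ y ∈ refSimplex (d + 1), β y ≤ bc hT a (chart z e y) := by
    intro y hy
    have hp1 : ∏ i, y i ≤ 1 := Finset.prod_le_one (fun i _ => hy.1 i)
      fun i _ => le_one_of_mem_refSimplex hy i
    have hp0 : 0 ≤ ∏ i, y i := Finset.prod_nonneg fun i _ => hy.1 i
    have hs0 : 0 ≤ 1 - ∑ i, y i := sub_nonneg.2 hy.2
    have hs1 : 1 - ∑ i, y i ≤ 1 := by
      have := Finset.sum_nonneg (s := Finset.univ) fun i _ => hy.1 i
      linarith
    have ha : a.1 ∈ insert z (range e) := by rw [← he]; exact a.2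
    have hmemT : ∀ v, v ∈ insert z (range e) → v ∈ T := fun v hv => by
      rw [← he] at hv; exact hv
    rw [affine_chart]
    rcases ha with ha | ⟨j, hj⟩
    · have h2 : bc hT a z = 1 := by rw [← ha]; exact bc_self hT a
      have h3 : ∀ i, bc hT a (e i) = 0 := fun i =>
        bc_ne hT (b := ⟨e i, hmemT _ (mem_insert_of_mem _ (mem_range_self i))⟩) fun hh => by
          apply hze
          rw [← ha, hh]; exact mem_range_self i
      simp only [h2, h3, hβ]
      rw [← Finset.sum_mul]
      nlinarith
    · have h2 : bc hT a z = 0 := bc_ne hT (b := ⟨z, hz⟩) fun hh => by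
        apply hze; rw [hh] at hj; exact ⟨j, hj⟩
      have h3 : ∀ i, bc hT a (e i) = if i = j then 1 else 0 := by
        intro i
        split_ifs with hij
        · rw [hij, hj]; exact bc_self hT a
        · exact bc_ne hT (b := ⟨e i, hmemT _ (mem_insert_of_mem _ (mem_range_self i))⟩) fun hh => by
            rw [hh] at hj; exact hij (hinj hj.symm)
      simp only [h2, h3, sub_zero, zero_add, mul_ite, mul_one, mul_zero, Finset.sum_ite_eq',
        Finset.mem_univ, if_true, hβ]
      have h4 : ∏ i, y i ≤ y j := by
        rw [← Finset.mul_prod_erase _ _ (Finset.mem_univ j)]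
        exact mul_le_of_le_one_right (hy.1 j) (Finset.prod_le_one (fun i _ => hy.1 i)
          fun i _ => le_one_of_mem_refSimplex hy i)
      nlinarith
  have hcont : Continuous fun y => u (chart z e y) :=
    (poly_continuous hu).comp (continuous_chart z e)
  have hbcc : Continuous fun y => bc hT a (chart z e y) :=
    (poly_continuous (poly_affine (bc hT a))).comp (continuous_chart z e)
  have h5 : ∫ y in refSimplex (d + 1), β y * u (chart z e y) ^ 2 ≤
      ∫ y in refSimplex (d + 1), bc hT a (chart z e y) * u (chart z e y) ^ 2 :=
    setIntegral_mono_on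
      ((hβc.mul (hcont.pow 2)).continuousOn.integrableOn_compact (isCompact_refSimplex _))
      ((hbcc.mul (hcont.pow 2)).continuousOn.integrableOn_compact (isCompact_refSimplex _))
      (isClosed_refSimplex _).measurableSet
      fun y hy => mul_le_mul_of_nonneg_right (hle y hy) (sq_nonneg _)
  have h6 := mul_le_mul_of_nonneg_left (h1.trans (mul_le_mul_of_nonneg_left h5 hC.le)) (jac_pos hT).le
  linarith

/-- Bound on a side. -/
lemma exists_side_bound (d k : ℕ) :
    ∃ C : ℝ, 0 < C ∧ ∀ T : Finset (Vec (d + 1)), IsSimplex T → ∀ u ∈ poly k univ,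
      ∀ a : T, ∀ x ∈ cell (T.erase a.1),
        jac T * u x ^ 2 ≤ C * (height T a * ∫ x in cell (T.erase a.1), u x ^ 2 ∂μHE[d]) := by
  obtain ⟨C, hC, h⟩ := exists_rpow_le_weighted d k (β := fun _ => 1) continuous_const
    (fun _ _ => zero_le_one) (fun _ _ => zero_lt_one) one_le_two
  refine ⟨C, hC, fun T hT u hu a x hx => ?_⟩
  obtain ⟨z, hz⟩ : (T.erase a.1).Nonempty := Finset.card_pos.1 (by rw [erase_card hT]; omega)
  obtain ⟨e, -, -, he, -⟩ := exists_enum (erase_card hT a) hz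
  rw [integral_side hT a he]
  rw [cell_eq_image_chart he] at hx
  obtain ⟨y, hy, rfl⟩ := hx
  have := h (fun y => u (chart z e y)) (poly_comp hu (chart_coord z e)) y hy
  simp only [one_mul, Real.rpow_two, sq_abs] at this
  nlinarith [mul_le_mul_of_nonneg_left this (jac_pos hT).le]

lemma measure_cell_eq (hT : IsSimplex T) : volume.real (cell T) =
    jac T * (volume : Measure (Vec (d + 1))).real (refSimplex (d + 1)) := by
  rw [jac, div_mul_cancel₀ _ (volume_refSimplex_pos _).ne']

lemma measure_side_eq (hT : IsSimplex T) (a : T) :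
    height T a * (μHE[d] : Measure (Vec (d + 1))).real (cell (T.erase a.1)) =
      jac T * (volume : Measure (Vec d)).real (refSimplex d) := by
  obtain ⟨z, hz⟩ : (T.erase a.1).Nonempty := Finset.card_pos.1 (by rw [erase_card hT]; omega)
  obtain ⟨e, -, -, he, -⟩ := exists_enum (erase_card hT a) hz
  simpa using integral_side hT a he fun _ => 1

lemma norm_sub_le_diam {n : ℕ} {T : Finset (Vec n)} {x y : Vec n} (hx : x ∈ cell T) (hy : y ∈ cell T) :
    ‖x - y‖ ≤ Metric.diam (cell T) := by
  rw [← dist_eq_norm]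
  exact Metric.dist_le_diam_of_mem (isCompact_cell T).isBounded hx hy

lemma vertex_mem_cell {n : ℕ} {T : Finset (Vec n)} {a : Vec n} (ha : a ∈ T) : a ∈ cell T :=
  subset_convexHull ℝ _ (by exact_mod_cast ha)

/-- Radial fields with a coefficient of degree l belong to both spaces: to the Raviart-Thomas space
because of the summand x P_l, to the other one because its degree is l + 1. They are tangential on
all sides that contain a, which makes them suitable test functions. -/
lemma smul_sub_mem_rowSpace {n : ℕ} (P : Pairing) (l : ℕ) {s : Vec n → ℝ} (hs : s ∈ poly l univ)
    (a : Vec n) : (fun x => s x • (a - x)) ∈ P.rowSpace l univ := by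
  cases P with
  | rt =>
    refine ⟨fun x => s x • a, fun i => ?_, fun x => - s x, (poly l univ).neg_mem hs, ?_⟩
    · have h1 : (fun x => (s x • a) i) = a i • s := by
        funext x
        simp [mul_comm]
      rw [h1]
      exact (poly l univ).smul_mem (a i) hs
    · funext x
      rw [smul_sub, neg_smul, sub_eq_add_neg]
  | bdm =>
    intro i
    refine poly_mul hs ?_
    exact (poly 1 univ).sub_mem (poly_const (a i)) (poly_coord i)

lemma rowSpace_coord {n : ℕ} {P : Pairing} {l : ℕ} {σ : Vec n → Vec n}
    (hσ : σ ∈ P.rowSpace l univ) (i : Fin n) : (fun x => σ x i) ∈ poly (l + 1) univ := by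
  cases P with
  | rt =>
    obtain ⟨a, ha, b, hb, rfl⟩ := hσ
    refine (poly (l + 1) univ).add_mem (poly_mono (Nat.le_succ l) (ha i)) ?_
    exact poly_mul hb (poly_coord i)
  | bdm => exact hσ i

lemma continuous_of_coord {n m : ℕ} {σ : Vec n → Vec m} (h : ∀ i, Continuous fun x => σ x i) :
    Continuous σ :=
  (PiLp.continuous_toLp 2 _).comp (continuous_pi h)

lemma rowSpace_continuous {n : ℕ} {P : Pairing} {l : ℕ} {σ : Vec n → Vec n}
    (hσ : σ ∈ P.rowSpace l univ) : Continuous σ :=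
  continuous_of_coord fun i => poly_continuous (rowSpace_coord hσ i)

lemma fderiv_apply_eq_sum {n : ℕ} (v : Vec n → ℝ) (x e : Vec n) :
    fderiv ℝ v x e = ∑ j, fderiv ℝ v x (EuclideanSpace.single j 1) * e j := by
  conv_lhs => rw [show e = ∑ j, e j • EuclideanSpace.single j (1 : ℝ) by
    ext j; simp [Finset.sum_apply, Pi.single_apply]]
  simp [map_sum, mul_comm]

/-- Differentiation lowers the degree by one and the affine factor restores it. For l = 0 the
derivative vanishes. -/
lemma poly_fderiv_mul {n l : ℕ} {v : Vec n → ℝ} (hv : v ∈ poly l univ) {s : Vec n → ℝ}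
    (hs : s ∈ poly 1 univ) (e : Vec n) : (fun x => s x * fderiv ℝ v x e) ∈ poly l univ := by
  cases l with
  | zero =>
    simp only [fderiv_poly_zero hv, ContinuousLinearMap.zero_apply, mul_zero]
    exact Submodule.zero_mem _
  | succ l =>
    rw [add_comm]
    exact poly_mul hs (poly_fderiv hv e)

lemma poly_fderiv_sub {n l : ℕ} {v : Vec n → ℝ} (hv : v ∈ poly l univ) (a : Vec n) :
    (fun x => fderiv ℝ v x (a - x)) ∈ poly l univ := by
  simp only [fderiv_apply_eq_sum v _ (a - _)]
  refine poly_sum _ fun j _ => ?_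
  simp only [mul_comm]
  exact poly_fderiv_mul hv ((poly 1 univ).sub_mem (poly_const (a j)) (poly_coord j)) _

end

section

variable {d : ℕ} {T : Finset (Vec (d + 1))}

/-! ### Local stability of the gradient reconstruction -/

lemma bc_continuous (hT : IsSimplex T) (a : T) : Continuous (bc hT a) :=
  poly_continuous (poly_affine (bc hT a))

/-- Extension of a polynomial on a side to a normal trace on the simplex. -/
lemma exists_normal_lift (d : ℕ) (P : Pairing) (l : ℕ) :
    ∃ C : ℝ, 0 < C ∧ ∀ (T : Finset (Vec (d + 1))), IsSimplex T → ∀ (a : T),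
      ∀ w ∈ poly (P.k l) univ, ∀ s : ℝ, 0 ≤ s → (∀ x ∈ cell (T.erase a.1), |w x| ≤ s) →
      ∃ σ ∈ P.rowSpace l univ,
        (∀ x ∈ cell (T.erase a.1), inner ℝ (σ x) (outerNormal T (T.erase a.1)) = w x) ∧
        (∀ c : T, c ≠ a → ∀ x ∈ cell (T.erase c.1),
          inner ℝ (σ x) (outerNormal T (T.erase c.1)) = 0) ∧
        ∀ x ∈ cell T, ‖σ x‖ ≤ C * (Metric.diam (cell T) / height T a) * s := by
  obtain ⟨C, hC, hdec⟩ := exists_barycentric_decomp_bound d l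
  -- The summand 1 serves the Raviart-Thomas lift and (d + 1) C the other one, which has d + 1
  -- terms.
  refine ⟨1 + (d + 1) * C, by positivity, fun T hT a w hw s hs0 hs => ?_⟩
  obtain ⟨z, hz⟩ : (T.erase a.1).Nonempty := Finset.card_pos.1 (by rw [erase_card hT]; omega)
  obtain ⟨e, -, -, he, hsum⟩ := exists_enum (erase_card hT a) hz
  have hH := height_pos hT a
  have heF : ∀ i, e i ∈ T.erase a.1 := fun i => by
    have : e i ∈ ((T.erase a.1 : Finset _) : Set (Vec (d + 1))) := by
      rw [he]; exact mem_insert_of_mem _ (mem_range_self i)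
    exact_mod_cast this
  let eT : Fin d → T := fun i => ⟨e i, Finset.mem_of_mem_erase (heF i)⟩
  let zT : T := ⟨z, Finset.mem_of_mem_erase hz⟩
  have hea : ∀ i, eT i ≠ a := fun i h => Finset.ne_of_mem_erase (heF i) (congrArg Subtype.val h)
  have hza : zT ≠ a := fun h => Finset.ne_of_mem_erase hz (congrArg Subtype.val h)
  have hsumT : ∀ {M : Type} [AddCommGroup M] (f : T → M),
      ∑ v, f v = f a + (f zT + ∑ i, f (eT i)) := by
    intro M _ f
    set g : Vec (d + 1) → M := fun v => if h : v ∈ T then f ⟨v, h⟩ else 0 with hg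
    have h1 : ∀ v : T, f v = g v.1 := fun v => by simp [hg]
    simp only [h1]
    rw [Finset.sum_coe_sort T g, ← Finset.add_sum_erase _ _ a.2, hsum g]
  -- The barycentric coordinates of the vertices of the side other than z. On the hyperplane of the
  -- side, `Y` inverts the chart; on all of T it takes values in the unit simplex, so that
  -- polynomials on the side extend to T without loss in the maximum norm.
  let Y : Vec (d + 1) → Vec d := fun v => WithLp.toLp 2 fun i => bc hT (eT i) v
  have hY : ∀ v ∈ cell T, Y v ∈ refSimplex d := by
    intro v hv
    have h0 := (mem_cell_iff hT).1 hv
    refine ⟨fun i => h0 (eT i), ?_⟩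
    have h1 := sum_bc hT v
    rw [hsumT] at h1
    have h2 := h0 a
    have h3 := h0 zT
    change ∑ i, bc hT (eT i) v ≤ 1
    linarith
  have hYp : ∀ i, (fun v => Y v i) ∈ poly 1 univ := fun i => poly_affine (bc hT (eT i))
  have hYz : ∀ v, bc hT a v = 0 → 1 - ∑ i, Y v i = bc hT zT v := by
    intro v hv
    have h1 := sum_bc hT v
    rw [hsumT, hv] at h1
    change 1 - ∑ i, bc hT (eT i) v = _
    linarith
  have hchart : ∀ v, bc hT a v = 0 → chart z e (Y v) = v := by
    intro v hv
    rw [chart_eq, hYz v hv]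
    have h2 := sum_bc_smul hT v
    rw [hsumT, hv, zero_smul, zero_add] at h2
    exact h2
  set û : Vec d → ℝ := fun y => w (chart z e y) with hû
  have hûp : û ∈ poly (P.k l) univ := poly_comp hw (chart_coord z e)
  have hûs : ∀ y ∈ refSimplex d, |û y| ≤ s := fun y hy => hs _ (by
    rw [cell_eq_image_chart he]; exact mem_image_of_mem _ hy)
  have hdiam : ∀ x ∈ cell T, ∀ b ∈ T, ‖b - x‖ ≤ Metric.diam (cell T) := fun x hx b hb =>
    norm_sub_le_diam (vertex_mem_cell hb) hx
  have hdiam' : ∀ b ∈ T, ‖b - a.1‖ ≤ Metric.diam (cell T) := fun b hb =>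
    hdiam _ (vertex_mem_cell a.2) b hb
  set h := Metric.diam (cell T) with hh
  have hh0 : 0 ≤ h := Metric.diam_nonneg
  cases P with
  | rt =>
    -- The field x - a has constant normal component `height T a` on the side opposite a and is
    -- tangential on the sides through a. Dividing by the height and multiplying by the extension of
    -- w gives the lift.
    refine ⟨fun x => (-(û (Y x) / height T a)) • (a.1 - x), ?_, ?_, ?_, ?_⟩
    · refine smul_sub_mem_rowSpace Pairing.rt l (s := fun x => -(û (Y x) / height T a)) ?_ a.1
      have h1 : (fun x => -(û (Y x) / height T a)) = (-(height T a)⁻¹) • fun x => û (Y x) := by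
        funext x
        simp [div_eq_mul_inv, mul_comm]
      rw [h1]
      exact (poly l univ).smul_mem _ (poly_comp hûp hYp)
    · intro x hx
      have h0 := bc_eq_zero_of_mem_side hT a hx
      have h1 := inner_sub_normal_of_side hT a hx
      rw [real_inner_smul_left, ← neg_sub, inner_neg_left, h1, hû]
      simp only [hchart x h0]
      field_simp
    · intro c hc x hx
      rw [real_inner_smul_left, inner_sub_normal_eq_zero hT c (bc_ne hT hc)
        (bc_eq_zero_of_mem_side hT c hx), mul_zero]
    · intro x hx
      rw [norm_smul, norm_neg, Real.norm_eq_abs, abs_div, abs_of_pos hH]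
      have h1 := hûs _ (hY x hx)
      have h2 := hdiam x hx a.1 a.2
      calc |û (Y x)| / height T a * ‖a.1 - x‖ ≤ s / height T a * h := by gcongr
        _ = 1 * (h / height T a) * s := by ring
        _ ≤ _ := by
          have : 0 ≤ (d + 1) * C := by positivity
          gcongr; linarith
  | bdm =>
    obtain ⟨w₀, w', hw₀, hw', hde, hb⟩ := hdec û hûp s hûs
    -- The terms are λ_b w_b (b - a) / `height T a` for the vertices b ≠ a. On the side opposite a
    -- all edge vectors have normal component `height T a`, so the decomposition of û is recovered.
    -- On the side opposite c ≠ a, either b = c and λ_b vanishes, or the edge from a to b is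
    -- tangential.
    refine ⟨fun x => (bc hT zT x * w₀ (Y x) / height T a) • (z - a.1) +
      ∑ i, (bc hT (eT i) x * w' i (Y x) / height T a) • (e i - a.1), ?_, ?_, ?_, ?_⟩
    · have h1 : ∀ (b : T) (g : Vec d → ℝ), g ∈ poly l univ → ∀ q : ℝ,
          (fun x => (bc hT b x * g (Y x) / height T a) * q) ∈ poly (l + 1) univ := by
        intro b g hg q
        have h2 : (fun x => (bc hT b x * g (Y x) / height T a) * q) =
            (q / height T a) • fun x => bc hT b x * g (Y x) := by
          funext x
          simp [div_eq_mul_inv]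
          ring
        rw [h2]
        exact poly_mono (k := 1 + l) (by omega)
          ((poly (1 + l) univ).smul_mem _ (poly_mul (poly_affine _) (poly_comp hg hYp)))
      intro j
      simp only [PiLp.add_apply, PiLp.smul_apply, WithLp.ofLp_sum, Finset.sum_apply, smul_eq_mul]
      exact (poly (l + 1) univ).add_mem (h1 zT w₀ hw₀ _)
        (poly_sum _ fun i _ => h1 (eT i) (w' i) (hw' i) _)
    · intro x hx
      have h0 := bc_eq_zero_of_mem_side hT a hx
      have h1 : ∀ b : T, b ≠ a →
          inner ℝ (b.1 - a.1) (outerNormal T (T.erase a.1)) = height T a := fun b hb =>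
        (normal_spec hT a).2.2 b.1 (Finset.mem_erase.2 ⟨fun hh => hb (Subtype.ext hh), b.2⟩)
      rw [inner_add_left, sum_inner, real_inner_smul_left, h1 zT hza]
      simp only [real_inner_smul_left]
      rw [Finset.sum_congr rfl fun i _ => by rw [h1 (eT i) (hea i)]]
      have h3 := hde (Y x)
      rw [hYz x h0, hû] at h3
      simp only [hchart x h0] at h3
      rw [h3, div_mul_cancel₀ _ hH.ne']
      congr 1
      exact Finset.sum_congr rfl fun i _ => div_mul_cancel₀ _ hH.ne'
    · intro c hc x hx
      have h0 := bc_eq_zero_of_mem_side hT c hx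
      have h1 : ∀ b : T, ∀ g : ℝ, (bc hT b x * g / height T a) *
          inner ℝ (b.1 - a.1) (outerNormal T (T.erase c.1)) = 0 := by
        intro b g
        by_cases hbc : b = c
        · rw [hbc, h0]; simp
        · rw [inner_sub_normal_eq_zero hT c (bc_ne hT fun hh => hbc hh.symm) (bc_ne hT hc), mul_zero]
      rw [inner_add_left, sum_inner, real_inner_smul_left, h1 zT, zero_add]
      refine Finset.sum_eq_zero fun i _ => ?_
      rw [real_inner_smul_left, h1 (eT i)]
    · intro x hx
      obtain ⟨hb0, hb1⟩ := hb _ (hY x hx)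
      have h1 : ∀ b : T, ∀ g : ℝ, |g| ≤ C * s →
          ‖(bc hT b x * g / height T a) • (b.1 - a.1)‖ ≤ C * s / height T a * h := by
        intro b g hg
        rw [norm_smul, Real.norm_eq_abs, abs_div, abs_of_pos hH, abs_mul,
          abs_of_nonneg ((mem_cell_iff hT).1 hx b)]
        have h3 := bc_le_one hT hx b
        have h4 := (mem_cell_iff hT).1 hx b
        have h5 := hdiam' b.1 b.2
        have h6 : bc hT b x * |g| ≤ C * s := by nlinarith [abs_nonneg g]
        gcongr
      calc _ ≤ ‖(bc hT zT x * w₀ (Y x) / height T a) • (z - a.1)‖ +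
            ∑ i, ‖(bc hT (eT i) x * w' i (Y x) / height T a) • (e i - a.1)‖ :=
            (norm_add_le _ _).trans (by gcongr; exact norm_sum_le _ _)
        _ ≤ C * s / height T a * h + ∑ i : Fin d, C * s / height T a * h := by
            gcongr with i
            · exact h1 zT _ hb0
            · exact h1 (eT i) _ (hb1 i)
        _ = (d + 1) * C * (h / height T a) * s := by simp; ring
        _ ≤ _ := by gcongr; linarith

/-- The local identity that relates a row `r` of the gradient reconstruction to the gradient of
`v` and to the differences `w` of the side values and the traces of `v`. -/
def LocalIdentity (P : Pairing) (l : ℕ) (T : Finset (Vec (d + 1))) (r : Vec (d + 1) → Vec (d + 1))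
    (v : Vec (d + 1) → ℝ) (w : T → Vec (d + 1) → ℝ) : Prop :=
  ∀ σ ∈ P.rowSpace l univ, ∫ x in cell T, inner ℝ (r x) (σ x) =
    (∫ x in cell T, fderiv ℝ v x (σ x)) +
      ∑ a : T, ∫ x in cell (T.erase a.1), w a x * inner ℝ (σ x) (outerNormal T (T.erase a.1)) ∂μHE[d]

/-- The test function τ = ∑_a λ_a (∇v·(a - x)) (a - x) has zero normal trace: on the side opposite
c, either λ_a vanishes or a - x is tangential. Hence w drops out of the local identity, which
becomes ∫ r·τ = ∫ ∑_a λ_a (∇v·(a - x))². Young's inequality, a weighted inverse estimate and the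
inscribed ball lead from there to a pointwise bound for ∇v. -/
lemma exists_gradient_bound (d : ℕ) (P : Pairing) (l : ℕ) (γ : ℝ) :
    ∃ C : ℝ, 0 ≤ C ∧ ∀ (T : Finset (Vec (d + 1))), IsSimplex T →
      (∃ (c : Vec (d + 1)) (ρ : ℝ), 0 < ρ ∧ Metric.closedBall c ρ ⊆ cell T ∧
        Metric.diam (cell T) ≤ γ * ρ) →
      ∀ r ∈ P.rowSpace l univ, ∀ v ∈ poly l univ, ∀ w, LocalIdentity P l T r v w →
      ∀ R : ℝ, 0 ≤ R → (∀ x ∈ cell T, ‖r x‖ ≤ R) →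
      ∀ x ∈ cell T, ‖fderiv ℝ v x‖ ≤ C * R := by
  obtain ⟨C, hC, hw⟩ := exists_weighted_cell_bound d l
  set V := (volume : Measure (Vec (d + 1))).real (refSimplex (d + 1)) with hV
  have hV0 : 0 < V := volume_refSimplex_pos _
  refine ⟨√(C * V) * |γ|, by positivity, ?_⟩
  rintro T hT ⟨c, ρ, hρ, hball, hdiam⟩ r hr v hv w hloc R hR0 hR
  set h := Metric.diam (cell T) with hh
  have hh0 : 0 ≤ h := Metric.diam_nonneg
  have hJ := jac_pos hT
  obtain ⟨z, hz⟩ : T.Nonempty := Finset.card_pos.1 (by rw [hT.card_eq]; omega)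
  set τ : Vec (d + 1) → Vec (d + 1) := fun x =>
    ∑ a : T, (bc hT a x * fderiv ℝ v x (a.1 - x)) • (a.1 - x) with hτ
  -- Since ∑_a λ_a (a - x) = 0, the direction a - x of differentiation may be replaced by the
  -- constant direction a - z. This lowers the degree of the coefficients to l, as membership in the
  -- local space requires.
  have hτ' : τ = ∑ a : T, fun x => (bc hT a x * fderiv ℝ v x (a.1 - z)) • (a.1 - x) := by
    funext x
    have h1 : ∑ a : T, (bc hT a x * fderiv ℝ v x (x - z)) • (a.1 - x) = 0 := by
      simp only [mul_comm (bc hT _ x), mul_smul]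
      rw [← Finset.smul_sum, sum_bc_smul_sub, sub_self, smul_zero]
    rw [Finset.sum_apply, ← sub_zero (∑ a : T, _), ← h1, ← Finset.sum_sub_distrib]
    refine Finset.sum_congr rfl fun a _ => ?_
    rw [← sub_smul, ← mul_sub, ← map_sub, sub_sub_sub_cancel_right]
  have hτm : τ ∈ P.rowSpace l univ := by
    rw [hτ']
    refine Submodule.sum_mem _ fun a _ => smul_sub_mem_rowSpace P l ?_ a.1
    exact poly_fderiv_mul hv (poly_affine _) _
  have h1 := hloc τ hτm
  have h2 : ∀ c : T, ∀ x ∈ cell (T.erase c.1),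
      inner ℝ (τ x) (outerNormal T (T.erase c.1)) = 0 := by
    intro c x hx
    have h0 := bc_eq_zero_of_mem_side hT c hx
    rw [hτ]
    simp only [sum_inner, real_inner_smul_left]
    refine Finset.sum_eq_zero fun a _ => ?_
    by_cases hac : a = c
    · rw [hac, h0]; simp
    · rw [inner_sub_normal_eq_zero hT c (bc_ne hT fun hh => hac hh.symm) h0, mul_zero]
  rw [Finset.sum_eq_zero, add_zero] at h1
  swap
  · intro a _
    exact setIntegral_eq_zero_of_forall_eq_zero fun x hx => by rw [h2 a x hx, mul_zero]
  set S : Vec (d + 1) → ℝ := fun x => ∑ a : T, bc hT a x * fderiv ℝ v x (a.1 - x) ^ 2 with hS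
  have hdv : ∀ x, fderiv ℝ v x (τ x) = S x := by
    intro x
    simp only [hτ, hS, map_sum, map_smul, smul_eq_mul]
    exact Finset.sum_congr rfl fun a _ => by ring
  simp only [hdv] at h1
  have hqc : ∀ a : Vec (d + 1), Continuous fun x => fderiv ℝ v x (a - x) := fun a =>
    poly_continuous (poly_fderiv_sub hv a)
  have hSc : Continuous S := continuous_finsetSum _ fun a _ =>
    (bc_continuous hT a).mul ((hqc a.1).pow 2)
  have hrc := rowSpace_continuous hr
  have hτc := rowSpace_continuous hτm
  have hvolT : volume.real (cell T) = jac T * V := measure_cell_eq hT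
  -- Young's inequality in each summand; half of the integral of `S` is absorbed on the left,
  -- because the weights λ_a add up to one.
  have h3 : ∫ x in cell T, S x ≤ h ^ 2 * R ^ 2 * (jac T * V) := by
    have h4 : ∫ x in cell T, inner ℝ (r x) (τ x) ≤
        ∫ x in cell T, (1 / 2 * S x + 1 / 2 * (h ^ 2 * R ^ 2)) := by
      refine setIntegral_mono_on (integrableOn_cell T (hrc.inner hτc))
        (integrableOn_cell T ((continuous_const.mul hSc).add continuous_const))
        (measurableSet_cell T) fun x hx => ?_
      have hb := (mem_cell_iff hT).1 hx
      have h5 : ∀ a : T, inner ℝ (r x) (a.1 - x) ^ 2 ≤ h ^ 2 * R ^ 2 := by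
        intro a
        have h6 : |inner ℝ (r x) (a.1 - x)| ≤ R * h :=
          (abs_real_inner_le_norm _ _).trans (mul_le_mul (hR x hx)
            (norm_sub_le_diam (vertex_mem_cell a.2) hx) (norm_nonneg _) hR0)
        rw [← sq_abs]
        calc |inner ℝ (r x) (a.1 - x)| ^ 2 ≤ (R * h) ^ 2 := by gcongr
          _ = _ := by ring
      have h7 : inner ℝ (r x) (τ x) =
          ∑ a : T, bc hT a x * (fderiv ℝ v x (a.1 - x) * inner ℝ (r x) (a.1 - x)) := by
        simp only [hτ, inner_sum, inner_smul_right, mul_assoc]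
      have h8 : h ^ 2 * R ^ 2 = ∑ a : T, bc hT a x * (h ^ 2 * R ^ 2) := by
        rw [← Finset.sum_mul, sum_bc, one_mul]
      rw [h7, h8, hS]
      simp only [Finset.mul_sum]
      rw [← Finset.sum_add_distrib]
      refine Finset.sum_le_sum fun a _ => ?_
      have h9 := two_mul_le_add_sq (fderiv ℝ v x (a.1 - x)) (inner ℝ (r x) (a.1 - x))
      nlinarith [mul_le_mul_of_nonneg_left h9 (hb a), mul_le_mul_of_nonneg_left (h5 a) (hb a)]
    rw [h1, integral_add (f := fun x => 1 / 2 * S x)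
      (integrableOn_cell T (continuous_const.mul hSc))
      (integrableOn_cell T continuous_const), integral_const_mul, setIntegral_const, hvolT,
      smul_eq_mul] at h4
    linarith
  set K := √(C * V) * (h * R) with hK
  have hq : ∀ a : T, ∀ x ∈ cell T, |fderiv ℝ v x (a.1 - x)| ≤ K := by
    intro a x hx
    have h4 := hw T hT _ (poly_fderiv_sub hv a.1) a x hx
    have h5 : ∫ x in cell T, bc hT a x * fderiv ℝ v x (a.1 - x) ^ 2 ≤ ∫ x in cell T, S x := by
      refine setIntegral_mono_on (integrableOn_cell T ((bc_continuous hT a).mul ((hqc a.1).pow 2)))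
        (integrableOn_cell T hSc) (measurableSet_cell T) fun x hx => ?_
      exact Finset.single_le_sum (f := fun a : T => bc hT a x * fderiv ℝ v x (a.1 - x) ^ 2)
        (fun b _ => mul_nonneg ((mem_cell_iff hT).1 hx b) (sq_nonneg _)) (Finset.mem_univ a)
    have h6 : fderiv ℝ v x (a.1 - x) ^ 2 ≤ C * V * (h * R) ^ 2 := by
      refine le_of_mul_le_mul_left (h4.trans ((mul_le_mul_of_nonneg_left (h5.trans h3) hC.le).trans
        (le_of_eq ?_))) hJ
      ring
    refine abs_le_of_sq_le_sq ?_ (by positivity)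
    rw [hK, mul_pow, Real.sq_sqrt (by positivity)]
    exact h6
  intro x hx
  -- The direction from x to a point of T is a convex combination of the directions to the vertices.
  have hy : ∀ y ∈ cell T, |fderiv ℝ v x (y - x)| ≤ K := by
    intro y hy
    rw [← sum_bc_smul_sub hT y x, map_sum]
    have hb := (mem_cell_iff hT).1 hy
    calc |∑ a : T, fderiv ℝ v x (bc hT a y • (a.1 - x))|
        ≤ ∑ a : T, |fderiv ℝ v x (bc hT a y • (a.1 - x))| := Finset.abs_sum_le_sum_abs _ _
      _ ≤ ∑ a : T, bc hT a y * K := Finset.sum_le_sum fun a _ => by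
          rw [map_smul, smul_eq_mul, abs_mul, abs_of_nonneg (hb a)]
          exact mul_le_mul_of_nonneg_left (hq a x hx) (hb a)
      _ = K := by rw [← Finset.sum_mul, sum_bc, one_mul]
  have hK0 : 0 ≤ K := by positivity
  refine ContinuousLinearMap.opNorm_le_of_unit_norm (by positivity) fun e he => ?_
  have h4 : c + ρ • e ∈ cell T := hball (by simp [norm_smul, he, abs_of_pos hρ])
  have h5 : c - ρ • e ∈ cell T := hball (by simp [norm_smul, he, abs_of_pos hρ])
  -- Two antipodal points of the inscribed ball isolate the derivative in the direction e; the
  -- factor ρ is compared with the diameter by shape regularity.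
  have h6 : fderiv ℝ v x (c + ρ • e - x) - fderiv ℝ v x (c - ρ • e - x) =
      2 * ρ * fderiv ℝ v x e := by
    rw [← map_sub, show c + ρ • e - x - (c - ρ • e - x) = (2 * ρ) • e by
      rw [mul_smul, two_smul]; abel, map_smul, smul_eq_mul]
  have h7 : |2 * ρ * fderiv ℝ v x e| ≤ 2 * K := by
    rw [← h6]
    exact (abs_sub _ _).trans (by linarith [hy _ h4, hy _ h5])
  rw [abs_mul, abs_of_pos (by positivity : (0 : ℝ) < 2 * ρ)] at h7
  have h8 : h ≤ |γ| * ρ := hdiam.trans (mul_le_mul_of_nonneg_right (le_abs_self γ) hρ.le)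
  rw [Real.norm_eq_abs]
  refine le_of_mul_le_mul_left (a := 2 * ρ) (h7.trans ?_) (by positivity)
  calc 2 * K = 2 * √(C * V) * R * h := by rw [hK]; ring
    _ ≤ 2 * √(C * V) * R * (|γ| * ρ) := by gcongr
    _ = _ := by ring

/-- Local stability: the gradient and the differences on the sides are controlled by the gradient
reconstruction. -/
theorem exists_local_bound (d : ℕ) (P : Pairing) (l : ℕ) (γ : ℝ) :
    ∃ C : ℝ, 0 < C ∧ ∀ (T : Finset (Vec (d + 1))), IsSimplex T →
      (∃ (c : Vec (d + 1)) (ρ : ℝ), 0 < ρ ∧ Metric.closedBall c ρ ⊆ cell T ∧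
        Metric.diam (cell T) ≤ γ * ρ) →
      ∀ r ∈ P.rowSpace l univ, ∀ v ∈ poly l univ, ∀ w : T → Vec (d + 1) → ℝ,
      (∀ a, w a ∈ poly (P.k l) univ) → LocalIdentity P l T r v w →
      ∀ R : ℝ, 0 ≤ R → (∀ x ∈ cell T, ‖r x‖ ≤ R) →
      (∀ x ∈ cell T, ‖fderiv ℝ v x‖ ≤ C * R) ∧
      ∀ a : T, ∀ x ∈ cell (T.erase a.1), |w a x| ≤ C * Metric.diam (cell T) * R := by
  obtain ⟨C₁, hC₁, hgrad⟩ := exists_gradient_bound d P l γ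
  obtain ⟨C₂, hC₂, hlift⟩ := exists_normal_lift d P l
  obtain ⟨C₃, hC₃, hside⟩ := exists_side_bound d (P.k l)
  set V := (volume : Measure (Vec (d + 1))).real (refSimplex (d + 1)) with hV
  have hV0 : 0 < V := volume_refSimplex_pos _
  refine ⟨C₁ + 1 + C₃ * V * (1 + C₁) * C₂, by positivity, ?_⟩
  intro T hT hsh r hr v hv w hwp hloc R hR0 hR
  have hg := hgrad T hT hsh r hr v hv w hloc R hR0 hR
  refine ⟨fun x hx => (hg x hx).trans ?_, fun a x hx => ?_⟩
  · have : 0 ≤ C₃ * V * (1 + C₁) * C₂ := by positivity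
    exact mul_le_mul_of_nonneg_right (by linarith) hR0
  set h := Metric.diam (cell T) with hh
  have hh0 : 0 ≤ h := Metric.diam_nonneg
  have hJ := jac_pos hT
  have hH := height_pos hT a
  have hwc := poly_continuous (hwp a)
  obtain ⟨x₀, hx₀, hmax⟩ := (isCompact_cell (T.erase a.1)).exists_isMaxOn ⟨x, hx⟩
    hwc.abs.continuousOn
  set s := |w a x₀| with hs
  have hs0 : 0 ≤ s := abs_nonneg _
  have hws : ∀ x ∈ cell (T.erase a.1), |w a x| ≤ s := fun x hx => hmax hx
  -- The test function is the lift of `w a` itself, so that the side terms reduce to the integral of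
  -- its square over one side. Its maximum s there is then estimated by itself.
  obtain ⟨σ, hσ, hσa, hσc, hσn⟩ := hlift T hT a (w a) (hwp a) s hs0 hws
  have h1 := hloc σ hσ
  have h2 : ∑ c : T, ∫ x in cell (T.erase c.1),
      w c x * inner ℝ (σ x) (outerNormal T (T.erase c.1)) ∂μHE[d] =
      ∫ x in cell (T.erase a.1), w a x ^ 2 ∂μHE[d] := by
    rw [Finset.sum_eq_single_of_mem a (Finset.mem_univ a)]
    · refine setIntegral_congr_fun (measurableSet_cell _) fun x hx => ?_
      rw [hσa x hx, sq]
    · intro c _ hc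
      exact setIntegral_eq_zero_of_forall_eq_zero fun x hx => by rw [hσc c hc x hx, mul_zero]
  rw [h2] at h1
  set B := C₂ * (h / height T a) * s with hB
  have hB0 : 0 ≤ B := by positivity
  have hσcont := rowSpace_continuous hσ
  have hrc := rowSpace_continuous hr
  have hvol : volume.real (cell T) = jac T * V := measure_cell_eq hT
  have hfin : volume (cell T) < ⊤ := (isCompact_cell T).measure_lt_top
  have h3 : |∫ x in cell T, inner ℝ (r x) (σ x)| ≤ R * B * (jac T * V) := by
    rw [← hvol, ← Real.norm_eq_abs]
    refine norm_setIntegral_le_of_norm_le_const hfin fun x hx => ?_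
    exact (norm_inner_le_norm _ _).trans (mul_le_mul (hR x hx) (hσn x hx) (norm_nonneg _) hR0)
  have h4 : |∫ x in cell T, fderiv ℝ v x (σ x)| ≤ C₁ * R * B * (jac T * V) := by
    rw [← hvol, ← Real.norm_eq_abs]
    refine norm_setIntegral_le_of_norm_le_const hfin fun x hx => ?_
    exact ((fderiv ℝ v x).le_opNorm _).trans
      (mul_le_mul (hg x hx) (hσn x hx) (norm_nonneg _) (by positivity))
  have h5 : ∫ x in cell (T.erase a.1), w a x ^ 2 ∂μHE[d] ≤ (1 + C₁) * R * B * (jac T * V) := by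
    have := abs_le.1 h3
    have := abs_le.1 h4
    linarith
  have h6 := hside T hT (w a) (hwp a) a x₀ hx₀
  -- The height in the bound on the side cancels the one in the denominator of the lift; what is
  -- left is a factor h. The common factor s is divided out next.
  have h7 : s * s ≤ C₃ * V * (1 + C₁) * C₂ * h * R * s := by
    have h8 : jac T * w a x₀ ^ 2 = jac T * (s * s) := by rw [hs, ← sq, sq_abs]
    rw [h8] at h6
    refine le_of_mul_le_mul_left (h6.trans ((mul_le_mul_of_nonneg_left
      (mul_le_mul_of_nonneg_left h5 hH.le) hC₃.le).trans (le_of_eq ?_))) hJ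
    rw [hB]
    field_simp
  have h9 : s ≤ C₃ * V * (1 + C₁) * C₂ * h * R := by
    rcases hs0.eq_or_lt with h0 | h0
    · rw [← h0]; positivity
    · exact le_of_mul_le_mul_right h7 h0
  refine (hws x hx).trans (h9.trans ?_)
  have : 0 ≤ (C₁ + 1) * (h * R) := by positivity
  linarith

end

section

variable {d : ℕ} {T : Finset (Vec (d + 1))} {Ω : Set (Vec (d + 1))}
  {𝒯 : Finset (Finset (Vec (d + 1)))}

/-! ### Triangulations -/

lemma IsTriangulation.isSimplex (h : IsTriangulation Ω 𝒯) {T : Finset (Vec (d + 1))} (hT : T ∈ 𝒯) :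
    IsSimplex T := ⟨h.card_eq T hT, h.affineIndependent T hT⟩

lemma cell_erase_subset_frontier (hT : IsSimplex T) (a : T) :
    cell (T.erase a.1) ⊆ frontier (cell T) := by
  intro x hx
  rw [(isCompact_cell T).isClosed.frontier_eq]
  refine ⟨cell_erase_subset T a.1 hx, fun h => ?_⟩
  have := (mem_interior_cell_iff hT).1 h a
  rw [bc_eq_zero_of_mem_side hT a hx] at this
  exact lt_irrefl _ this

lemma volume_frontier_cell {n : ℕ} (T : Finset (Vec n)) : volume (frontier (cell T)) = 0 :=
  Convex.addHaar_frontier volume (convex_convexHull ℝ _)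

/-- Distinct simplices have equally many vertices, so T has a vertex that T' lacks. By regularity of
the triangulation the intersection lies in the opposite side of T, which is part of a null set. -/
lemma volume_inter_cell (h : IsTriangulation Ω 𝒯) {T T' : Finset (Vec (d + 1))} (hT : T ∈ 𝒯)
    (hT' : T' ∈ 𝒯) (hne : T ≠ T') : volume (cell T ∩ cell T') = 0 := by
  have hS := h.isSimplex hT
  obtain ⟨a, haT, haT'⟩ : ∃ a ∈ T, a ∉ T' := by
    by_contra! hcon
    exact hne (Finset.eq_of_subset_of_card_le hcon
      (by rw [h.card_eq T hT, h.card_eq T' hT']))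
  refine measure_mono_null ?_ (volume_frontier_cell T)
  rw [h.inter_eq T hT T' hT']
  refine subset_trans (convexHull_mono ?_) (cell_erase_subset_frontier hS ⟨a, haT⟩)
  rintro x ⟨hx, hx'⟩
  simp only [Finset.coe_erase, mem_diff, mem_singleton_iff]
  exact ⟨hx, fun hxa => haT' (by rw [← hxa]; exact hx')⟩

lemma cell_subset_closure (h : IsTriangulation Ω 𝒯) {T : Finset (Vec (d + 1))} (hT : T ∈ 𝒯) :
    cell T ⊆ closure Ω := by
  rw [← h.covers]
  exact subset_biUnion_of_mem (u := fun T => cell T) hT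

/-- A null boundary is not assumed but follows: the interior of each simplex is an open subset of
closure Ω and hence contained in Ω = int closure Ω, so closure Ω \ Ω consists of boundary points of
simplices. -/
lemma closure_ae_eq (h : IsTriangulation Ω 𝒯) (hΩr : interior (closure Ω) = Ω) :
    (Ω : Set (Vec (d + 1))) =ᵐ[volume] closure Ω := by
  refine (Filter.EventuallyLE.antisymm (HasSubset.Subset.eventuallyLE subset_closure) ?_)
  rw [ae_le_set]
  have h1 : closure Ω \ Ω ⊆ ⋃ T ∈ 𝒯, frontier (cell T) := by
    rintro x ⟨hx, hxΩ⟩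
    have hx' := hx
    rw [← h.covers] at hx
    simp only [mem_iUnion, exists_prop] at hx ⊢
    obtain ⟨T, hT, hxT⟩ := hx
    refine ⟨T, hT, ?_⟩
    rw [(isCompact_cell T).isClosed.frontier_eq]
    refine ⟨hxT, fun hi => hxΩ ?_⟩
    rw [← hΩr]
    exact interior_mono (cell_subset_closure h hT) hi
  refine measure_mono_null h1 ?_
  exact (measure_biUnion_null_iff 𝒯.countable_toSet).2 fun T _ => volume_frontier_cell T

lemma restrict_eq_sum (h : IsTriangulation Ω 𝒯) (hΩr : interior (closure Ω) = Ω) :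
    (volume : Measure (Vec (d + 1))).restrict Ω =
      Measure.sum fun T : 𝒯 => volume.restrict (cell T.1) := by
  have hU : (⋃ T ∈ 𝒯, cell T) = ⋃ T : 𝒯, cell T.1 := by ext x; simp
  rw [Measure.restrict_congr_set (closure_ae_eq h hΩr), ← h.covers, hU]
  refine Measure.restrict_iUnion_ae ?_ fun T => (measurableSet_cell T.1).nullMeasurableSet
  intro T T' hne
  exact volume_inter_cell h T.2 T'.2 fun hh => hne (Subtype.ext hh)

lemma integral_eq_sum_cells (h : IsTriangulation Ω 𝒯) (hΩr : interior (closure Ω) = Ω)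
    {E : Type*} [NormedAddCommGroup E] [NormedSpace ℝ E] {f : Vec (d + 1) → E}
    (hf : ∀ T : 𝒯, IntegrableOn f (cell T.1)) :
    ∫ x in Ω, f x = ∑ T : 𝒯, ∫ x in cell T.1, f x := by
  rw [restrict_eq_sum h hΩr, Measure.sum_fintype, integral_finsetSum_measure fun T _ => hf T]

lemma integrableOn_of_cells (h : IsTriangulation Ω 𝒯) (hΩr : interior (closure Ω) = Ω)
    {E : Type*} [NormedAddCommGroup E] {f : Vec (d + 1) → E}
    (hf : ∀ T : 𝒯, IntegrableOn f (cell T.1)) : IntegrableOn f Ω := by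
  rw [IntegrableOn, restrict_eq_sum h hΩr, Measure.sum_fintype]
  exact integrable_finsetSum_measure.2 fun T _ => hf T

lemma ae_mem_interior_cell {n : ℕ} (T : Finset (Vec n)) :
    ∀ᵐ x ∂volume.restrict (cell T), x ∈ interior (cell T) := by
  rw [ae_restrict_iff' (measurableSet_cell T), ae_iff]
  refine measure_mono_null ?_ (volume_frontier_cell T)
  intro x hx
  simp only [mem_setOf_eq, Classical.not_imp] at hx
  rw [(isCompact_cell T).isClosed.frontier_eq]
  exact hx

lemma ae_notMem_cell (h : IsTriangulation Ω 𝒯) (T : 𝒯) :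
    ∀ᵐ x ∂volume.restrict (cell T.1), ∀ T' : 𝒯, T' ≠ T → x ∉ cell T'.1 := by
  rw [ae_all_iff]
  intro T'
  by_cases hne : T' = T
  · exact Filter.Eventually.of_forall fun x h1 => absurd hne h1
  · rw [ae_restrict_iff' (measurableSet_cell _), ae_iff]
    refine measure_mono_null ?_ (volume_inter_cell h T.2 T'.2 fun hh => hne (Subtype.ext hh.symm))
    intro x hx
    simp only [mem_setOf_eq, Classical.not_imp, not_not] at hx
    exact ⟨hx.1, hx.2.2⟩

lemma glue_ae (h : IsTriangulation Ω 𝒯) {G : Type*} [AddCommGroup G] [Module ℝ G]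
    {S : 𝒯 → Submodule ℝ (Vec (d + 1) → G)}
    (hS : ∀ T, ∀ g ∈ S T, ∀ x ∉ cell T.1, g x = 0) (q : (T : 𝒯) → S T) (T : 𝒯) :
    ∀ᵐ x ∂volume.restrict (cell T.1), glue q x = (q T : Vec (d + 1) → G) x := by
  filter_upwards [ae_notMem_cell h T] with x hx
  rw [glue, Finset.sum_eq_single_of_mem T (Finset.mem_univ _)]
  intro T' _ hne
  exact hS T' _ (q T').2 x (hx T' hne)

/-! ### Sides -/

lemma sides_card {F : Finset (Vec (d + 1))} (hF : F ∈ sides 𝒯) : F.card = d + 1 := by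
  simp only [sides, Finset.mem_biUnion, Finset.mem_powersetCard] at hF
  obtain ⟨T, -, -, h⟩ := hF
  exact h

lemma erase_mem_sides (h : IsTriangulation Ω 𝒯) (T : 𝒯) (a : T.1) : T.1.erase a.1 ∈ sides 𝒯 := by
  simp only [sides, Finset.mem_biUnion, Finset.mem_powersetCard]
  exact ⟨T.1, T.2, Finset.erase_subset _ _, erase_card (h.isSimplex T.2) a⟩

lemma eq_erase_of_subset (hT : IsSimplex T) {F : Finset (Vec (d + 1))} (hc : F.card = d + 1)
    (hF : F ⊆ T) : ∃ a : T, F = T.erase a.1 := by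
  classical
  have h1 : (T \ F).card = 1 := by
    rw [Finset.card_sdiff_of_subset hF, hT.card_eq, hc]; omega
  obtain ⟨a, ha⟩ := Finset.card_eq_one.1 h1
  have haT : a ∈ T := (Finset.mem_sdiff.1 (by rw [ha]; exact Finset.mem_singleton_self a)).1
  refine ⟨⟨a, haT⟩, ?_⟩
  rw [← Finset.sdiff_singleton_eq_erase, ← ha, Finset.sdiff_sdiff_eq_self hF]

open Classical in
lemma sum_sides_of_simplex (h : IsTriangulation Ω 𝒯) (T : 𝒯) {M : Type*} [AddCommMonoid M]
    (G : Finset (Vec (d + 1)) → M) :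
    ∑ F ∈ sides 𝒯, (if F ⊆ T.1 then G F else 0) = ∑ a : T.1, G (T.1.erase a.1) := by
  have h1 : (sides 𝒯).filter (fun F => F ⊆ T.1) =
      Finset.univ.image fun a : T.1 => T.1.erase a.1 := by
    ext F
    simp only [Finset.mem_filter, Finset.mem_image, Finset.mem_univ, true_and]
    constructor
    · rintro ⟨hF, hFT⟩
      obtain ⟨a, ha⟩ := eq_erase_of_subset (h.isSimplex T.2) (sides_card hF) hFT
      exact ⟨a, ha.symm⟩
    · rintro ⟨a, rfl⟩
      exact ⟨erase_mem_sides h T a, Finset.erase_subset _ _⟩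
  rw [← Finset.sum_filter, h1, Finset.sum_image]
  intro a _ b _ hab
  by_contra hne
  have h2 : a.1 ∈ T.1.erase b.1 := Finset.mem_erase.2 ⟨fun hh => hne (Subtype.ext hh), a.2⟩
  have h3 : T.1.erase a.1 = T.1.erase b.1 := hab
  rw [← h3] at h2
  exact (Finset.notMem_erase a.1 T.1) h2

open Classical in
-- This reorders the boundary terms of elementwise integration by parts, so that contributions of
-- neighbours meet on their common side.
lemma sum_simplices_sides (h : IsTriangulation Ω 𝒯) {M : Type*} [AddCommMonoid M]
    (G : 𝒯 → Finset (Vec (d + 1)) → M) :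
    ∑ T : 𝒯, ∑ a : T.1, G T (T.1.erase a.1) =
      ∑ F ∈ sides 𝒯, ∑ T : 𝒯, if F ⊆ T.1 then G T F else 0 := by
  rw [Finset.sum_comm]
  exact Finset.sum_congr rfl fun T _ => (sum_sides_of_simplex h T (G T)).symm

lemma cell_side_subset {n : ℕ} {F T : Finset (Vec n)} (h : F ⊆ T) : cell F ⊆ cell T :=
  convexHull_mono (by exact_mod_cast h)

/-- An interior side is only known to contain some point of Ω, possibly on its relative boundary. A
small step towards the relative interior stays in the open set. -/
lemma exists_refOpen_chart_mem {n k : ℕ} {U : Set (Vec n)} (hU : IsOpen U) {z : Vec n}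
    {e : Fin k → Vec n} {y : Vec k} (hy : y ∈ refSimplex k) (hyU : chart z e y ∈ U) :
    ∃ y₀ ∈ refOpen k, chart z e y₀ ∈ U := by
  obtain ⟨c, hc⟩ := refOpen_nonempty k
  have hcont : Continuous fun t : ℝ => chart z e ((1 - t) • y + t • c) :=
    (continuous_chart z e).comp (by fun_prop)
  have h0 : (fun t : ℝ => chart z e ((1 - t) • y + t • c)) 0 ∈ U := by simpa using hyU
  have h1 := (hcont.tendsto 0).eventually (hU.mem_nhds h0)
  have h2 : ∀ᶠ t : ℝ in nhdsWithin 0 (Ioi 0), chart z e ((1 - t) • y + t • c) ∈ U :=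
    h1.filter_mono nhdsWithin_le_nhds
  have h3 : ∀ᶠ t : ℝ in nhdsWithin 0 (Ioi 0), t ∈ Ioo (0 : ℝ) 1 :=
    Ioo_mem_nhdsGT one_pos
  obtain ⟨t, ht1, ht2⟩ := (h2.and h3).exists
  refine ⟨(1 - t) • y + t • c, ⟨fun i => ?_, ?_⟩, ht1⟩
  · have := hy.1 i
    have := hc.1 i
    have h4 : 0 ≤ 1 - t := by linarith [ht2.2]
    have h5 := ht2.1
    simp only [PiLp.add_apply, PiLp.smul_apply, smul_eq_mul]
    positivity
  · simp only [PiLp.add_apply, PiLp.smul_apply, smul_eq_mul, Finset.sum_add_distrib,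
      ← Finset.mul_sum]
    have := hy.2
    have := hc.2
    have h4 : 0 ≤ 1 - t := by linarith [ht2.2]
    have h5 := ht2.1
    nlinarith

lemma affine_chart_pos {n k : ℕ} (L : Vec n →ᵃ[ℝ] ℝ) {z : Vec n} {e : Fin k → Vec n} {y : Vec k}
    (hy : y ∈ refOpen k) (h0 : ∀ v ∈ insert z (range e), 0 ≤ L v) {c : Vec n}
    (hc : c ∈ insert z (range e)) (hLc : 0 < L c) : 0 < L (chart z e y) := by
  have h1 : L (chart z e y) = (1 - ∑ i, y i) * L z + ∑ i, y i * L (e i) := by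
    rw [affine_chart]
    simp only [mul_sub, Finset.sum_sub_distrib, ← Finset.sum_mul]
    ring
  have hz := h0 z (mem_insert _ _)
  have he : ∀ i, 0 ≤ L (e i) := fun i => h0 _ (mem_insert_of_mem _ (mem_range_self i))
  have hs : 0 < 1 - ∑ i, y i := sub_pos.2 hy.2
  rw [h1]
  rcases hc with rfl | ⟨j, rfl⟩
  · exact add_pos_of_pos_of_nonneg (mul_pos hs hLc)
      (Finset.sum_nonneg fun i _ => mul_nonneg (hy.1 i).le (he i))
  · refine add_pos_of_nonneg_of_pos (mul_nonneg hs.le hz) ?_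
    exact Finset.sum_pos' (fun i _ => mul_nonneg (hy.1 i).le (he i))
      ⟨j, Finset.mem_univ j, mul_pos (hy.1 j) hLc⟩

lemma mem_interiorSides {F : Finset (Vec (d + 1))} :
    F ∈ interiorSides Ω 𝒯 ↔ F ∈ sides 𝒯 ∧ ¬ cell F ⊆ frontier Ω := by
  simp [interiorSides]

open Classical in
/-- The outer normals along an interior side cancel. -/
theorem sum_outerNormal_eq_zero (h : IsTriangulation Ω 𝒯) (hΩo : IsOpen Ω)
    (hΩr : interior (closure Ω) = Ω) {F : Finset (Vec (d + 1))} (hF : F ∈ interiorSides Ω 𝒯) :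
    ∑ T : 𝒯, (if F ⊆ T.1 then outerNormal T.1 F else 0) = 0 := by
  obtain ⟨hFs, hFf⟩ := mem_interiorSides.1 hF
  have hFc := sides_card hFs
  have hFs' := hFs
  simp only [sides, Finset.mem_biUnion, Finset.mem_powersetCard] at hFs'
  obtain ⟨T₀, hT₀, hFT₀, -⟩ := hFs'
  have hS₀ := h.isSimplex hT₀
  obtain ⟨a₀, ha₀⟩ := eq_erase_of_subset hS₀ hFc hFT₀
  obtain ⟨z, hz⟩ : F.Nonempty := Finset.card_pos.1 (by omega)
  obtain ⟨e, -, -, he, -⟩ := exists_enum hFc hz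
  obtain ⟨y, hyF, hyf⟩ := not_subset.1 hFf
  have hyΩ : y ∈ Ω := by
    have h1 := cell_subset_closure h hT₀ (cell_side_subset hFT₀ hyF)
    by_contra h2
    exact hyf ⟨h1, by rwa [hΩo.interior_eq]⟩
  rw [cell_eq_image_chart he] at hyF
  obtain ⟨y', hy', rfl⟩ := hyF
  obtain ⟨y₀, hy₀, hxΩ⟩ := exists_refOpen_chart_mem hΩo hy' hyΩ
  set x := chart z e y₀ with hx
  have hxF : x ∈ cell F := by
    rw [cell_eq_image_chart he]; exact mem_image_of_mem _ (refOpen_subset _ hy₀)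
  have hpos : ∀ T ∈ 𝒯, ∀ hT : IsSimplex T, F ⊆ T → ∀ c : T, c.1 ∈ F → 0 < bc hT c x := by
    intro T _ hT hFT c hc
    refine affine_chart_pos (bc hT c) hy₀ (fun v hv => ?_) (c := c.1) (by rw [← he]; exact hc)
      (by rw [bc_self]; exact one_pos)
    rw [← he] at hv
    exact (mem_cell_iff hT).1 (vertex_mem_cell (hFT (by exact_mod_cast hv))) c
  -- A relative interior point x of F lies on no other side F' of a simplex T'. Regularity and the
  -- positivity of the barycentric coordinates of x at the vertices of F give F ⊆ T'; the vertex of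
  -- T' opposite F' has coordinate zero at x and so is not in F. Hence F ⊆ F', with equal
  -- cardinality.
  have honly : ∀ F' ∈ sides 𝒯, x ∈ cell F' → F' = F := by
    intro F' hF' hxF'
    have hF'c := sides_card hF'
    simp only [sides, Finset.mem_biUnion, Finset.mem_powersetCard] at hF'
    obtain ⟨T', hT', hFT', -⟩ := hF'
    have hS' := h.isSimplex hT'
    have hxi : x ∈ convexHull ℝ ((T₀ : Set (Vec (d + 1))) ∩ (T' : Set (Vec (d + 1)))) := by
      rw [← h.inter_eq T₀ hT₀ T' hT']
      exact ⟨cell_side_subset hFT₀ hxF, cell_side_subset hFT' hxF'⟩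
    have hsub : F ⊆ T' := by
      intro c hc
      by_contra hcT'
      have h1 := hpos T₀ hT₀ hS₀ hFT₀ ⟨c, hFT₀ hc⟩ hc
      have h2 : x ∈ cell (T₀.erase c) := by
        refine convexHull_mono ?_ hxi
        rintro v ⟨hv, hv'⟩
        simp only [Finset.coe_erase, mem_diff, mem_singleton_iff]
        exact ⟨hv, fun hh => hcT' (by rw [← hh]; exact hv')⟩
      rw [bc_eq_zero_of_mem_side hS₀ ⟨c, hFT₀ hc⟩ h2] at h1
      exact lt_irrefl _ h1
    obtain ⟨a', ha'⟩ := eq_erase_of_subset hS' hF'c hFT'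
    have ha'F : a'.1 ∉ F := by
      intro hh
      have h1 := hpos T' hT' hS' hsub a' hh
      rw [ha'] at hxF'
      rw [bc_eq_zero_of_mem_side hS' a' hxF'] at h1
      exact lt_irrefl _ h1
    refine (Finset.eq_of_subset_of_card_le (fun c hc => ?_) (by rw [hFc, hF'c])).symm
    rw [ha']
    exact Finset.mem_erase.2 ⟨fun hh => ha'F (by rw [← hh]; exact hc), hsub hc⟩
  -- A bump function supported in `U` sees no side except F and vanishes near the boundary of Ω.
  set U : Set (Vec (d + 1)) := Ω ∩ (⋃ F' ∈ (sides 𝒯).erase F, cell F')ᶜ with hU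
  have hUo : IsOpen U := hΩo.inter (isOpen_compl_iff.2 (isClosed_biUnion_finset
    fun F' _ => (isCompact_cell F').isClosed))
  have hxU : x ∈ U := by
    refine ⟨hxΩ, fun hh => ?_⟩
    simp only [mem_iUnion, exists_prop] at hh
    obtain ⟨F', hF', hxF'⟩ := hh
    exact Finset.ne_of_mem_erase hF' (honly F' (Finset.mem_of_mem_erase hF') hxF')
  obtain ⟨ε, hε, hεU⟩ := Metric.isOpen_iff.1 hUo x hxU
  let φ : ContDiffBump x := ⟨ε / 4, ε / 2, by positivity, by linarith⟩
  have hφc : ContDiff ℝ 1 (φ : Vec (d + 1) → ℝ) := φ.contDiff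
  have hφU : tsupport (φ : Vec (d + 1) → ℝ) ⊆ U := by
    rw [φ.tsupport_eq]
    exact (Metric.closedBall_subset_ball (by show ε / 2 < ε; linarith)).trans hεU
  have hφ0 : ∀ v, v ∉ U → φ v = 0 := fun v hv => image_eq_zero_of_notMem_tsupport fun hh => hv (hφU hh)
  set I := ∫ v in cell F, φ v ∂μHE[d] with hI
  have hIpos : 0 < I := by
    have h1 := integral_side hS₀ a₀ (z := z) (x := e) (by rw [← ha₀, he]) φ
    rw [← ha₀] at h1
    have hcc : Continuous fun y => φ (chart z e y) := φ.continuous.comp (continuous_chart z e)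
    have h2 : 0 < ∫ y in refSimplex d, φ (chart z e y) := by
      rw [setIntegral_pos_iff_support_of_nonneg_ae (Filter.Eventually.of_forall fun y => φ.nonneg)
        (hcc.continuousOn.integrableOn_compact (isCompact_refSimplex d))]
      have h3 : IsOpen (refOpen d ∩ (fun y => φ (chart z e y)) ⁻¹' Ioi 0) :=
        (isOpen_refOpen d).inter (isOpen_Ioi.preimage hcc)
      refine (h3.measure_pos volume ⟨y₀, hy₀, ?_⟩).trans_le (measure_mono ?_)
      · exact φ.pos_of_mem_ball (Metric.mem_ball_self φ.rOut_pos)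
      · rintro y ⟨hy, hy2⟩
        exact ⟨ne_of_gt hy2, refOpen_subset d hy⟩
    have h4 : 0 < height T₀ a₀ * I := by rw [h1]; exact mul_pos (jac_pos hS₀) h2
    exact pos_of_mul_pos_right h4 (height_pos hS₀ a₀).le
  have hfc : Continuous (fderiv ℝ (φ : Vec (d + 1) → ℝ)) := hφc.continuous_fderiv one_ne_zero
  -- The derivative of a function with compact support in Ω has integral zero.
  have hzero : ∀ e : Vec (d + 1), ∫ v in Ω, fderiv ℝ φ v e = 0 := by
    intro e
    have h1 : ∫ v in Ω, fderiv ℝ φ v e = ∫ v, fderiv ℝ φ v e := by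
      refine setIntegral_eq_integral_of_forall_compl_eq_zero fun v hv => ?_
      rw [image_eq_zero_of_notMem_tsupport (f := fderiv ℝ φ) fun hh =>
        hv (hφU (tsupport_fderiv_subset ℝ hh)).1]
      rfl
    rw [h1]
    have hcs : HasCompactSupport (φ : Vec (d + 1) → ℝ) := φ.hasCompactSupport
    have hcs' : HasCompactSupport fun v => fderiv ℝ φ v e :=
      (hcs.fderiv ℝ).comp_left (g := fun L : Vec (d + 1) →L[ℝ] ℝ => L e) rfl
    have h2 := integral_bilinear_hasLineDerivAt_right_eq_neg_left_of_integrable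
      (μ := (volume : Measure (Vec (d + 1)))) (B := ContinuousLinearMap.mul ℝ ℝ)
      (f := fun _ => (1 : ℝ)) (f' := fun _ => 0) (g := (φ : Vec (d + 1) → ℝ))
      (g' := fun v => fderiv ℝ φ v e) (v := e)
      (by simp)
      (by simpa using (hfc.clm_apply continuous_const).integrable_of_hasCompactSupport hcs')
      (by simpa using φ.continuous.integrable_of_hasCompactSupport hcs)
      (fun v _ => by
        have h3 : HasFDerivAt (fun _ : Vec (d + 1) => (1 : ℝ)) (0 : Vec (d + 1) →L[ℝ] ℝ) v :=
          hasFDerivAt_const 1 v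
        exact h3.hasLineDerivAt e)
      (fun v _ => (hφc.differentiable one_ne_zero v).hasFDerivAt.hasLineDerivAt e)
    simpa using h2
  -- Gauss' theorem on every simplex leaves only the side F, with the positive factor `I`. The
  -- number and the relative position of the simplices at F need not be known.
  have hN : ∀ e : Vec (d + 1),
      inner ℝ (∑ T : 𝒯, (if F ⊆ T.1 then outerNormal T.1 F else 0)) e = 0 := by
    intro e
    have h1 := hzero e
    rw [integral_eq_sum_cells h hΩr fun T => integrableOn_cell T.1 (hfc.clm_apply continuous_const)] at h1
    simp only [fun T : 𝒯 => integral_fderiv_cell (h.isSimplex T.2) hφc e] at h1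
    rw [sum_simplices_sides h (fun T F' => (∫ x in cell F', φ x ∂μHE[d]) * inner ℝ (outerNormal T.1 F') e),
      Finset.sum_eq_single_of_mem F hFs] at h1
    · simp only [← hI] at h1
      have h2 : ∑ T : 𝒯, (if F ⊆ T.1 then I * inner ℝ (outerNormal T.1 F) e else 0) =
          I * inner ℝ (∑ T : 𝒯, (if F ⊆ T.1 then outerNormal T.1 F else 0)) e := by
        rw [sum_inner, Finset.mul_sum]
        refine Finset.sum_congr rfl fun T _ => ?_
        split_ifs <;> simp
      rw [h2] at h1
      exact (mul_eq_zero.1 h1).resolve_left hIpos.ne'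
    · intro F' hF' hne
      refine Finset.sum_eq_zero fun T _ => ?_
      split_ifs with hFT
      · rw [setIntegral_eq_zero_of_forall_eq_zero fun v hv => ?_, zero_mul]
        refine hφ0 v fun hvU => hvU.2 ?_
        simp only [mem_iUnion, exists_prop]
        exact ⟨F', Finset.mem_erase.2 ⟨hne, hF'⟩, hv⟩
      · rfl
  exact inner_self_eq_zero.1 (hN _)

end

section

/-! ### Piecewise functions with rows in a local space -/

section LocalSpace

variable {n m : ℕ} {G : Type*} [NormedAddCommGroup G] [InnerProductSpace ℝ G]

/-- A family of spaces of functions on sets which consist of the restrictions of a finite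
dimensional space of continuous functions with unique continuation. -/
structure IsLocalSpace (A : Set (Vec n) → Submodule ℝ (Vec n → G)) : Prop where
  mem_iff : ∀ {K g}, g ∈ A K ↔ ∃ σ ∈ A univ, g = K.indicator σ
  continuous : ∀ {σ}, σ ∈ A univ → Continuous σ
  eq_zero : ∀ {σ}, σ ∈ A univ → ∀ {U : Set (Vec n)}, IsOpen U → U.Nonempty →
    (∀ x ∈ U, σ x = 0) → σ = 0
  finite : Module.Finite ℝ (A univ)

/-- Functions with values in a power of `G` and with all components in a given space. -/
def rowsIn (m : ℕ) (S : Submodule ℝ (Vec n → G)) :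
    Submodule ℝ (Vec n → PiLp 2 fun _ : Fin m => G) where
  carrier := {τ | ∀ i, (fun x => τ x i) ∈ S}
  zero_mem' := fun _ => S.zero_mem
  add_mem' := fun ha hb i => S.add_mem (ha i) (hb i)
  smul_mem' := fun c _ ha i => S.smul_mem c (ha i)

variable {A : Set (Vec n) → Submodule ℝ (Vec n → G)}

/-- The extension is not unique if K is a side, because polynomials may vanish on a hyperplane. A
linear right inverse of the restriction map selects extensions in a linear way. -/
lemma IsLocalSpace.exists_ext (hA : IsLocalSpace A) (K : Set (Vec n)) :
    ∃ E : A K →ₗ[ℝ] A univ, ∀ g : A K, (g : Vec n → G) = K.indicator (E g : Vec n → G) := by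
  let φ : A univ →ₗ[ℝ] (Vec n → G) :=
    { toFun := fun σ => K.indicator (σ : Vec n → G)
      map_add' := fun σ τ => indicator_add K _ _
      map_smul' := fun c σ => indicator_const_smul K c _ }
  have hle : A K ≤ LinearMap.range φ := by
    intro g hg
    obtain ⟨σ, hσ, rfl⟩ := hA.mem_iff.1 hg
    exact ⟨⟨σ, hσ⟩, rfl⟩
  obtain ⟨E, hE⟩ := LinearMap.exists_rightInverse_of_surjective φ.rangeRestrict
    φ.range_rangeRestrict
  refine ⟨E ∘ₗ Submodule.inclusion hle, fun g => ?_⟩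
  have h1 := LinearMap.congr_fun hE (Submodule.inclusion hle g)
  exact (congrArg Subtype.val h1).symm

/-- Extension of the functions on `K` to `ℝⁿ`. -/
noncomputable def ext (hA : IsLocalSpace A) (K : Set (Vec n)) : A K →ₗ[ℝ] A univ :=
  (hA.exists_ext K).choose

lemma eq_indicator_ext (hA : IsLocalSpace A) {K : Set (Vec n)} (g : A K) :
    (g : Vec n → G) = K.indicator (ext hA K g : Vec n → G) :=
  (hA.exists_ext K).choose_spec g

/-- The components of a function on `K`, extended to `ℝⁿ`. -/
noncomputable def row (hA : IsLocalSpace A) {K : Set (Vec n)} (i : Fin m) :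
    rowsIn m (A K) →ₗ[ℝ] A univ :=
  ext hA K ∘ₗ
    { toFun := fun g => ⟨fun x => (g : Vec n → PiLp 2 fun _ : Fin m => G) x i, g.2 i⟩
      map_add' := fun _ _ => rfl
      map_smul' := fun _ _ => rfl }

/-- A function on `K` extended to `ℝⁿ`. -/
noncomputable def rowFun (hA : IsLocalSpace A) {K : Set (Vec n)} (g : rowsIn m (A K)) (x : Vec n) :
    PiLp 2 fun _ : Fin m => G :=
  WithLp.toLp 2 fun i => (row hA i g : Vec n → G) x

lemma rowFun_apply (hA : IsLocalSpace A) {K : Set (Vec n)} (g : rowsIn m (A K)) (x : Vec n)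
    (i : Fin m) : rowFun hA g x i = (row hA i g : Vec n → G) x := rfl

lemma row_continuous (hA : IsLocalSpace A) {K : Set (Vec n)} (i : Fin m) (g : rowsIn m (A K)) :
    Continuous (row hA i g : Vec n → G) := hA.continuous (row hA i g).2

lemma rowFun_continuous (hA : IsLocalSpace A) {K : Set (Vec n)} (g : rowsIn m (A K)) :
    Continuous (rowFun hA g) :=
  (PiLp.continuous_toLp 2 _).comp (continuous_pi fun i => row_continuous hA i g)

lemma row_spec (hA : IsLocalSpace A) {K : Set (Vec n)} (i : Fin m) (g : rowsIn m (A K)) :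
    (fun x => (g : Vec n → PiLp 2 fun _ : Fin m => G) x i) =
      K.indicator (row hA i g : Vec n → G) :=
  eq_indicator_ext hA ⟨fun x => (g : Vec n → PiLp 2 fun _ : Fin m => G) x i, g.2 i⟩

lemma eq_rowFun (hA : IsLocalSpace A) {K : Set (Vec n)} (g : rowsIn m (A K)) {x : Vec n}
    (hx : x ∈ K) : (g : Vec n → PiLp 2 fun _ : Fin m => G) x = rowFun hA g x := by
  ext i
  rw [rowFun_apply]
  have h := congrFun (row_spec hA i g) x
  rwa [indicator_of_mem hx] at h

lemma eq_zero_of_notMem (hA : IsLocalSpace A) {K : Set (Vec n)} (g : rowsIn m (A K)) {x : Vec n}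
    (hx : x ∉ K) : (g : Vec n → PiLp 2 fun _ : Fin m => G) x = 0 := by
  ext i
  have h := congrFun (row_spec hA i g) x
  rwa [indicator_of_notMem hx] at h

lemma rowFun_add (hA : IsLocalSpace A) {K : Set (Vec n)} (g h : rowsIn m (A K)) (x : Vec n) :
    rowFun hA (g + h) x = rowFun hA g x + rowFun hA h x := by
  ext i; simp [rowFun_apply]

lemma rowFun_smul (hA : IsLocalSpace A) {K : Set (Vec n)} (c : ℝ) (g : rowsIn m (A K))
    (x : Vec n) : rowFun hA (c • g) x = c • rowFun hA g x := by
  ext i; simp [rowFun_apply]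

/-- The function on `K` with given components. -/
noncomputable def ofRows (hA : IsLocalSpace A) (K : Set (Vec n)) (σ : Fin m → A univ) :
    rowsIn m (A K) :=
  ⟨K.indicator fun x => WithLp.toLp 2 fun i => (σ i : Vec n → G) x, fun i =>
    hA.mem_iff.2 ⟨σ i, (σ i).2, by
      ext x
      by_cases hx : x ∈ K <;> simp [hx]⟩⟩

lemma ofRows_apply (hA : IsLocalSpace A) {K : Set (Vec n)} (σ : Fin m → A univ) {x : Vec n}
    (hx : x ∈ K) (i : Fin m) :
    (ofRows hA K σ : Vec n → PiLp 2 fun _ : Fin m => G) x i = (σ i : Vec n → G) x := by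
  simp [ofRows, hx]

lemma IsLocalSpace.eq_of_interior (hA : IsLocalSpace A) {K : Set (Vec n)}
    (hK : (interior K).Nonempty) {σ τ : A univ}
    (h : ∀ x ∈ interior K, (σ : Vec n → G) x = (τ : Vec n → G) x) : σ = τ := by
  rw [← sub_eq_zero]
  refine Subtype.ext (hA.eq_zero (σ - τ).2 isOpen_interior hK fun x hx => ?_)
  simp [h x hx]

lemma row_ofRows (hA : IsLocalSpace A) {K : Set (Vec n)} (hK : (interior K).Nonempty)
    (σ : Fin m → A univ) (i : Fin m) : row hA i (ofRows hA K σ) = σ i := by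
  refine hA.eq_of_interior hK fun x hx => ?_
  have hx' := interior_subset hx
  rw [← rowFun_apply, ← eq_rowFun hA _ hx', ofRows_apply hA σ hx']

lemma rowsIn_ext (hA : IsLocalSpace A) {K : Set (Vec n)} {g h : rowsIn m (A K)}
    (hgh : ∀ i, row hA i g = row hA i h) : g = h := by
  refine Subtype.ext (funext fun x => ?_)
  by_cases hx : x ∈ K
  · rw [eq_rowFun hA g hx, eq_rowFun hA h hx]
    ext i
    rw [rowFun_apply, rowFun_apply, hgh i]
  · rw [eq_zero_of_notMem hA g hx, eq_zero_of_notMem hA h hx]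

lemma rowsIn_finite (hA : IsLocalSpace A) (K : Set (Vec n)) : Module.Finite ℝ (rowsIn m (A K)) := by
  have := hA.finite
  refine Module.Finite.of_injective (LinearMap.pi fun i : Fin m => row hA (K := K) i) ?_
  intro g h hgh
  exact rowsIn_ext hA fun i => congrFun hgh i

lemma integrableOn_cell' (T : Finset (Vec n)) {E : Type*} [NormedAddCommGroup E] {u : Vec n → E}
    (hu : Continuous u) : IntegrableOn u (cell T) :=
  hu.continuousOn.integrableOn_compact (isCompact_cell T)

lemma integrableOn_inner {T : Finset (Vec n)} {g σ : Vec n → G} (hg : IntegrableOn g (cell T))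
    (hσ : Continuous σ) : IntegrableOn (fun x => inner ℝ (g x) (σ x)) (cell T) := by
  obtain ⟨C, hC⟩ := (isCompact_cell T).exists_bound_of_continuousOn hσ.continuousOn
  refine Integrable.mono' (hg.norm.mul_const C)
    (hg.aestronglyMeasurable.inner (integrableOn_cell' T hσ).aestronglyMeasurable) ?_
  filter_upwards [ae_restrict_mem (measurableSet_cell T)] with x hx
  exact (norm_inner_le_norm _ _).trans (mul_le_mul_of_nonneg_left (hC x hx) (norm_nonneg _))

lemma eq_zero_of_integral_inner_self (hA : IsLocalSpace A) {T : Finset (Vec n)}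
    (hT : (interior (cell T)).Nonempty) {σ : A univ}
    (h : ∫ x in cell T, inner ℝ ((σ : Vec n → G) x) ((σ : Vec n → G) x) = 0) : σ = 0 := by
  have hc := hA.continuous σ.2
  have h1 := (setIntegral_eq_zero_iff_of_nonneg_ae
    (Filter.Eventually.of_forall fun x => real_inner_self_nonneg)
    (integrableOn_inner (integrableOn_cell' T hc) hc)).1 h
  have h2 : ∀ x ∈ interior (cell T), (σ : Vec n → G) x = (0 : A univ).1 x := by
    have := Measure.eqOn_open_of_ae_eq (μ := (volume : Measure (Vec n)))
      (f := fun x => inner ℝ ((σ : Vec n → G) x) ((σ : Vec n → G) x)) (g := fun _ => (0 : ℝ))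
      (ae_restrict_of_ae_restrict_of_subset interior_subset h1)
      isOpen_interior (hc.inner hc).continuousOn continuousOn_const
    intro x hx
    exact inner_self_eq_zero.1 (this hx)
  exact hA.eq_of_interior hT h2

/-- Riesz representation in a local space with respect to the `L²` scalar product. -/
lemma existsUnique_riesz (hA : IsLocalSpace A) {T : Finset (Vec n)}
    (hT : (interior (cell T)).Nonempty) (L : A univ →ₗ[ℝ] ℝ) :
    ∃! r : A univ, ∀ σ : A univ,
      ∫ x in cell T, inner ℝ ((r : Vec n → G) x) ((σ : Vec n → G) x) = L σ := by
  have := hA.finite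
  have hi : ∀ r σ : A univ, IntegrableOn
      (fun x => inner ℝ ((r : Vec n → G) x) ((σ : Vec n → G) x)) (cell T) := fun r σ =>
    integrableOn_inner (integrableOn_cell' T (hA.continuous r.2)) (hA.continuous σ.2)
  let B : A univ →ₗ[ℝ] A univ →ₗ[ℝ] ℝ := LinearMap.mk₂ ℝ
    (fun r σ => ∫ x in cell T, inner ℝ ((r : Vec n → G) x) ((σ : Vec n → G) x))
    (fun r r' σ => by
      rw [← integral_add (hi r σ) (hi r' σ)]
      simp [inner_add_left])
    (fun c r σ => by
      rw [smul_eq_mul, ← integral_const_mul]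
      simp [inner_smul_left])
    (fun r σ σ' => by
      rw [← integral_add (hi r σ) (hi r σ')]
      simp [inner_add_right])
    (fun c r σ => by
      rw [smul_eq_mul, ← integral_const_mul]
      simp [inner_smul_right])
  -- The form is definite by unique continuation, and an injective map into the dual space of the
  -- same finite dimension is onto.
  have hinj : Function.Injective B := by
    rw [injective_iff_map_eq_zero]
    intro r hr
    exact eq_zero_of_integral_inner_self hA hT (LinearMap.congr_fun hr r)
  have hsurj : Function.Surjective B :=
    (LinearMap.injective_iff_surjective_of_finrank_eq_finrank
      (Subspace.dual_finrank_eq (K := ℝ) (V := A univ)).symm).1 hinj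
  obtain ⟨r, hr⟩ := hsurj L
  refine ⟨r, fun σ => LinearMap.congr_fun hr σ, fun r' hr' => hinj ?_⟩
  rw [hr]
  exact LinearMap.ext hr'

variable {𝒯 : Finset (Finset (Vec n))}

/-- No continuity is required across sides, so the problem decouples into one Riesz representation
for each simplex and each component. -/
lemma existsUnique_assemble (hA : IsLocalSpace A) (h𝒯 : ∀ T ∈ 𝒯, (interior (cell T)).Nonempty)
    (L : 𝒯 → Fin m → A univ →ₗ[ℝ] ℝ) :
    ∃! q : (T : 𝒯) → rowsIn m (A (cell T.1)), ∀ T i, ∀ σ : A univ,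
      ∫ x in cell T.1, inner ℝ ((row hA i (q T) : Vec n → G) x) ((σ : Vec n → G) x) =
        L T i σ := by
  choose r hr hr' using fun (T : 𝒯) (i : Fin m) => existsUnique_riesz hA (h𝒯 T.1 T.2) (L T i)
  refine ⟨fun T => ofRows hA _ (r T), fun T i σ => ?_, fun q hq => ?_⟩
  · simp only [row_ofRows hA (h𝒯 T.1 T.2)]
    exact hr T i σ
  · funext T
    refine rowsIn_ext hA fun i => ?_
    rw [row_ofRows hA (h𝒯 T.1 T.2)]
    exact hr' T i _ (hq T i)

end LocalSpace

/-! ### Piecewise functions on a triangulation and their L² projections -/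

section Pw

variable {d m : ℕ} {Ω : Set (Vec (d + 1))} {𝒯 : Finset (Finset (Vec (d + 1)))}
  {G : Type*} [NormedAddCommGroup G] [InnerProductSpace ℝ G]
  {A : Set (Vec (d + 1)) → Submodule ℝ (Vec (d + 1) → G)}

lemma IsTriangulation.interior_nonempty (h : IsTriangulation Ω 𝒯) :
    ∀ T ∈ 𝒯, (interior (cell T)).Nonempty := fun _ hT => nonempty_interior_cell (h.isSimplex hT)

lemma glue_ae_rowFun (h : IsTriangulation Ω 𝒯) (hA : IsLocalSpace A)
    (q : (T : 𝒯) → rowsIn m (A (cell T.1))) (T : 𝒯) :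
    ∀ᵐ x ∂volume.restrict (cell T.1), glue q x = rowFun hA (q T) x := by
  filter_upwards [glue_ae h (S := fun T : 𝒯 => rowsIn m (A (cell T.1)))
    (fun T g hg x hx => eq_zero_of_notMem hA ⟨g, hg⟩ hx) q T,
    ae_restrict_mem (measurableSet_cell T.1)] with x h1 h2
  rw [h1, eq_rowFun hA _ h2]

lemma integral_glue (h : IsTriangulation Ω 𝒯) (hΩr : interior (closure Ω) = Ω)
    (hA : IsLocalSpace A) (q : (T : 𝒯) → rowsIn m (A (cell T.1)))
    {E : Type*} [NormedAddCommGroup E] [NormedSpace ℝ E]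
    (Φ : Vec (d + 1) → (PiLp 2 fun _ : Fin m => G) → E)
    (hΦ : ∀ T : 𝒯, IntegrableOn (fun x => Φ x (rowFun hA (q T) x)) (cell T.1)) :
    ∫ x in Ω, Φ x (glue q x) = ∑ T : 𝒯, ∫ x in cell T.1, Φ x (rowFun hA (q T) x) := by
  have hae : ∀ T : 𝒯, (fun x => Φ x (rowFun hA (q T) x)) =ᵐ[volume.restrict (cell T.1)]
      fun x => Φ x (glue q x) := fun T => by
    filter_upwards [glue_ae_rowFun h hA q T] with x hx
    rw [hx]
  rw [integral_eq_sum_cells h hΩr fun T => (hΦ T).congr (hae T)]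
  exact Finset.sum_congr rfl fun T _ => (integral_congr_ae (hae T)).symm

lemma integrableOn_glue (h : IsTriangulation Ω 𝒯) (hΩr : interior (closure Ω) = Ω)
    (hA : IsLocalSpace A) (q : (T : 𝒯) → rowsIn m (A (cell T.1)))
    {E : Type*} [NormedAddCommGroup E]
    (Φ : Vec (d + 1) → (PiLp 2 fun _ : Fin m => G) → E)
    (hΦ : ∀ T : 𝒯, IntegrableOn (fun x => Φ x (rowFun hA (q T) x)) (cell T.1)) :
    IntegrableOn (fun x => Φ x (glue q x)) Ω := by
  refine integrableOn_of_cells h hΩr fun T => (hΦ T).congr ?_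
  filter_upwards [glue_ae_rowFun h hA q T] with x hx
  rw [hx]

lemma glue_add {S : 𝒯 → Submodule ℝ (Vec (d + 1) → G)} (q q' : (T : 𝒯) → S T)
    (x : Vec (d + 1)) : glue (q + q') x = glue q x + glue q' x := by
  simp [glue, Finset.sum_add_distrib]

lemma glue_smul {S : 𝒯 → Submodule ℝ (Vec (d + 1) → G)} (c : ℝ) (q : (T : 𝒯) → S T)
    (x : Vec (d + 1)) : glue (c • q) x = c • glue q x := by
  simp [glue, Finset.smul_sum]

lemma integrableOn_component {T : Finset (Vec (d + 1))}
    {g : Vec (d + 1) → PiLp 2 fun _ : Fin m => G} (hg : IntegrableOn g (cell T)) (i : Fin m) :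
    IntegrableOn (fun x => g x i) (cell T) :=
  (PiLp.proj (𝕜 := ℝ) 2 (fun _ : Fin m => G) i).integrable_comp hg

open Classical in
/-- A piecewise function with one nonzero component on one simplex. -/
noncomputable def singlePw (hA : IsLocalSpace A) (T : 𝒯) (i : Fin m) (σ : A univ) :
    (T : 𝒯) → rowsIn m (A (cell T.1)) :=
  Pi.single T (ofRows hA _ (Pi.single i σ))

open Classical in
lemma row_singlePw (h : IsTriangulation Ω 𝒯) (hA : IsLocalSpace A) (T : 𝒯) (i : Fin m)
    (σ : A univ) (T' : 𝒯) (i' : Fin m) :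
    row hA i' (singlePw hA T i σ T') = if T' = T ∧ i' = i then σ else 0 := by
  by_cases hT : T' = T
  · subst hT
    rw [singlePw, Pi.single_eq_same, row_ofRows hA (h.interior_nonempty _ T'.2)]
    by_cases hi : i' = i
    · subst hi; simp
    · simp [hi]
  · rw [singlePw, Pi.single_eq_of_ne hT]
    simp [hT]

/-- Localisation of variational equations tested with piecewise functions. -/
lemma forall_sum_eq_zero_iff (h : IsTriangulation Ω 𝒯) (hA : IsLocalSpace A)
    (b : 𝒯 → Fin m → A univ → ℝ) (hb : ∀ T i, b T i 0 = 0) :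
    (∀ φ : (T : 𝒯) → rowsIn m (A (cell T.1)), ∑ T, ∑ i, b T i (row hA i (φ T)) = 0) ↔
      ∀ T i σ, b T i σ = 0 := by
  classical
  refine ⟨fun H T i σ => ?_, fun H φ => by simp [H]⟩
  have h1 := H (singlePw hA T i σ)
  simp only [row_singlePw h] at h1
  rw [Finset.sum_eq_single_of_mem T (Finset.mem_univ _),
    Finset.sum_eq_single_of_mem i (Finset.mem_univ _)] at h1
  · simpa using h1
  · intro i' _ hi'
    simp [hi', hb]
  · intro T' _ hT'
    simp [hT', hb]

lemma integral_inner_glue (h : IsTriangulation Ω 𝒯) (hΩr : interior (closure Ω) = Ω)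
    (hA : IsLocalSpace A) {g : Vec (d + 1) → PiLp 2 fun _ : Fin m => G}
    (hg : ∀ T : 𝒯, IntegrableOn g (cell T.1)) (φ : (T : 𝒯) → rowsIn m (A (cell T.1))) :
    ∫ x in Ω, inner ℝ (g x) (glue φ x) =
      ∑ T : 𝒯, ∑ i, ∫ x in cell T.1, inner ℝ (g x i) ((row hA i (φ T) : Vec (d + 1) → G) x) := by
  rw [integral_glue h hΩr hA φ (fun x y => inner ℝ (g x) y)
    fun T => integrableOn_inner (hg T) (rowFun_continuous hA _)]
  refine Finset.sum_congr rfl fun T _ => ?_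
  simp only [PiLp.inner_apply, rowFun_apply]
  exact integral_finsetSum _ fun i _ =>
    integrableOn_inner (integrableOn_component (hg T) i) (row_continuous hA i _)

/-- Test functions supported on one simplex with one nonzero component localise the equation.
Integrability of g suffices, because test functions are bounded. -/
lemma isL2Proj_iff (h : IsTriangulation Ω 𝒯) (hΩr : interior (closure Ω) = Ω)
    (hA : IsLocalSpace A) {g : Vec (d + 1) → PiLp 2 fun _ : Fin m => G}
    (hg : ∀ T : 𝒯, IntegrableOn g (cell T.1)) (q : (T : 𝒯) → rowsIn m (A (cell T.1))) :
    IsL2Proj (fun T : 𝒯 => rowsIn m (A (cell T.1))) Ω g q ↔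
      ∀ (T : 𝒯) (i : Fin m) (σ : A univ),
        ∫ x in cell T.1, inner ℝ ((row hA i (q T) : Vec (d + 1) → G) x)
          ((σ : Vec (d + 1) → G) x) =
        ∫ x in cell T.1, inner ℝ (g x i) ((σ : Vec (d + 1) → G) x) := by
  have hq : ∀ T : 𝒯, IntegrableOn (fun x => glue q x) (cell T.1) := fun T => by
    refine (integrableOn_cell' T.1 (rowFun_continuous hA (q T))).congr ?_
    filter_upwards [glue_ae_rowFun h hA q T] with x hx
    rw [hx]
  have key : ∀ φ : (T : 𝒯) → rowsIn m (A (cell T.1)),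
      ∫ x in Ω, inner ℝ (g x - glue q x) (glue φ x) = ∑ T : 𝒯, ∑ i,
        ((∫ x in cell T.1, inner ℝ (g x i) ((row hA i (φ T) : Vec (d + 1) → G) x)) -
          ∫ x in cell T.1, inner ℝ ((row hA i (q T) : Vec (d + 1) → G) x)
            ((row hA i (φ T) : Vec (d + 1) → G) x)) := by
    intro φ
    rw [integral_inner_glue h hΩr hA (g := fun x => g x - glue q x)
      fun T => (hg T).sub (hq T)]
    refine Finset.sum_congr rfl fun T _ => Finset.sum_congr rfl fun i _ => ?_
    rw [← integral_sub (integrableOn_inner (integrableOn_component (hg T) i)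
      (row_continuous hA i _)) (integrableOn_inner (integrableOn_cell' T.1
      (row_continuous hA i _)) (row_continuous hA i _))]
    refine integral_congr_ae ?_
    filter_upwards [glue_ae_rowFun h hA q T] with x hx
    rw [← inner_sub_left, PiLp.sub_apply, hx, rowFun_apply]
  unfold IsL2Proj
  have h1 : ∀ φ : (T : 𝒯) → rowsIn m (A (cell T.1)), (∫ x in Ω, inner ℝ (g x -
      glue (S := fun T : 𝒯 => rowsIn m (A (cell T.1))) q x)
      (glue (S := fun T : 𝒯 => rowsIn m (A (cell T.1))) φ x)) = _ := key
  simp only [h1]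
  rw [forall_sum_eq_zero_iff h hA (fun T i σ =>
    (∫ x in cell T.1, inner ℝ (g x i) ((σ : Vec (d + 1) → G) x)) -
      ∫ x in cell T.1, inner ℝ ((row hA i (q T) : Vec (d + 1) → G) x)
        ((σ : Vec (d + 1) → G) x)) (fun T i => by simp)]
  exact forall_congr' fun T => forall_congr' fun i => forall_congr' fun σ => by
    rw [sub_eq_zero, eq_comm]

lemma existsUnique_isL2Proj (h : IsTriangulation Ω 𝒯) (hΩr : interior (closure Ω) = Ω)
    (hA : IsLocalSpace A) {g : Vec (d + 1) → PiLp 2 fun _ : Fin m => G}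
    (hg : ∀ T : 𝒯, IntegrableOn g (cell T.1)) :
    ∃! q : (T : 𝒯) → rowsIn m (A (cell T.1)),
      IsL2Proj (fun T : 𝒯 => rowsIn m (A (cell T.1))) Ω g q := by
  have hi : ∀ (T : 𝒯) (i : Fin m) (σ : A univ),
      IntegrableOn (fun x => inner ℝ (g x i) ((σ : Vec (d + 1) → G) x)) (cell T.1) :=
    fun T i σ => integrableOn_inner (integrableOn_component (hg T) i) (hA.continuous σ.2)
  simp only [isL2Proj_iff h hΩr hA hg]
  exact existsUnique_assemble hA h.interior_nonempty fun T i =>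
    { toFun := fun σ => ∫ x in cell T.1, inner ℝ (g x i) ((σ : Vec (d + 1) → G) x)
      map_add' := fun σ τ => by
        rw [← integral_add (hi T i σ) (hi T i τ)]
        simp [inner_add_right]
      map_smul' := fun c σ => by
        rw [smul_eq_mul, RingHom.id_apply, ← integral_const_mul]
        simp [inner_smul_right] }

end Pw

end

section

/-! ### The discrete spaces as local spaces -/

lemma isLocalSpace_poly (n k : ℕ) : IsLocalSpace (poly (n := n) k) where
  mem_iff := mem_poly_iff
  continuous := poly_continuous
  eq_zero := fun hσ _ hU hne h0 => poly_eq_zero_of_open hσ hU hne h0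
  finite := poly_finite _

lemma mem_polyVec_iff {n m k : ℕ} {K : Set (Vec n)} {g : Vec n → Vec m} :
    g ∈ polyVec m k K ↔ ∃ σ ∈ polyVec m k univ, g = K.indicator σ := by
  constructor
  · intro hg
    choose u hu hgu using fun i => mem_poly_iff.1 (hg i)
    refine ⟨fun x => WithLp.toLp 2 fun i => u i x, fun i => hu i, ?_⟩
    ext x i
    have := congrFun (hgu i) x
    by_cases hx : x ∈ K <;> simpa [hx] using this
  · rintro ⟨σ, hσ, rfl⟩ i
    refine mem_poly_iff.2 ⟨fun x => σ x i, hσ i, ?_⟩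
    ext x
    by_cases hx : x ∈ K <;> simp [hx]

lemma mem_rowSpace_iff {n l : ℕ} {P : Pairing} {K : Set (Vec n)} {g : Vec n → Vec n} :
    g ∈ P.rowSpace l K ↔ ∃ σ ∈ P.rowSpace l univ, g = K.indicator σ := by
  cases P with
  | bdm => exact mem_polyVec_iff
  | rt =>
    constructor
    · rintro ⟨a, ha, b, hb, rfl⟩
      obtain ⟨a', ha', rfl⟩ := mem_polyVec_iff.1 ha
      obtain ⟨b', hb', rfl⟩ := mem_poly_iff.1 hb
      refine ⟨_, ⟨a', ha', b', hb', rfl⟩, ?_⟩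
      ext x i
      by_cases hx : x ∈ K <;> simp [hx]
    · rintro ⟨_, ⟨a, ha, b, hb, rfl⟩, rfl⟩
      refine ⟨_, mem_polyVec_iff.2 ⟨a, ha, rfl⟩, _, mem_poly_iff.2 ⟨b, hb, rfl⟩, ?_⟩
      ext x i
      by_cases hx : x ∈ K <;> simp [hx]

lemma isLocalSpace_rowSpace (n : ℕ) (P : Pairing) (l : ℕ) :
    IsLocalSpace (P.rowSpace (n := n) l) where
  mem_iff := mem_rowSpace_iff
  continuous := rowSpace_continuous
  eq_zero := fun {σ} hσ U hU hne h0 => by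
    ext x j
    have := poly_eq_zero_of_open (rowSpace_coord hσ j) hU hne fun x hx => by simp [h0 x hx]
    exact congrFun this x
  finite := by
    let φ : P.rowSpace (n := n) l univ →ₗ[ℝ] (Fin n → poly (n := n) (l + 1) univ) :=
      { toFun := fun σ j => ⟨fun x => (σ : Vec n → Vec n) x j, rowSpace_coord σ.2 j⟩
        map_add' := fun _ _ => rfl
        map_smul' := fun _ _ => rfl }
    refine Module.Finite.of_injective φ fun σ τ h => Subtype.ext ?_
    ext x j
    exact congrFun (congrArg Subtype.val (congrFun h j)) x

/-! ### Row-wise divergence -/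

/-- The divergence of a vector field. -/
noncomputable def rowDiv {n : ℕ} (σ : Vec n → Vec n) (x : Vec n) : ℝ :=
  ∑ j, fderiv ℝ (fun y => σ y j) x (EuclideanSpace.single j 1)

lemma rowSpace_contDiff {n l : ℕ} {P : Pairing} {σ : Vec n → Vec n} (hσ : σ ∈ P.rowSpace l univ)
    (j : Fin n) : ContDiff ℝ 1 fun x => σ x j := poly_contDiff (rowSpace_coord hσ j)

lemma rowSpace_differentiable {n l : ℕ} {P : Pairing} {σ : Vec n → Vec n}
    (hσ : σ ∈ P.rowSpace l univ) (j : Fin n) : Differentiable ℝ fun x => σ x j :=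
  (rowSpace_contDiff hσ j).differentiable one_ne_zero

lemma rowDiv_continuous {n l : ℕ} {P : Pairing} {σ : Vec n → Vec n}
    (hσ : σ ∈ P.rowSpace l univ) : Continuous (rowDiv σ) :=
  continuous_finsetSum _ fun j _ =>
    ((rowSpace_contDiff hσ j).continuous_fderiv one_ne_zero).clm_apply continuous_const

lemma rowDiv_add {n l : ℕ} {P : Pairing} {σ τ : Vec n → Vec n}
    (hσ : σ ∈ P.rowSpace l univ) (hτ : τ ∈ P.rowSpace l univ) (x : Vec n) :
    rowDiv (σ + τ) x = rowDiv σ x + rowDiv τ x := by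
  rw [rowDiv, rowDiv, rowDiv, ← Finset.sum_add_distrib]
  refine Finset.sum_congr rfl fun j _ => ?_
  have : (fun y => (σ + τ) y j) = (fun y => σ y j) + fun y => τ y j := rfl
  rw [this, fderiv_add (rowSpace_differentiable hσ j x) (rowSpace_differentiable hτ j x)]
  rfl

lemma rowDiv_smul {n l : ℕ} {P : Pairing} {σ : Vec n → Vec n}
    (hσ : σ ∈ P.rowSpace l univ) (c : ℝ) (x : Vec n) :
    rowDiv (c • σ) x = c * rowDiv σ x := by
  rw [rowDiv, rowDiv, Finset.mul_sum]
  refine Finset.sum_congr rfl fun j _ => ?_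
  have : (fun y => (c • σ) y j) = c • fun y => σ y j := rfl
  rw [this, fderiv_const_smul (rowSpace_differentiable hσ j x)]
  rfl

/-- The divergence of x b is n b + x·∇b, of the same degree as b; in the other case one degree is
lost from l + 1. The divergence thus lies in the space onto which f is projected, so the discrete
equilibrium holds pointwise. -/
lemma rowDiv_mem_poly {n l : ℕ} {P : Pairing} {σ : Vec n → Vec n}
    (hσ : σ ∈ P.rowSpace l univ) : rowDiv σ ∈ poly l univ := by
  cases P with
  | bdm => exact poly_sum _ fun j _ => poly_fderiv (hσ j) _
  | rt =>
    obtain ⟨a, ha, b, hb, rfl⟩ := hσ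
    have h1 : rowDiv (fun x => a x + b x • x) = fun x => ∑ j : Fin n,
        (fderiv ℝ (fun y => a y j) x (EuclideanSpace.single j 1) +
          (x j * fderiv ℝ b x (EuclideanSpace.single j 1) + b x)) := by
      ext x
      refine Finset.sum_congr rfl fun j _ => ?_
      have hproj : HasFDerivAt (fun y : Vec n => y j) (EuclideanSpace.proj j : Vec n →L[ℝ] ℝ) x :=
        (EuclideanSpace.proj j : Vec n →L[ℝ] ℝ).hasFDerivAt
      have h2 := ((poly_differentiable (ha j) x).hasFDerivAt.add
        ((poly_differentiable hb x).hasFDerivAt.mul hproj)).fderiv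
      have h3 : (fun y => (a y + b y • y) j) = fun y => a y j + b y * y j := by ext y; simp
      rw [h3]
      refine (DFunLike.congr_fun h2 _).trans ?_
      simp
      ring
    rw [h1]
    refine poly_sum _ fun j _ => (poly l univ).add_mem ?_ ((poly l univ).add_mem
      (poly_fderiv_mul hb (poly_coord j) _) hb)
    exact poly_fderiv (poly_mono (Nat.le_succ l) (ha j)) _

variable {d : ℕ} {T : Finset (Vec (d + 1))}

/-- Integration by parts on a simplex. -/
theorem integral_fderiv_add_rowDiv (hT : IsSimplex T) {P : Pairing} {l : ℕ}
    {σ : Vec (d + 1) → Vec (d + 1)} (hσ : σ ∈ P.rowSpace l univ) {v : Vec (d + 1) → ℝ}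
    (hv : ContDiff ℝ 1 v) :
    (∫ x in cell T, fderiv ℝ v x (σ x)) + ∫ x in cell T, v x * rowDiv σ x =
      ∑ a : T, ∫ x in cell (T.erase a.1),
        v x * inner ℝ (σ x) (outerNormal T (T.erase a.1)) ∂μHE[d] := by
  have hσc := rowSpace_continuous hσ
  have hfv := hv.continuous_fderiv one_ne_zero
  have hprod : ∀ j : Fin (d + 1), ContDiff ℝ 1 fun x => v x * σ x j := fun j =>
    hv.mul (rowSpace_contDiff hσ j)
  have h1 : ∀ x, fderiv ℝ v x (σ x) + v x * rowDiv σ x =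
      ∑ j, fderiv ℝ (fun y => v y * σ y j) x (EuclideanSpace.single j 1) := by
    intro x
    rw [fderiv_apply_eq_sum, rowDiv, Finset.mul_sum, ← Finset.sum_add_distrib]
    refine Finset.sum_congr rfl fun j _ => ?_
    have h2 := ((hv.differentiable one_ne_zero x).hasFDerivAt.mul
      (rowSpace_differentiable hσ j x).hasFDerivAt).fderiv
    have h3 : fderiv ℝ (fun y => v y * σ y j) x = _ := h2
    rw [h3]
    simp
    ring
  have h0 : IntegrableOn (fun x => v x * rowDiv σ x) (cell T) :=
    integrableOn_cell T (hv.continuous.mul (rowDiv_continuous hσ))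
  rw [← integral_add (integrableOn_cell T (hfv.clm_apply hσc)) h0]
  simp only [h1]
  rw [integral_finsetSum _ fun j _ => integrableOn_cell T
    (((hprod j).continuous_fderiv one_ne_zero).clm_apply continuous_const)]
  simp only [integral_fderiv_cell hT (hprod _)]
  rw [Finset.sum_comm]
  refine Finset.sum_congr rfl fun a _ => ?_
  simp only [← integral_mul_const]
  rw [← integral_finsetSum _ fun j _ => (integrableOn_side hT a (hprod j).continuous).mul_const _]
  refine integral_congr_ae (Filter.Eventually.of_forall fun x => ?_)
  simp only [PiLp.inner_apply, Finset.mul_sum]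
  refine Finset.sum_congr rfl fun j _ => ?_
  simp
  ring

/-! ### The gradient reconstruction -/

variable {m : ℕ} {P : Pairing} {l : ℕ} {Ω : Set (Vec (d + 1))}
  {𝒯 : Finset (Finset (Vec (d + 1)))}

/-- The components of a matrix-valued function on a simplex. -/
noncomputable abbrev mrow {K : Set (Vec (d + 1))} (τ : P.matSpace m l K) (i : Fin m) :
    P.rowSpace (n := d + 1) l univ :=
  row (isLocalSpace_rowSpace (d + 1) P l) i (K := K) τ

/-- The components of a vector-valued polynomial on a simplex. -/
noncomputable abbrev vrow {K : Set (Vec (d + 1))} (v : polyVec m l K) (i : Fin m) :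
    poly (n := d + 1) l univ :=
  row (isLocalSpace_poly (d + 1) l) i (K := K) v

open Classical in
/-- The components on the side `F` of a discrete function; they vanish on the boundary sides. -/
noncomputable def sideRow (v : Vh m P l Ω 𝒯) (F : Finset (Vec (d + 1))) (i : Fin m) :
    poly (n := d + 1) (P.k l) univ :=
  if hF : F ∈ interiorSides Ω 𝒯 then vrow (v.2 ⟨F, hF⟩) i else 0

lemma sideRow_of_mem (v : Vh m P l Ω 𝒯) {F : Finset (Vec (d + 1))} (hF : F ∈ interiorSides Ω 𝒯)
    (i : Fin m) : sideRow v F i = vrow (v.2 ⟨F, hF⟩) i := dif_pos hF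

lemma sideRow_of_notMem (v : Vh m P l Ω 𝒯) {F : Finset (Vec (d + 1))}
    (hF : F ∉ interiorSides Ω 𝒯) (i : Fin m) : sideRow v F i = 0 := dif_neg hF

lemma sideRow_add (v w : Vh m P l Ω 𝒯) (F : Finset (Vec (d + 1))) (i : Fin m) :
    sideRow (v + w) F i = sideRow v F i + sideRow w F i := by
  by_cases hF : F ∈ interiorSides Ω 𝒯
  · simp only [sideRow_of_mem _ hF]
    exact map_add (row (isLocalSpace_poly (d + 1) (P.k l)) i) (v.2 ⟨F, hF⟩) (w.2 ⟨F, hF⟩)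
  · simp only [sideRow_of_notMem _ hF, add_zero]

lemma sideRow_smul (c : ℝ) (v : Vh m P l Ω 𝒯) (F : Finset (Vec (d + 1))) (i : Fin m) :
    sideRow (c • v) F i = c • sideRow v F i := by
  by_cases hF : F ∈ interiorSides Ω 𝒯
  · simp only [sideRow_of_mem _ hF]
    exact map_smul (row (isLocalSpace_poly (d + 1) (P.k l)) i) c (v.2 ⟨F, hF⟩)
  · simp only [sideRow_of_notMem _ hF, smul_zero]

lemma matDiv_apply {K : Set (Vec (d + 1))} (τ : P.matSpace m l K) {x : Vec (d + 1)}
    (hx : x ∈ interior K) (i : Fin m) :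
    matDiv (τ : Vec (d + 1) → Mat m (d + 1)) x i = rowDiv (mrow τ i : Vec (d + 1) → Vec (d + 1)) x := by
  rw [rowDiv]
  change ∑ j, fderiv ℝ (fun y => (τ : Vec (d + 1) → Mat m (d + 1)) y i j) x
    (EuclideanSpace.single j 1) = _
  refine Finset.sum_congr rfl fun j _ => ?_
  have : (fun y => (τ : Vec (d + 1) → Mat m (d + 1)) y i j) =ᶠ[nhds x]
      fun y => (mrow τ i : Vec (d + 1) → Vec (d + 1)) y j := by
    filter_upwards [isOpen_interior.mem_nhds hx] with y hy
    have := eq_rowFun (isLocalSpace_rowSpace (d + 1) P l) (K := K) τ (interior_subset hy)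
    rw [this]
    rfl
  rw [this.fderiv_eq]

lemma divPw_ae (h : IsTriangulation Ω 𝒯) (τ : SigmaPw m P l 𝒯) (T : 𝒯) :
    ∀ᵐ x ∂volume.restrict (cell T.1), ∀ i, divPw τ x i =
      rowDiv (mrow (τ T) i : Vec (d + 1) → Vec (d + 1)) x := by
  filter_upwards [ae_notMem_cell h T, ae_mem_interior_cell T.1] with x hx hx' i
  rw [divPw, Finset.sum_eq_single_of_mem T (Finset.mem_univ _), indicator_of_mem hx',
    matDiv_apply _ hx']
  intro T' _ hne
  exact indicator_of_notMem (fun hh => hx T' hne (interior_subset hh)) _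

lemma integral_inner_divPw (h : IsTriangulation Ω 𝒯) (hΩr : interior (closure Ω) = Ω)
    {g : Vec (d + 1) → Vec m} (hg : ∀ T : 𝒯, IntegrableOn g (cell T.1)) (τ : SigmaPw m P l 𝒯) :
    ∫ x in Ω, inner ℝ (g x) (divPw τ x) =
      ∑ T : 𝒯, ∑ i, ∫ x in cell T.1, g x i *
        rowDiv (mrow (τ T) i : Vec (d + 1) → Vec (d + 1)) x := by
  have hae : ∀ T : 𝒯, (fun x => inner ℝ (g x) (divPw τ x)) =ᵐ[volume.restrict (cell T.1)]
      fun x => ∑ i, g x i * rowDiv (mrow (τ T) i : Vec (d + 1) → Vec (d + 1)) x := fun T => by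
    filter_upwards [divPw_ae h τ T] with x hx
    simp only [PiLp.inner_apply, hx]
    exact Finset.sum_congr rfl fun i _ => by simp [mul_comm]
  have hi : ∀ (T : 𝒯) (i : Fin m), IntegrableOn (fun x => g x i *
      rowDiv (mrow (τ T) i : Vec (d + 1) → Vec (d + 1)) x) (cell T.1) := fun T i => by
    refine (integrableOn_inner (integrableOn_component (hg T) i)
      (rowDiv_continuous (mrow (τ T) i).2)).congr (Filter.Eventually.of_forall fun x => ?_)
    simp [mul_comm]
  rw [integral_eq_sum_cells h hΩr fun T =>
    (integrable_finsetSum _ fun i _ => hi T i).congr (hae T).symm]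
  refine Finset.sum_congr rfl fun T _ => ?_
  rw [integral_congr_ae (hae T)]
  exact integral_finsetSum _ fun i _ => hi T i

open Classical in
lemma normalJump_apply (τ : SigmaPw m P l 𝒯) (F : Finset (Vec (d + 1))) {x : Vec (d + 1)}
    (hx : x ∈ cell F) (i : Fin m) : normalJump τ F x i = ∑ T : 𝒯, if F ⊆ T.1 then
      inner ℝ ((mrow (τ T) i : Vec (d + 1) → Vec (d + 1)) x) (outerNormal T.1 F) else 0 := by
  rw [normalJump, WithLp.ofLp_sum, Finset.sum_apply]
  refine Finset.sum_congr rfl fun T _ => ?_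
  split_ifs with hFT
  · simp only
    rw [eq_rowFun (isLocalSpace_rowSpace (d + 1) P l) (K := cell T.1) (τ T)
      (cell_side_subset hFT hx)]
    rfl
  · rfl

lemma integrableOn_of_mem_sides (h : IsTriangulation Ω 𝒯) {F : Finset (Vec (d + 1))}
    (hF : F ∈ sides 𝒯) {u : Vec (d + 1) → ℝ} (hu : Continuous u) :
    IntegrableOn u (cell F) μHE[d] := by
  have hc := sides_card hF
  simp only [sides, Finset.mem_biUnion, Finset.mem_powersetCard] at hF
  obtain ⟨T, hT, hFT, -⟩ := hF
  obtain ⟨a, rfl⟩ := eq_erase_of_subset (h.isSimplex hT) hc hFT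
  exact integrableOn_side (h.isSimplex hT) a hu

open Classical in
-- The jump is a sum over the simplices at F, so the skeleton term splits into contributions of
-- single simplices. Boundary sides may be added, because `sideRow` vanishes there.
lemma sum_integral_normalJump (h : IsTriangulation Ω 𝒯) (v : Vh m P l Ω 𝒯)
    (τ : SigmaPw m P l 𝒯) :
    ∑ F : interiorSides Ω 𝒯, (∫ x in cell F.1,
        inner ℝ ((v.2 F : Vec (d + 1) → Vec m) x) (normalJump τ F.1 x) ∂μHE[d]) =
      ∑ T : 𝒯, ∑ i, ∑ a : T.1, ∫ x in cell (T.1.erase a.1),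
        (sideRow v (T.1.erase a.1) i : Vec (d + 1) → ℝ) x *
          inner ℝ ((mrow (τ T) i : Vec (d + 1) → Vec (d + 1)) x)
            (outerNormal T.1 (T.1.erase a.1)) ∂μHE[d] := by
  have h1 : ∀ T : 𝒯, ∑ i, ∑ a : T.1, ∫ x in cell (T.1.erase a.1),
        (sideRow v (T.1.erase a.1) i : Vec (d + 1) → ℝ) x *
          inner ℝ ((mrow (τ T) i : Vec (d + 1) → Vec (d + 1)) x)
            (outerNormal T.1 (T.1.erase a.1)) ∂μHE[d] =
      ∑ a : T.1, ∑ i, ∫ x in cell (T.1.erase a.1),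
        (sideRow v (T.1.erase a.1) i : Vec (d + 1) → ℝ) x *
          inner ℝ ((mrow (τ T) i : Vec (d + 1) → Vec (d + 1)) x)
            (outerNormal T.1 (T.1.erase a.1)) ∂μHE[d] := fun T => Finset.sum_comm
  simp only [h1]
  rw [sum_simplices_sides h (fun T F => ∑ i, ∫ x in cell F,
        (sideRow v F i : Vec (d + 1) → ℝ) x *
          inner ℝ ((mrow (τ T) i : Vec (d + 1) → Vec (d + 1)) x) (outerNormal T.1 F) ∂μHE[d])]
  have hsub : interiorSides Ω 𝒯 ⊆ sides 𝒯 := fun F hF => (mem_interiorSides.1 hF).1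
  rw [← Finset.sum_subset hsub]
  · rw [← Finset.sum_coe_sort (interiorSides Ω 𝒯)]
    refine Finset.sum_congr rfl fun F _ => ?_
    have hint : ∀ (T : 𝒯) (i : Fin m), IntegrableOn (fun x => (sideRow v F.1 i : Vec (d + 1) → ℝ) x *
        inner ℝ ((mrow (τ T) i : Vec (d + 1) → Vec (d + 1)) x) (outerNormal T.1 F.1))
        (cell F.1) μHE[d] := fun T i => integrableOn_of_mem_sides h (hsub F.2)
      ((poly_continuous (sideRow v F.1 i).2).mul
        ((rowSpace_continuous (mrow (τ T) i).2).inner continuous_const))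
    have h2 : ∀ x ∈ cell F.1, inner ℝ ((v.2 F : Vec (d + 1) → Vec m) x) (normalJump τ F.1 x) =
        ∑ T : 𝒯, if F.1 ⊆ T.1 then ∑ i, (sideRow v F.1 i : Vec (d + 1) → ℝ) x *
        inner ℝ ((mrow (τ T) i : Vec (d + 1) → Vec (d + 1)) x) (outerNormal T.1 F.1) else 0 := by
      intro x hx
      rw [eq_rowFun (isLocalSpace_poly (d + 1) (P.k l)) (K := cell F.1) (v.2 F) hx]
      simp only [PiLp.inner_apply, normalJump_apply τ F.1 hx, rowFun_apply, sideRow_of_mem v F.2]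
      simp only [RCLike.inner_apply, conj_trivial, Finset.sum_mul]
      rw [Finset.sum_comm]
      refine Finset.sum_congr rfl fun T _ => ?_
      split_ifs
      · exact Finset.sum_congr rfl fun i _ => mul_comm _ _
      · simp
    rw [setIntegral_congr_fun (isCompact_cell F.1).isClosed.measurableSet h2, integral_finsetSum]
    · refine Finset.sum_congr rfl fun T _ => ?_
      split_ifs
      · exact integral_finsetSum _ fun i _ => hint T i
      · simp
    · intro T _
      split_ifs
      · exact integrable_finsetSum _ fun i _ => hint T i
      · exact integrable_zero _ _ _
  · intro F _ hF
    refine Finset.sum_eq_zero fun T _ => ?_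
    simp [sideRow_of_notMem v hF]

/-- The right-hand side of the local problem for the gradient reconstruction. -/
noncomputable def gradRhs (h : IsTriangulation Ω 𝒯) (v : Vh m P l Ω 𝒯) (T : 𝒯) (i : Fin m) :
    P.rowSpace (n := d + 1) l univ →ₗ[ℝ] ℝ where
  toFun σ := -(∫ x in cell T.1, (vrow (v.1 T) i : Vec (d + 1) → ℝ) x *
      rowDiv (σ : Vec (d + 1) → Vec (d + 1)) x) +
    ∑ a : T.1, ∫ x in cell (T.1.erase a.1), (sideRow v (T.1.erase a.1) i : Vec (d + 1) → ℝ) x *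
      inner ℝ ((σ : Vec (d + 1) → Vec (d + 1)) x) (outerNormal T.1 (T.1.erase a.1)) ∂μHE[d]
  map_add' σ τ := by
    have h1 : ∀ σ : P.rowSpace (n := d + 1) l univ, IntegrableOn (fun x =>
        (vrow (v.1 T) i : Vec (d + 1) → ℝ) x * rowDiv (σ : Vec (d + 1) → Vec (d + 1)) x)
        (cell T.1) := fun σ => integrableOn_cell T.1
      ((poly_continuous (vrow (v.1 T) i).2).mul (rowDiv_continuous σ.2))
    have h2 : ∀ (σ : P.rowSpace (n := d + 1) l univ) (a : T.1), IntegrableOn (fun x =>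
        (sideRow v (T.1.erase a.1) i : Vec (d + 1) → ℝ) x *
        inner ℝ ((σ : Vec (d + 1) → Vec (d + 1)) x) (outerNormal T.1 (T.1.erase a.1)))
        (cell (T.1.erase a.1)) μHE[d] := fun σ a => integrableOn_side (h.isSimplex T.2) a
      ((poly_continuous (sideRow v (T.1.erase a.1) i).2).mul
        ((rowSpace_continuous σ.2).inner continuous_const))
    simp only [Submodule.coe_add, rowDiv_add σ.2 τ.2, Pi.add_apply, inner_add_left, mul_add]
    rw [integral_add (h1 σ) (h1 τ),
      Finset.sum_congr rfl fun a _ => integral_add (h2 σ a) (h2 τ a), Finset.sum_add_distrib]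
    ring
  map_smul' c σ := by
    simp only [Submodule.coe_smul, rowDiv_smul σ.2, Pi.smul_apply, inner_smul_left, mul_left_comm _ c,
      integral_const_mul, conj_trivial, ← Finset.mul_sum, smul_eq_mul, RingHom.id_apply]
    ring

lemma vrow_continuous {K : Set (Vec (d + 1))} (v : polyVec m l K) (i : Fin m) :
    Continuous (vrow v i : Vec (d + 1) → ℝ) := poly_continuous (vrow v i).2

/-- The test functions are discontinuous, so the global equation is equivalent to one local problem
per simplex and row, which Riesz representation solves. -/
lemma isGradRec_iff (h : IsTriangulation Ω 𝒯) (hΩr : interior (closure Ω) = Ω)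
    (v : Vh m P l Ω 𝒯) (ρ : SigmaPw m P l 𝒯) :
    IsGradRec v ρ ↔ ∀ (T : 𝒯) (i : Fin m) (σ : P.rowSpace (n := d + 1) l univ),
      ∫ x in cell T.1, inner ℝ ((mrow (ρ T) i : Vec (d + 1) → Vec (d + 1)) x)
        ((σ : Vec (d + 1) → Vec (d + 1)) x) = gradRhs h v T i σ := by
  have hR := isLocalSpace_rowSpace (d + 1) P l
  have hp := isLocalSpace_poly (d + 1) l
  have hρ : ∀ T : 𝒯, IntegrableOn (fun x => glue ρ x) (cell T.1) := fun T => by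
    refine (integrableOn_cell' T.1 (rowFun_continuous hR (ρ T))).congr ?_
    filter_upwards [glue_ae_rowFun (m := m) h hR ρ T] with x hx
    exact hx.symm
  have hv : ∀ T : 𝒯, IntegrableOn (fun x => glue v.1 x) (cell T.1) := fun T => by
    refine (integrableOn_cell' T.1 (rowFun_continuous hp (v.1 T))).congr ?_
    filter_upwards [glue_ae_rowFun (m := m) h hp v.1 T] with x hx
    exact hx.symm
  have key : ∀ τ : SigmaPw m P l 𝒯, ((∫ x in Ω, inner ℝ (glue ρ x) (glue τ x)) =
      - (∫ x in Ω, inner ℝ (glue v.1 x) (divPw τ x))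
      + ∑ F : interiorSides Ω 𝒯, (∫ x in cell F.1,
        inner ℝ ((v.2 F : Vec (d + 1) → Vec m) x) (normalJump τ F.1 x) ∂μHE[d])) ↔
      ∑ T : 𝒯, ∑ i, ((∫ x in cell T.1, inner ℝ ((mrow (ρ T) i : Vec (d + 1) → Vec (d + 1)) x)
        ((mrow (τ T) i : Vec (d + 1) → Vec (d + 1)) x)) - gradRhs h v T i (mrow (τ T) i)) = 0 := by
    intro τ
    have h1 := integral_inner_glue (m := m) h hΩr hR hρ τ
    have h2 := integral_inner_divPw h hΩr hv τ
    have h1' : (∫ x in Ω, inner ℝ (glue ρ x) (glue τ x)) =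
        ∑ T : 𝒯, ∑ i, ∫ x in cell T.1, inner ℝ ((mrow (ρ T) i : Vec (d + 1) → Vec (d + 1)) x)
        ((mrow (τ T) i : Vec (d + 1) → Vec (d + 1)) x) := by
      refine h1.trans (Finset.sum_congr rfl fun T _ => Finset.sum_congr rfl fun i _ => ?_)
      refine integral_congr_ae ?_
      filter_upwards [glue_ae_rowFun (m := m) h hR ρ T] with x hx
      have hx' : glue ρ x = _ := hx
      rw [hx']
      rfl
    have h2' : ∫ x in Ω, inner ℝ (glue v.1 x) (divPw τ x) =
        ∑ T : 𝒯, ∑ i, ∫ x in cell T.1, (vrow (v.1 T) i : Vec (d + 1) → ℝ) x *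
        rowDiv (mrow (τ T) i : Vec (d + 1) → Vec (d + 1)) x := by
      refine h2.trans (Finset.sum_congr rfl fun T _ => Finset.sum_congr rfl fun i _ => ?_)
      refine integral_congr_ae ?_
      filter_upwards [glue_ae_rowFun (m := m) h hp v.1 T] with x hx
      have hx' : glue v.1 x = _ := hx
      rw [hx']
      rfl
    rw [h1', h2', sum_integral_normalJump h, ← sub_eq_zero, ← Finset.sum_neg_distrib,
      ← Finset.sum_add_distrib, ← Finset.sum_sub_distrib]
    simp only [← Finset.sum_neg_distrib, ← Finset.sum_add_distrib, ← Finset.sum_sub_distrib]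
    rfl
  have h3 := forall_sum_eq_zero_iff (m := m) h hR (fun T i σ => (∫ x in cell T.1,
    inner ℝ ((mrow (ρ T) i : Vec (d + 1) → Vec (d + 1)) x)
      ((σ : Vec (d + 1) → Vec (d + 1)) x)) - gradRhs h v T i σ) (fun T i => by simp)
  refine (forall_congr' key).trans (h3.trans ?_)
  simp only [sub_eq_zero]

theorem existsUnique_isGradRec (h : IsTriangulation Ω 𝒯) (hΩr : interior (closure Ω) = Ω)
    (v : Vh m P l Ω 𝒯) : ∃! ρ : SigmaPw m P l 𝒯, IsGradRec v ρ := by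
  simp only [isGradRec_iff h hΩr]
  exact existsUnique_assemble (isLocalSpace_rowSpace (d + 1) P l) h.interior_nonempty
    (gradRhs h v)

lemma isGradRec_R (h : IsTriangulation Ω 𝒯) (hΩr : interior (closure Ω) = Ω)
    (v : Vh m P l Ω 𝒯) : IsGradRec v (R v) :=
  Classical.epsilon_spec (existsUnique_isGradRec h hΩr v).exists

lemma integral_inner_R (h : IsTriangulation Ω 𝒯) (hΩr : interior (closure Ω) = Ω)
    (v : Vh m P l Ω 𝒯) (T : 𝒯) (i : Fin m) (σ : P.rowSpace (n := d + 1) l univ) :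
    ∫ x in cell T.1, inner ℝ ((mrow (R v T) i : Vec (d + 1) → Vec (d + 1)) x)
        ((σ : Vec (d + 1) → Vec (d + 1)) x) = gradRhs h v T i σ :=
  (isGradRec_iff h hΩr v _).1 (isGradRec_R h hΩr v) T i σ

lemma gradRhs_add (h : IsTriangulation Ω 𝒯) (v w : Vh m P l Ω 𝒯) (T : 𝒯) (i : Fin m)
    (σ : P.rowSpace (n := d + 1) l univ) :
    gradRhs h (v + w) T i σ = gradRhs h v T i σ + gradRhs h w T i σ := by
  have h1 : ∀ v : Vh m P l Ω 𝒯, IntegrableOn (fun x =>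
      (vrow (v.1 T) i : Vec (d + 1) → ℝ) x * rowDiv (σ : Vec (d + 1) → Vec (d + 1)) x)
      (cell T.1) := fun v => integrableOn_cell T.1
    ((poly_continuous (vrow (v.1 T) i).2).mul (rowDiv_continuous σ.2))
  have h2 : ∀ (v : Vh m P l Ω 𝒯) (a : T.1), IntegrableOn (fun x =>
      (sideRow v (T.1.erase a.1) i : Vec (d + 1) → ℝ) x *
      inner ℝ ((σ : Vec (d + 1) → Vec (d + 1)) x) (outerNormal T.1 (T.1.erase a.1)))
      (cell (T.1.erase a.1)) μHE[d] := fun v a => integrableOn_side (h.isSimplex T.2) a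
    ((poly_continuous (sideRow v (T.1.erase a.1) i).2).mul
      ((rowSpace_continuous σ.2).inner continuous_const))
  have h3 : vrow ((v + w).1 T) i = vrow (v.1 T) i + vrow (w.1 T) i :=
    map_add (row (isLocalSpace_poly (d + 1) l) i) (v.1 T) (w.1 T)
  simp only [gradRhs, LinearMap.coe_mk, AddHom.coe_mk, h3, sideRow_add, Submodule.coe_add,
    Pi.add_apply, add_mul]
  rw [integral_add (h1 v) (h1 w),
    Finset.sum_congr rfl fun a _ => integral_add (h2 v a) (h2 w a), Finset.sum_add_distrib]
  ring

lemma gradRhs_smul (h : IsTriangulation Ω 𝒯) (c : ℝ) (v : Vh m P l Ω 𝒯) (T : 𝒯) (i : Fin m)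
    (σ : P.rowSpace (n := d + 1) l univ) :
    gradRhs h (c • v) T i σ = c * gradRhs h v T i σ := by
  have h3 : vrow ((c • v).1 T) i = c • vrow (v.1 T) i :=
    map_smul (row (isLocalSpace_poly (d + 1) l) i) c (v.1 T)
  simp only [gradRhs, LinearMap.coe_mk, AddHom.coe_mk, h3, sideRow_smul, Submodule.coe_smul,
    Pi.smul_apply, smul_eq_mul, mul_assoc, integral_const_mul, ← Finset.mul_sum]
  ring

lemma R_add (h : IsTriangulation Ω 𝒯) (hΩr : interior (closure Ω) = Ω) (v w : Vh m P l Ω 𝒯) :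
    R (v + w) = R v + R w := by
  refine (existsUnique_isGradRec h hΩr (v + w)).unique (isGradRec_R h hΩr _) ?_
  rw [isGradRec_iff h hΩr]
  intro T i σ
  have h3 : mrow ((R v + R w) T) i = mrow (R v T) i + mrow (R w T) i :=
    map_add (row (isLocalSpace_rowSpace (d + 1) P l) i) (R v T) (R w T)
  rw [gradRhs_add, ← integral_inner_R h hΩr v T i σ, ← integral_inner_R h hΩr w T i σ, h3,
    ← integral_add]
  · simp [inner_add_left]
  · exact integrableOn_inner (integrableOn_cell' T.1 (rowSpace_continuous (mrow (R v T) i).2))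
      (rowSpace_continuous σ.2)
  · exact integrableOn_inner (integrableOn_cell' T.1 (rowSpace_continuous (mrow (R w T) i).2))
      (rowSpace_continuous σ.2)

lemma R_smul (h : IsTriangulation Ω 𝒯) (hΩr : interior (closure Ω) = Ω) (c : ℝ)
    (v : Vh m P l Ω 𝒯) : R (c • v) = c • R v := by
  refine (existsUnique_isGradRec h hΩr (c • v)).unique (isGradRec_R h hΩr _) ?_
  rw [isGradRec_iff h hΩr]
  intro T i σ
  have h3 : mrow ((c • R v) T) i = c • mrow (R v T) i :=
    map_smul (row (isLocalSpace_rowSpace (d + 1) P l) i) c (R v T)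
  rw [gradRhs_smul, ← integral_inner_R h hΩr v T i σ, h3, ← integral_const_mul]
  simp [inner_smul_left]

/-- Integration by parts of ∫ v div σ in the definition of R. The traces of v join the side values,
so that only ∇v and the differences v_F - v remain. -/
lemma localIdentity_R (h : IsTriangulation Ω 𝒯) (hΩr : interior (closure Ω) = Ω)
    (v : Vh m P l Ω 𝒯) (T : 𝒯) (i : Fin m) :
    LocalIdentity P l T.1 (mrow (R v T) i : Vec (d + 1) → Vec (d + 1))
      (vrow (v.1 T) i : Vec (d + 1) → ℝ)
      (fun a x => (sideRow v (T.1.erase a.1) i : Vec (d + 1) → ℝ) x -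
        (vrow (v.1 T) i : Vec (d + 1) → ℝ) x) := by
  intro σ hσ
  have hS := h.isSimplex T.2
  have h1 := integral_inner_R h hΩr v T i ⟨σ, hσ⟩
  have h2 := integral_fderiv_add_rowDiv hS hσ (poly_contDiff (vrow (v.1 T) i).2)
  simp only [gradRhs, LinearMap.coe_mk, AddHom.coe_mk] at h1
  have h3 : ∀ a : T.1, ∫ x in cell (T.1.erase a.1),
      ((sideRow v (T.1.erase a.1) i : Vec (d + 1) → ℝ) x -
        (vrow (v.1 T) i : Vec (d + 1) → ℝ) x) *
        inner ℝ (σ x) (outerNormal T.1 (T.1.erase a.1)) ∂μHE[d] =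
      (∫ x in cell (T.1.erase a.1), (sideRow v (T.1.erase a.1) i : Vec (d + 1) → ℝ) x *
        inner ℝ (σ x) (outerNormal T.1 (T.1.erase a.1)) ∂μHE[d]) -
      ∫ x in cell (T.1.erase a.1), (vrow (v.1 T) i : Vec (d + 1) → ℝ) x *
        inner ℝ (σ x) (outerNormal T.1 (T.1.erase a.1)) ∂μHE[d] := fun a => by
    rw [← integral_sub]
    · simp only [sub_mul]
    · exact integrableOn_side hS a ((poly_continuous (sideRow v (T.1.erase a.1) i).2).mul
        ((rowSpace_continuous hσ).inner continuous_const))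
    · exact integrableOn_side hS a ((poly_continuous (vrow (v.1 T) i).2).mul
        ((rowSpace_continuous hσ).inner continuous_const))
  rw [Finset.sum_congr rfl fun a _ => h3 a, Finset.sum_sub_distrib, ← h2, h1]
  ring

end

section

/-! ### The broken Poincaré inequality -/

variable {d : ℕ} {T : Finset (Vec (d + 1))}

lemma abs_rpow_sub_rpow_le {p A x y : ℝ} (hp : 1 ≤ p) (hx : x ∈ Icc 0 A) (hy : y ∈ Icc 0 A) :
    |x ^ p - y ^ p| ≤ p * A ^ (p - 1) * |x - y| := by
  refine Convex.norm_image_sub_le_of_norm_hasDerivWithin_le (f := fun t : ℝ => t ^ p)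
    (s := Icc 0 A) (fun t _ => (Real.hasDerivAt_rpow_const (Or.inr hp)).hasDerivWithinAt)
    (fun t ht => ?_) (convex_Icc 0 A) hy hx
  have h0 : 0 ≤ p := by linarith
  rw [Real.norm_of_nonneg (mul_nonneg h0 (Real.rpow_nonneg ht.1 _))]
  exact mul_le_mul_of_nonneg_left (Real.rpow_le_rpow ht.1 ht.2 (by linarith)) h0

/-- If r ≤ η a, the factor r is small compared with a; otherwise a ≤ r / η. The free parameter η
serves to absorb the term with a^p. -/
lemma add_rpow_mul_le {p η a r : ℝ} (hp : 1 ≤ p) (hη : 0 < η) (hη1 : η ≤ 1) (ha : 0 ≤ a)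
    (hr : 0 ≤ r) :
    (a + r) ^ (p - 1) * r ≤ 2 ^ (p - 1) * η * a ^ p + (1 + 1 / η) ^ (p - 1) * r ^ p := by
  have hp1 : 0 ≤ p - 1 := by linarith
  have hsplit : ∀ t : ℝ, 0 ≤ t → t ^ (p - 1) * t = t ^ p := by
    intro t ht
    rcases ht.eq_or_lt with rfl | ht
    · simp [Real.zero_rpow (by linarith : p ≠ 0)]
    · rw [← Real.rpow_add_one ht.ne']; ring_nf
  rcases le_total r (η * a) with h | h
  · have h1 : (a + r) ^ (p - 1) ≤ (2 * a) ^ (p - 1) :=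
      Real.rpow_le_rpow (by positivity) (by nlinarith) hp1
    have h2 : (a + r) ^ (p - 1) * r ≤ (2 * a) ^ (p - 1) * (η * a) :=
      mul_le_mul h1 h hr (by positivity)
    have h3 : (2 * a) ^ (p - 1) * (η * a) = 2 ^ (p - 1) * η * a ^ p := by
      rw [Real.mul_rpow (by norm_num) ha, ← hsplit a ha]; ring
    have h4 : 0 ≤ (1 + 1 / η) ^ (p - 1) * r ^ p := by positivity
    linarith
  · have h0 : a ≤ r / η := by rw [le_div_iff₀ hη]; linarith
    have h1 : (a + r) ^ (p - 1) ≤ ((1 + 1 / η) * r) ^ (p - 1) :=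
      Real.rpow_le_rpow (by positivity) (by
        have : (1 + 1 / η) * r = r + r / η := by ring
        linarith) hp1
    have h2 : (a + r) ^ (p - 1) * r ≤ ((1 + 1 / η) * r) ^ (p - 1) * r :=
      mul_le_mul_of_nonneg_right h1 hr
    have h3 : ((1 + 1 / η) * r) ^ (p - 1) * r = (1 + 1 / η) ^ (p - 1) * r ^ p := by
      rw [Real.mul_rpow (by positivity) hr, ← hsplit r hr]; ring
    have h4 : 0 ≤ 2 ^ (p - 1) * η * a ^ p := by positivity
    linarith

lemma norm_rpow_le_sum {n : ℕ} {p : ℝ} (hp : 1 ≤ p) (v : Vec n) :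
    ‖v‖ ^ p ≤ (n : ℝ) ^ (p - 1) * ∑ j, |v j| ^ p := by
  have h1 : ‖v‖ ≤ ∑ j, |v j| := by
    have h2 : v = ∑ j, v j • EuclideanSpace.single j (1 : ℝ) := by
      ext k
      simp [Finset.sum_apply, Pi.single_apply]
    calc ‖v‖ = ‖∑ j, v j • EuclideanSpace.single j (1 : ℝ)‖ := by rw [← h2]
      _ ≤ ∑ j, ‖v j • EuclideanSpace.single j (1 : ℝ)‖ := norm_sum_le _ _
      _ = ∑ j, |v j| := by simp [norm_smul]
  have h3 := Real.rpow_sum_le_const_mul_sum_rpow (s := Finset.univ) (f := fun j => v j) hp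
  rw [Finset.card_univ, Fintype.card_fin] at h3
  exact (Real.rpow_le_rpow (norm_nonneg _) h1 (by linarith)).trans h3

lemma continuous_norm_rpow {n : ℕ} {E : Type*} [NormedAddCommGroup E] {p : ℝ} (hp : 0 ≤ p)
    {u : Vec n → E} (hu : Continuous u) : Continuous fun x => ‖u x‖ ^ p :=
  hu.norm.rpow_const fun _ => Or.inr hp

lemma exists_cell_bound_rowSpace (d : ℕ) (P : Pairing) (l : ℕ) {p : ℝ} (hp : 1 ≤ p) :
    ∃ C : ℝ, 0 < C ∧ ∀ T : Finset (Vec (d + 1)), IsSimplex T → ∀ σ ∈ P.rowSpace l univ,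
      ∀ x ∈ cell T, jac T * ‖σ x‖ ^ p ≤ C * ∫ x in cell T, ‖σ x‖ ^ p := by
  obtain ⟨C, hC, h⟩ := exists_cell_bound d (l + 1) hp
  have hp0 : 0 ≤ p := by linarith
  refine ⟨((d + 1 : ℕ) : ℝ) ^ (p - 1) * ((d + 1 : ℕ) * C), by positivity, fun T hT σ hσ x hx => ?_⟩
  have h1 : ∀ j, jac T * |σ x j| ^ p ≤ C * ∫ x in cell T, ‖σ x‖ ^ p := fun j =>
    (h T hT _ (rowSpace_coord hσ j) x hx).trans (mul_le_mul_of_nonneg_left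
      (setIntegral_mono_on (integrableOn_cell T (continuous_norm_rpow hp0
        (poly_continuous (rowSpace_coord hσ j))))
        (integrableOn_cell T (continuous_norm_rpow hp0 (rowSpace_continuous hσ)))
        (measurableSet_cell T)
        fun y _ => Real.rpow_le_rpow (abs_nonneg _) (PiLp.norm_apply_le (σ y) j) hp0) hC.le)
  calc jac T * ‖σ x‖ ^ p
      ≤ jac T * (((d + 1 : ℕ) : ℝ) ^ (p - 1) * ∑ j, |σ x j| ^ p) :=
        mul_le_mul_of_nonneg_left (norm_rpow_le_sum hp _) (jac_pos hT).le
    _ = ((d + 1 : ℕ) : ℝ) ^ (p - 1) * ∑ j, jac T * |σ x j| ^ p := by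
        rw [← Finset.mul_sum]; ring
    _ ≤ ((d + 1 : ℕ) : ℝ) ^ (p - 1) * ∑ j : Fin (d + 1), C * ∫ x in cell T, ‖σ x‖ ^ p :=
        mul_le_mul_of_nonneg_left (Finset.sum_le_sum fun j _ => h1 j) (by positivity)
    _ = _ := by simp; ring

/-- In the direction of the normal, the inscribed ball has width 2ρ and the simplex has width
`height T a`. -/
lemma diam_le_height (hT : IsSimplex T) {γ : ℝ} (hγ : ∃ (c : Vec (d + 1)) (ρ : ℝ), 0 < ρ ∧
    Metric.closedBall c ρ ⊆ cell T ∧ Metric.diam (cell T) ≤ γ * ρ) (a : T) :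
    Metric.diam (cell T) ≤ |γ| * height T a := by
  obtain ⟨c, ρ, hρ, hball, hdiam⟩ := hγ
  have hν := norm_outerNormal hT a
  set ν := outerNormal T (T.erase a.1) with hνd
  have h1 : c + ρ • ν ∈ cell T := hball (by simp [norm_smul, hν, abs_of_pos hρ])
  have h2 : c - ρ • ν ∈ cell T := hball (by simp [norm_smul, hν, abs_of_pos hρ])
  have e1 := inner_sub_outerNormal hT a (c + ρ • ν)
  have e2 := inner_sub_outerNormal hT a (c - ρ • ν)
  have b1 := (mem_cell_iff hT).1 h1 a
  have b2 := bc_le_one hT h2 a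
  have hh := height_pos hT a
  have e3 : inner ℝ (c + ρ • ν - a.1) ν - inner ℝ (c - ρ • ν - a.1) ν = 2 * ρ := by
    rw [← inner_sub_left]
    have : c + ρ • ν - a.1 - (c - ρ • ν - a.1) = (2 * ρ) • ν := by rw [two_mul, add_smul]; abel
    rw [this, inner_smul_left, real_inner_self_eq_norm_sq, hν]
    simp
  rw [← hνd] at e1 e2
  rw [e1, e2] at e3
  have h3 : ρ ≤ height T a := by nlinarith
  calc Metric.diam (cell T) ≤ γ * ρ := hdiam
    _ ≤ |γ| * ρ := mul_le_mul_of_nonneg_right (le_abs_self γ) hρ.le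
    _ ≤ _ := mul_le_mul_of_nonneg_left h3 (abs_nonneg γ)

/-- Gauss' theorem for the field x_0 |V|^p e_0 produces the integral of |V|^p, since ∂_0 x_0 = 1.
The two errors come from the derivative of |V|^p and from the replacement of V by S on the sides;
both are estimated with |V|, |S| ≤ A. -/
lemma abs_integral_rpow_sub_le (hT : IsSimplex T) {p : ℝ} (hp : 1 < p) {V : Vec (d + 1) → ℝ}
    (hV : ContDiff ℝ 1 V) {S : T → Vec (d + 1) → ℝ} (hS : ∀ a, Continuous (S a))
    {D A g δ : ℝ} (hD : ∀ x ∈ cell T, |x 0| ≤ D) (hVA : ∀ x ∈ cell T, |V x| ≤ A)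
    (hSA : ∀ a : T, ∀ x ∈ cell (T.erase a.1), |S a x| ≤ A)
    (hg : ∀ x ∈ cell T, ‖fderiv ℝ V x‖ ≤ g)
    (hδ : ∀ a : T, ∀ x ∈ cell (T.erase a.1), |S a x - V x| ≤ δ) :
    |(∫ x in cell T, |V x| ^ p) - ∑ a : T,
      (∫ x in cell (T.erase a.1), x 0 * |S a x| ^ p ∂μHE[d]) *
        inner ℝ (outerNormal T (T.erase a.1)) (EuclideanSpace.single 0 1)| ≤
      D * (p * A ^ (p - 1) * g) * volume.real (cell T) +
        ∑ a : T, D * (p * A ^ (p - 1) * δ) *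
          (μHE[d] : Measure (Vec (d + 1))).real (cell (T.erase a.1)) := by
  obtain ⟨x₀, hx₀⟩ := (nonempty_interior_cell hT).mono interior_subset
  have hp0 : 0 ≤ p := by linarith
  have hD0 : 0 ≤ D := (abs_nonneg _).trans (hD x₀ hx₀)
  have hA0 : 0 ≤ A := (abs_nonneg _).trans (hVA x₀ hx₀)
  have hg0 : 0 ≤ g := (norm_nonneg _).trans (hg x₀ hx₀)
  set e : Vec (d + 1) := EuclideanSpace.single 0 1 with he
  have hVp : ContDiff ℝ 1 fun x => |V x| ^ p := hV.norm_rpow hp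
  have hcoord : ContDiff ℝ 1 fun x : Vec (d + 1) => x 0 :=
    (EuclideanSpace.proj (0 : Fin (d + 1)) : Vec (d + 1) →L[ℝ] ℝ).contDiff
  have hfd := hVp.continuous_fderiv one_ne_zero
  have h1 := integral_fderiv_cell hT (hcoord.mul hVp) e
  have h2 : ∀ x, fderiv ℝ (fun x : Vec (d + 1) => x 0 * |V x| ^ p) x e =
      |V x| ^ p + x 0 * fderiv ℝ (fun x => |V x| ^ p) x e := by
    intro x
    have h3 := (((EuclideanSpace.proj (0 : Fin (d + 1)) : Vec (d + 1) →L[ℝ] ℝ).hasFDerivAt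
      (x := x)).mul (hVp.differentiable one_ne_zero x).hasFDerivAt).fderiv
    refine (DFunLike.congr_fun h3 e).trans ?_
    simp [he]
    ring
  have h1' : ∫ x in cell T, (|V x| ^ p + x 0 * fderiv ℝ (fun x => |V x| ^ p) x e) = ∑ a : T,
      (∫ x in cell (T.erase a.1), x 0 * |V x| ^ p ∂μHE[d]) *
        inner ℝ (outerNormal T (T.erase a.1)) e := by
    simp only [← h2]
    exact h1
  have hint : IntegrableOn (fun x => x 0 * fderiv ℝ (fun x => |V x| ^ p) x e) (cell T) :=
    integrableOn_cell T (hcoord.continuous.mul (hfd.clm_apply continuous_const))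
  rw [integral_add (integrableOn_cell T hVp.continuous) hint] at h1'
  have hSp : ∀ a, Continuous fun x => |S a x| ^ p := fun a => continuous_norm_rpow hp0 (hS a)
  have h4 : ∀ a : T, (∫ x in cell (T.erase a.1), x 0 * |V x| ^ p ∂μHE[d]) =
      (∫ x in cell (T.erase a.1), x 0 * |S a x| ^ p ∂μHE[d]) +
        ∫ x in cell (T.erase a.1), x 0 * (|V x| ^ p - |S a x| ^ p) ∂μHE[d] := fun a => by
    rw [← integral_add]
    · congr 1
      ext x
      ring
    · exact integrableOn_side hT a (hcoord.continuous.mul (hSp a))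
    · exact integrableOn_side hT a (hcoord.continuous.mul (hVp.continuous.sub (hSp a)))
  simp only [h4, add_mul, Finset.sum_add_distrib] at h1'
  have h5 : |∫ x in cell T, x 0 * fderiv ℝ (fun x => |V x| ^ p) x e| ≤
      D * (p * A ^ (p - 1) * g) * volume.real (cell T) := by
    rw [← Real.norm_eq_abs]
    refine norm_setIntegral_le_of_norm_le_const (isCompact_cell T).measure_lt_top fun x hx => ?_
    rw [norm_mul]
    refine mul_le_mul (hD x hx) ?_ (norm_nonneg _) hD0
    have h6 : ‖fderiv ℝ (fun x => |V x| ^ p) x‖ ≤ p * |V x| ^ (p - 1) * ‖fderiv ℝ V x‖ :=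
      norm_fderiv_norm_rpow_le (hV.differentiable one_ne_zero) hp
    have h7 : ‖e‖ = 1 := by simp [he]
    calc ‖fderiv ℝ (fun x => |V x| ^ p) x e‖
        ≤ ‖fderiv ℝ (fun x => |V x| ^ p) x‖ * ‖e‖ := ContinuousLinearMap.le_opNorm _ _
      _ ≤ p * |V x| ^ (p - 1) * ‖fderiv ℝ V x‖ := by rw [h7, mul_one]; exact h6
      _ ≤ p * A ^ (p - 1) * g := mul_le_mul (mul_le_mul_of_nonneg_left
          (Real.rpow_le_rpow (abs_nonneg _) (hVA x hx) (by linarith)) hp0) (hg x hx)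
          (norm_nonneg _) (by positivity)
  have h8 : ∀ a : T, |(∫ x in cell (T.erase a.1), x 0 * (|V x| ^ p - |S a x| ^ p) ∂μHE[d]) *
      inner ℝ (outerNormal T (T.erase a.1)) e| ≤ D * (p * A ^ (p - 1) * δ) *
      (μHE[d] : Measure (Vec (d + 1))).real (cell (T.erase a.1)) := fun a => by
    have h9 : |inner ℝ (outerNormal T (T.erase a.1)) e| ≤ 1 := by
      refine (abs_real_inner_le_norm _ _).trans ?_
      rw [norm_outerNormal hT a]
      simp [he]
    rw [abs_mul]
    refine (mul_le_of_le_one_right (abs_nonneg _) h9).trans ?_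
    rw [← Real.norm_eq_abs]
    refine norm_setIntegral_le_of_norm_le_const (measure_side_lt_top hT a) fun x hx => ?_
    have hx' := cell_erase_subset T a.1 hx
    rw [norm_mul]
    refine mul_le_mul (hD x hx') ?_ (norm_nonneg _) hD0
    refine (abs_rpow_sub_rpow_le hp.le ⟨abs_nonneg _, hVA x hx'⟩ ⟨abs_nonneg _, hSA a x hx⟩).trans ?_
    refine mul_le_mul_of_nonneg_left ?_ (by positivity)
    refine (abs_abs_sub_abs_le_abs_sub _ _).trans ?_
    rw [abs_sub_comm]
    exact hδ a x hx
  have h10 : (∫ x in cell T, |V x| ^ p) - ∑ a : T,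
      (∫ x in cell (T.erase a.1), x 0 * |S a x| ^ p ∂μHE[d]) *
        inner ℝ (outerNormal T (T.erase a.1)) e =
      -(∫ x in cell T, x 0 * fderiv ℝ (fun x => |V x| ^ p) x e) +
        ∑ a : T, (∫ x in cell (T.erase a.1), x 0 * (|V x| ^ p - |S a x| ^ p) ∂μHE[d]) *
          inner ℝ (outerNormal T (T.erase a.1)) e := by
    linarith
  rw [h10]
  refine (abs_add_le _ _).trans (add_le_add (by rwa [abs_neg]) ?_)
  exact (Finset.abs_sum_le_sum_abs _ _).trans (Finset.sum_le_sum fun a _ => h8 a)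

variable {m : ℕ} {P : Pairing} {l : ℕ} {Ω : Set (Vec (d + 1))}
  {𝒯 : Finset (Finset (Vec (d + 1)))}

/-- On an interior side the weight x_0 |v_F|^p is common to all adjacent simplices and their outer
normals cancel. On a boundary side v_F = 0, and p ≠ 0 makes the power vanish. -/
lemma sum_integral_sideRow_eq_zero (h : IsTriangulation Ω 𝒯) (hΩo : IsOpen Ω)
    (hΩr : interior (closure Ω) = Ω) (v : Vh m P l Ω 𝒯) (i : Fin m) {p : ℝ} (hp : p ≠ 0)
    (e : Vec (d + 1)) :
    ∑ T : 𝒯, ∑ a : T.1, (∫ x in cell (T.1.erase a.1),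
      x 0 * |(sideRow v (T.1.erase a.1) i : Vec (d + 1) → ℝ) x| ^ p ∂μHE[d]) *
        inner ℝ (outerNormal T.1 (T.1.erase a.1)) e = 0 := by
  classical
  rw [sum_simplices_sides h (fun T F => (∫ x in cell F,
      x 0 * |(sideRow v F i : Vec (d + 1) → ℝ) x| ^ p ∂μHE[d]) * inner ℝ (outerNormal T.1 F) e)]
  refine Finset.sum_eq_zero fun F hF => ?_
  by_cases hFi : F ∈ interiorSides Ω 𝒯
  · have h1 := sum_outerNormal_eq_zero h hΩo hΩr hFi
    have h2 : ∑ T : 𝒯, (if F ⊆ T.1 then (∫ x in cell F,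
        x 0 * |(sideRow v F i : Vec (d + 1) → ℝ) x| ^ p ∂μHE[d]) * inner ℝ (outerNormal T.1 F) e
        else 0) = (∫ x in cell F, x 0 * |(sideRow v F i : Vec (d + 1) → ℝ) x| ^ p ∂μHE[d]) *
        inner ℝ (∑ T : 𝒯, (if F ⊆ T.1 then outerNormal T.1 F else 0)) e := by
      rw [sum_inner, Finset.mul_sum]
      refine Finset.sum_congr rfl fun T _ => ?_
      split_ifs <;> simp
    rw [h2]
    have h3 : (∑ T : 𝒯, (if F ⊆ T.1 then outerNormal T.1 F else 0)) = 0 := by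
      convert h1
    rw [h3]
    simp
  · simp [sideRow_of_notMem v hFi, Real.zero_rpow hp]

set_option maxHeartbeats 1000000 in
/-- Discrete Poincaré inequality: the simplex components are controlled by the gradient
reconstruction. -/
theorem exists_poincare (d : ℕ) (P : Pairing) (l : ℕ) (γ D : ℝ) (hD : 0 ≤ D) {p : ℝ} (hp : 1 < p) :
    ∃ C : ℝ, 0 < C ∧ ∀ (m : ℕ) (Ω : Set (Vec (d + 1))), IsOpen Ω → interior (closure Ω) = Ω →
      (Ω ⊆ Metric.closedBall 0 D) → ∀ 𝒯 : Finset (Finset (Vec (d + 1))), IsTriangulation Ω 𝒯 →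
      ShapeRegular γ 𝒯 → ∀ (v : Vh m P l Ω 𝒯) (i : Fin m),
      ∑ T : 𝒯, ∫ x in cell T.1, |(vrow (v.1 T) i : Vec (d + 1) → ℝ) x| ^ p ≤
        C * ∑ T : 𝒯, ∫ x in cell T.1, ‖(mrow (R v T) i : Vec (d + 1) → Vec (d + 1)) x‖ ^ p := by
  obtain ⟨C₁, hC₁, hloc⟩ := exists_local_bound d P l γ
  obtain ⟨C₂, hC₂, hcell⟩ := exists_cell_bound d l hp.le
  obtain ⟨C₃, hC₃, hrow⟩ := exists_cell_bound_rowSpace d P l hp.le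
  have hp0 : 0 ≤ p := by linarith
  set κ := (volume : Measure (Vec (d + 1))).real (refSimplex (d + 1)) with hκ
  set κ' := (volume : Measure (Vec d)).real (refSimplex d) with hκ'
  have hκ0 : 0 ≤ κ := measureReal_nonneg
  have hκ'0 : 0 ≤ κ' := measureReal_nonneg
  -- With a, r the maxima of |v| and |R v| on a simplex and δ the bound for |v_F - v|, this constant
  -- yields a + δ ≤ B (a + r), as diameters are at most 2D. The constant `K` then collects the
  -- volume error and the d + 2 side errors.
  set B := 1 + C₁ * (2 * D) with hB
  have hB1 : 1 ≤ B := by rw [hB]; nlinarith [mul_nonneg hC₁.le hD]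
  set K := 1 + D * (p * B ^ (p - 1) * C₁) * κ +
    (d + 2 : ℕ) * (D * (p * B ^ (p - 1) * C₁) * (|γ| * κ')) with hK
  have hK1 : 1 ≤ K := by
    have h1 : 0 ≤ D * (p * B ^ (p - 1) * C₁) * κ := by positivity
    have h2 : 0 ≤ (d + 2 : ℕ) * (D * (p * B ^ (p - 1) * C₁) * (|γ| * κ')) := by positivity
    linarith
  -- This choice leaves at most half of the integral of |v|^p on the right, which is absorbed and
  -- causes the factor 2 in the final constant.
  set η := min 1 (1 / (2 * (K * 2 ^ (p - 1) * C₂))) with hη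
  have hη0 : 0 < η := lt_min one_pos (by positivity)
  have hη1 : η ≤ 1 := min_le_left _ _
  have hη2 : K * 2 ^ (p - 1) * C₂ * η ≤ 1 / 2 := by
    have h1 : η ≤ 1 / (2 * (K * 2 ^ (p - 1) * C₂)) := min_le_right _ _
    have h2 : 0 < K * 2 ^ (p - 1) * C₂ := by positivity
    calc K * 2 ^ (p - 1) * C₂ * η ≤ K * 2 ^ (p - 1) * C₂ * (1 / (2 * (K * 2 ^ (p - 1) * C₂))) :=
          mul_le_mul_of_nonneg_left h1 h2.le
      _ = 1 / 2 := by field_simp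
  refine ⟨2 * (K * (1 + 1 / η) ^ (p - 1) * C₃), by positivity, ?_⟩
  intro m Ω hΩo hΩr hΩD 𝒯 h hγ v i
  have hclD : closure Ω ⊆ Metric.closedBall 0 D := closure_minimal hΩD Metric.isClosed_closedBall
  have hbound : ∀ T : 𝒯, (∫ x in cell T.1, |(vrow (v.1 T) i : Vec (d + 1) → ℝ) x| ^ p) -
      ∑ a : T.1, (∫ x in cell (T.1.erase a.1),
      x 0 * |(sideRow v (T.1.erase a.1) i : Vec (d + 1) → ℝ) x| ^ p ∂μHE[d]) *
        inner ℝ (outerNormal T.1 (T.1.erase a.1)) (EuclideanSpace.single 0 1) ≤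
      1 / 2 * (∫ x in cell T.1, |(vrow (v.1 T) i : Vec (d + 1) → ℝ) x| ^ p) +
      K * (1 + 1 / η) ^ (p - 1) * C₃ *
        ∫ x in cell T.1, ‖(mrow (R v T) i : Vec (d + 1) → Vec (d + 1)) x‖ ^ p := by
    intro T
    have hS := h.isSimplex T.2
    have hcD : ∀ x ∈ cell T.1, ‖x‖ ≤ D := fun x hx => by
      simpa using hclD (cell_subset_closure h T.2 hx)
    set V : Vec (d + 1) → ℝ := (vrow (v.1 T) i : Vec (d + 1) → ℝ) with hVdef
    have hVp : V ∈ poly l univ := (vrow (v.1 T) i).2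
    set ρ : Vec (d + 1) → Vec (d + 1) := (mrow (R v T) i : Vec (d + 1) → Vec (d + 1)) with hρdef
    have hρ : ρ ∈ P.rowSpace l univ := (mrow (R v T) i).2
    have hne : (cell T.1).Nonempty := (nonempty_interior_cell hS).mono interior_subset
    -- The estimates on T are made with the maxima a of |v| and r of |R v|. Inverse estimates
    -- convert these back to L^p integrals at the end.
    obtain ⟨xa, hxa, hxamax⟩ := (isCompact_cell T.1).exists_isMaxOn hne
      (poly_continuous hVp).abs.continuousOn
    obtain ⟨xr, hxr, hxrmax⟩ := (isCompact_cell T.1).exists_isMaxOn hne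
      (rowSpace_continuous hρ).norm.continuousOn
    set a := |V xa| with ha
    set r := ‖ρ xr‖ with hr
    have hVa : ∀ x ∈ cell T.1, |V x| ≤ a := fun x hx => hxamax hx
    have hρr : ∀ x ∈ cell T.1, ‖ρ x‖ ≤ r := fun x hx => hxrmax hx
    have ha0 : 0 ≤ a := abs_nonneg _
    have hr0 : 0 ≤ r := norm_nonneg _
    have hl := localIdentity_R h hΩr v T i
    obtain ⟨hgrad, hjump⟩ := hloc T.1 hS (hγ T.1 T.2) ρ hρ V hVp _ (fun b => by
      refine (poly (P.k l) univ).sub_mem (sideRow v (T.1.erase b.1) i).2 ?_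
      cases P with
      | rt => exact hVp
      | bdm => exact poly_mono (Nat.le_succ l) hVp) hl r hr0 hρr
    set hd := Metric.diam (cell T.1) with hhd
    have hd0 : 0 ≤ hd := Metric.diam_nonneg
    have hdD : hd ≤ 2 * D := by
      refine Metric.diam_le_of_forall_dist_le (by positivity) fun x hx y hy => ?_
      rw [dist_eq_norm]
      refine (norm_sub_le _ _).trans ?_
      linarith [hcD x hx, hcD y hy]
    set δ := C₁ * hd * r with hδ
    have hδ0 : 0 ≤ δ := by positivity
    have hjump' : ∀ b : T.1, ∀ x ∈ cell (T.1.erase b.1),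
        |(sideRow v (T.1.erase b.1) i : Vec (d + 1) → ℝ) x - V x| ≤ δ := hjump
    have hA : a + δ ≤ B * (a + r) := by
      have h1 : δ ≤ C₁ * (2 * D) * r := mul_le_mul_of_nonneg_right
        (mul_le_mul_of_nonneg_left hdD hC₁.le) hr0
      have h2 : 0 ≤ C₁ * (2 * D) * a := by positivity
      rw [hB]
      nlinarith
    have hA' : (a + δ) ^ (p - 1) ≤ B ^ (p - 1) * (a + r) ^ (p - 1) := by
      rw [← Real.mul_rpow (by positivity) (by positivity)]
      exact Real.rpow_le_rpow (by positivity) hA (by linarith)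
    have hmain := abs_integral_rpow_sub_le hS hp (V := V)
      (S := fun b => (sideRow v (T.1.erase b.1) i : Vec (d + 1) → ℝ)) (poly_contDiff hVp)
      (fun b => poly_continuous (sideRow v (T.1.erase b.1) i).2) (D := D) (A := a + δ)
      (g := C₁ * r) (δ := δ)
      (fun x hx => (PiLp.norm_apply_le x 0).trans (hcD x hx))
      (fun x hx => by linarith [hVa x hx])
      (fun b x hx => by
        have h1 := hVa x (cell_erase_subset T.1 b.1 hx)
        have h2 := hjump' b x hx
        have h3 := abs_sub_abs_le_abs_sub ((sideRow v (T.1.erase b.1) i : Vec (d + 1) → ℝ) x) (V x)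
        linarith)
      hgrad hjump'
    refine (le_abs_self _).trans (hmain.trans ?_)
    have hJ := jac_pos hS
    have hside : ∀ b : T.1, D * (p * (a + δ) ^ (p - 1) * δ) *
        (μHE[d] : Measure (Vec (d + 1))).real (cell (T.1.erase b.1)) ≤
        D * (p * B ^ (p - 1) * C₁) * (|γ| * κ') * (jac T.1 * ((a + r) ^ (p - 1) * r)) := by
      intro b
      set μF := (μHE[d] : Measure (Vec (d + 1))).real (cell (T.1.erase b.1)) with hμF
      have hμ0 : 0 ≤ μF := measureReal_nonneg
      -- The diameter in the bound of |v_F - v| compensates the measure of the side, which by itself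
      -- is not controlled by the volume of T.
      have h1 : hd * μF ≤ |γ| * (jac T.1 * κ') := by
        calc hd * μF ≤ |γ| * height T.1 b * μF :=
              mul_le_mul_of_nonneg_right (diam_le_height hS (hγ T.1 T.2) b) hμ0
          _ = |γ| * (height T.1 b * μF) := by ring
          _ = |γ| * (jac T.1 * κ') := by rw [hμF, measure_side_eq hS b]
      calc D * (p * (a + δ) ^ (p - 1) * δ) * μF
          = D * p * C₁ * r * (a + δ) ^ (p - 1) * (hd * μF) := by rw [hδ]; ring
        _ ≤ D * p * C₁ * r * (B ^ (p - 1) * (a + r) ^ (p - 1)) * (|γ| * (jac T.1 * κ')) :=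
            mul_le_mul (mul_le_mul_of_nonneg_left hA' (by positivity)) h1 (by positivity)
              (by positivity)
        _ = _ := by ring
    have hvol : D * (p * (a + δ) ^ (p - 1) * (C₁ * r)) * volume.real (cell T.1) ≤
        D * (p * B ^ (p - 1) * C₁) * κ * (jac T.1 * ((a + r) ^ (p - 1) * r)) := by
      rw [measure_cell_eq hS, ← hκ]
      calc D * (p * (a + δ) ^ (p - 1) * (C₁ * r)) * (jac T.1 * κ)
          = D * p * C₁ * r * (jac T.1 * κ) * (a + δ) ^ (p - 1) := by ring
        _ ≤ D * p * C₁ * r * (jac T.1 * κ) * (B ^ (p - 1) * (a + r) ^ (p - 1)) :=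
            mul_le_mul_of_nonneg_left hA' (by positivity)
        _ = _ := by ring
    have hX0 : 0 ≤ jac T.1 * ((a + r) ^ (p - 1) * r) := by positivity
    have hsum : D * (p * (a + δ) ^ (p - 1) * (C₁ * r)) * volume.real (cell T.1) +
        ∑ b : T.1, D * (p * (a + δ) ^ (p - 1) * δ) *
          (μHE[d] : Measure (Vec (d + 1))).real (cell (T.1.erase b.1)) ≤
        K * (jac T.1 * ((a + r) ^ (p - 1) * r)) := by
      have h1 := Finset.sum_le_sum fun (b : T.1) (_ : b ∈ Finset.univ) => hside b
      rw [Finset.sum_const, Finset.card_univ, Fintype.card_coe, hS.card_eq, nsmul_eq_mul] at h1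
      rw [hK]
      nlinarith
    refine hsum.trans ?_
    have hY := add_rpow_mul_le hp.le hη0 hη1 ha0 hr0
    have hVi := hcell T.1 hS V hVp xa hxa
    have hρi := hrow T.1 hS ρ hρ xr hxr
    have hI0 : 0 ≤ ∫ x in cell T.1, |V x| ^ p :=
      setIntegral_nonneg (measurableSet_cell _) fun x _ => by positivity
    calc K * (jac T.1 * ((a + r) ^ (p - 1) * r))
        ≤ K * (jac T.1 * (2 ^ (p - 1) * η * a ^ p + (1 + 1 / η) ^ (p - 1) * r ^ p)) :=
          mul_le_mul_of_nonneg_left (mul_le_mul_of_nonneg_left hY hJ.le) (by linarith)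
      _ = K * 2 ^ (p - 1) * η * (jac T.1 * a ^ p) +
          K * (1 + 1 / η) ^ (p - 1) * (jac T.1 * r ^ p) := by ring
      _ ≤ K * 2 ^ (p - 1) * η * (C₂ * ∫ x in cell T.1, |V x| ^ p) +
          K * (1 + 1 / η) ^ (p - 1) * (C₃ * ∫ x in cell T.1, ‖ρ x‖ ^ p) :=
          add_le_add (mul_le_mul_of_nonneg_left hVi (by positivity))
            (mul_le_mul_of_nonneg_left hρi (by positivity))
      _ = (K * 2 ^ (p - 1) * C₂ * η) * (∫ x in cell T.1, |V x| ^ p) +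
          K * (1 + 1 / η) ^ (p - 1) * C₃ * ∫ x in cell T.1, ‖ρ x‖ ^ p := by ring
      _ ≤ _ := add_le_add (mul_le_mul_of_nonneg_right hη2 hI0) le_rfl
  -- In the sum over all simplices the terms with v_F disappear.
  have htot := Finset.sum_le_sum fun (T : 𝒯) (_ : T ∈ Finset.univ) => hbound T
  rw [Finset.sum_sub_distrib, sum_integral_sideRow_eq_zero h hΩo hΩr v i (by linarith : p ≠ 0),
    Finset.sum_add_distrib, ← Finset.mul_sum, ← Finset.mul_sum] at htot
  linarith

end

section

/-! ### Energy densities -/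

section Density

variable {m n : ℕ} {W : Mat m n → ℝ} {p r s c₁ c₂ c₃ c₄ c₅ : ℝ}

lemma DW_continuous (hW : ContDiff ℝ 1 W) : Continuous (DW W) :=
  (InnerProductSpace.toDual ℝ (Mat m n)).symm.continuous.comp (hW.continuous_fderiv one_ne_zero)

lemma one_add_rpow_pos (A B : Mat m n) : 0 < 1 + ‖A‖ ^ s + ‖B‖ ^ s := by positivity

/-- Convexity control implies convexity. -/
lemma ConvexityControl.nonneg (h : ConvexityControl r s c₃ W) (hc₃ : 0 < c₃) (A B : Mat m n) :
    0 ≤ W B - W A - inner ℝ (DW W A) (B - A) := by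
  have h1 := h A B
  have h2 : 0 ≤ ‖DW W A - DW W B‖ ^ r := Real.rpow_nonneg (norm_nonneg _) _
  exact nonneg_of_mul_nonneg_right (h2.trans h1) (mul_pos hc₃ (one_add_rpow_pos A B))

lemma ConvexityControl.eq_of_eq_zero (h : ConvexityControl r s c₃ W) (hr : r ≠ 0) {A B : Mat m n}
    (h0 : W B - W A - inner ℝ (DW W A) (B - A) = 0) : DW W A = DW W B := by
  have h1 := h A B
  rw [h0, mul_zero] at h1
  have h2 := (Real.rpow_eq_zero (norm_nonneg _) hr).1
    (le_antisymm h1 (Real.rpow_nonneg (norm_nonneg _) _))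
  exact sub_eq_zero.1 (norm_eq_zero.1 h2)

/-- The derivative of a convex function of growth `p` grows with order `p - 1`. -/
lemma norm_DW_le (hp : 1 < p) (hc₁ : 0 < c₁) (hc₂ : 0 < c₂) (hc₄ : 0 ≤ c₄) (hc₅ : 0 ≤ c₅)
    (hc₃ : 0 < c₃) (hg : TwoSidedGrowth p c₁ c₂ c₄ c₅ W) (hc : ConvexityControl r s c₃ W)
    (A : Mat m n) : ‖DW W A‖ ≤ (c₂ * 2 ^ p + c₄ + c₅) * (1 + ‖A‖) ^ (p - 1) := by
  have hK : 0 ≤ c₂ * 2 ^ p + c₄ + c₅ := by positivity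
  set t := 1 + ‖A‖ with ht
  have ht1 : 1 ≤ t := by rw [ht]; linarith [norm_nonneg A]
  have ht0 : 0 < t := by linarith
  rcases eq_or_ne (DW W A) 0 with h0 | h0
  · rw [h0, norm_zero]; positivity
  have hn : 0 < ‖DW W A‖ := norm_pos_iff.2 h0
  -- A step of length t = 1 + |A| along the gradient: convexity bounds t |DW(A)| by W(A + H) - W(A),
  -- and |A + H| ≤ 2t.
  set H := (t * ‖DW W A‖⁻¹) • DW W A with hH
  have hHn : ‖H‖ = t := by
    rw [hH, norm_smul, norm_mul, norm_inv, norm_norm, Real.norm_of_nonneg ht0.le]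
    field_simp
  have h1 := hc.nonneg hc₃ A (A + H)
  rw [add_sub_cancel_left] at h1
  have h2 : inner ℝ (DW W A) H = t * ‖DW W A‖ := by
    rw [hH, inner_smul_right, real_inner_self_eq_norm_sq]
    field_simp
  have h3 := (hg A).1
  have h4 := (hg (A + H)).2
  have h5 : ‖A + H‖ ^ p ≤ (2 * t) ^ p := by
    refine Real.rpow_le_rpow (norm_nonneg _) ?_ (by linarith)
    refine (norm_add_le _ _).trans ?_
    rw [hHn, ht]
    linarith
  rw [Real.mul_rpow (by norm_num) ht0.le] at h5
  have h6 : 1 ≤ t ^ p := Real.one_le_rpow ht1 (by linarith)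
  have h7 : 0 ≤ c₁ * ‖A‖ ^ p := by positivity
  have h8 : t * ‖DW W A‖ ≤ (c₂ * 2 ^ p + c₄ + c₅) * t ^ p := by
    have h9 := mul_le_mul_of_nonneg_left h5 hc₂.le
    have h10 := mul_le_mul_of_nonneg_left h6 hc₄
    have h11 := mul_le_mul_of_nonneg_left h6 hc₅
    linarith
  have h12 : t ^ p = t * t ^ (p - 1) := by
    rw [mul_comm, ← Real.rpow_add_one ht0.ne']; ring_nf
  rw [h12] at h8
  refine le_of_mul_le_mul_left ?_ ht0
  linarith

/-- For X ≥ 1 the constant a is at most a X, and a factor X can be divided out. -/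
lemma le_of_rpow_le_affine {c a b X : ℝ} (hp : 1 < p) (hc : 0 < c) (ha : 0 ≤ a) (hb : 0 ≤ b)
    (hX : 0 ≤ X) (h : c * X ^ p ≤ a + b * X) : X ≤ max 1 (((a + b) / c) ^ (1 / (p - 1))) := by
  rcases le_total X 1 with h1 | h1
  · exact h1.trans (le_max_left _ _)
  · refine le_trans ?_ (le_max_right _ _)
    have hX0 : 0 < X := by linarith
    have h2 : X ^ p = X * X ^ (p - 1) := by
      rw [mul_comm, ← Real.rpow_add_one hX0.ne']; ring_nf
    have h3 : X ^ (p - 1) ≤ (a + b) / c := by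
      rw [le_div_iff₀ hc]
      refine le_of_mul_le_mul_left ?_ hX0
      rw [h2] at h
      nlinarith
    calc X = (X ^ (p - 1)) ^ (1 / (p - 1)) := by
          rw [← Real.rpow_mul hX0.le, mul_one_div_cancel (by linarith), Real.rpow_one]
      _ ≤ _ := Real.rpow_le_rpow (by positivity) h3 (by
          have : 0 < p - 1 := by linarith
          positivity)

end Density

/-! ### Integrals of piecewise functions -/

variable {d m : ℕ} {P : Pairing} {l : ℕ} {Ω : Set (Vec (d + 1))}
  {𝒯 : Finset (Finset (Vec (d + 1)))}

/-- The extension of a matrix-valued function on a simplex. -/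
noncomputable abbrev mfun {K : Set (Vec (d + 1))} (τ : P.matSpace m l K) :
    Vec (d + 1) → Mat m (d + 1) :=
  rowFun (isLocalSpace_rowSpace (d + 1) P l) (K := K) τ

/-- The extension of a vector-valued polynomial on a simplex. -/
noncomputable abbrev vfun {K : Set (Vec (d + 1))} (v : polyVec m l K) : Vec (d + 1) → Vec m :=
  rowFun (isLocalSpace_poly (d + 1) l) (K := K) v

lemma mfun_apply {K : Set (Vec (d + 1))} (τ : P.matSpace m l K) (x : Vec (d + 1)) (i : Fin m) :
    mfun τ x i = (mrow τ i : Vec (d + 1) → Vec (d + 1)) x := rfl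

lemma mfun_continuous {K : Set (Vec (d + 1))} (τ : P.matSpace m l K) : Continuous (mfun τ) :=
  rowFun_continuous (isLocalSpace_rowSpace (d + 1) P l) (K := K) τ

lemma vfun_continuous {K : Set (Vec (d + 1))} (v : polyVec m l K) : Continuous (vfun v) :=
  rowFun_continuous (isLocalSpace_poly (d + 1) l) (K := K) v

lemma glue_ae_mfun (h : IsTriangulation Ω 𝒯) (ρ : SigmaPw m P l 𝒯) (T : 𝒯) :
    ∀ᵐ x ∂volume.restrict (cell T.1), glue ρ x = mfun (ρ T) x :=
  glue_ae_rowFun (m := m) h (isLocalSpace_rowSpace (d + 1) P l) ρ T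

lemma glue_ae_vfun (h : IsTriangulation Ω 𝒯) (v : PolyPw m l 𝒯) (T : 𝒯) :
    ∀ᵐ x ∂volume.restrict (cell T.1), glue v x = vfun (v T) x :=
  glue_ae_rowFun (m := m) h (isLocalSpace_poly (d + 1) l) v T

lemma integrableOn_comp_glue₂ (h : IsTriangulation Ω 𝒯) (hΩr : interior (closure Ω) = Ω)
    {E : Type*} [NormedAddCommGroup E] {Φ : Mat m (d + 1) → Mat m (d + 1) → E}
    (hΦ : Continuous (Function.uncurry Φ)) (ρ τ : SigmaPw m P l 𝒯) :
    IntegrableOn (fun x => Φ (glue ρ x) (glue τ x)) Ω := by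
  refine integrableOn_of_cells h hΩr fun T => ?_
  have hc : Continuous fun x => Φ (mfun (ρ T) x) (mfun (τ T) x) :=
    hΦ.comp ((mfun_continuous (ρ T)).prodMk (mfun_continuous (τ T)))
  refine (integrableOn_cell' T.1 hc).congr ?_
  filter_upwards [glue_ae_mfun h ρ T, glue_ae_mfun h τ T] with x h1 h2
  rw [h1, h2]

lemma integral_comp_glue₂ (h : IsTriangulation Ω 𝒯) (hΩr : interior (closure Ω) = Ω)
    {E : Type*} [NormedAddCommGroup E] [NormedSpace ℝ E] {Φ : Mat m (d + 1) → Mat m (d + 1) → E}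
    (hΦ : Continuous (Function.uncurry Φ)) (ρ τ : SigmaPw m P l 𝒯) :
    ∫ x in Ω, Φ (glue ρ x) (glue τ x) =
      ∑ T : 𝒯, ∫ x in cell T.1, Φ (mfun (ρ T) x) (mfun (τ T) x) := by
  have hae : ∀ T : 𝒯, (fun x => Φ (mfun (ρ T) x) (mfun (τ T) x)) =ᵐ[volume.restrict (cell T.1)]
      fun x => Φ (glue ρ x) (glue τ x) := fun T => by
    filter_upwards [glue_ae_mfun h ρ T, glue_ae_mfun h τ T] with x h1 h2
    rw [h1, h2]
  have hc : ∀ T : 𝒯, Continuous fun x => Φ (mfun (ρ T) x) (mfun (τ T) x) := fun T =>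
    hΦ.comp ((mfun_continuous (ρ T)).prodMk (mfun_continuous (τ T)))
  rw [integral_eq_sum_cells h hΩr fun T => (integrableOn_cell' T.1 (hc T)).congr (hae T)]
  exact Finset.sum_congr rfl fun T _ => (integral_congr_ae (hae T)).symm

lemma integrableOn_comp_glue (h : IsTriangulation Ω 𝒯) (hΩr : interior (closure Ω) = Ω)
    {E : Type*} [NormedAddCommGroup E] {Φ : Mat m (d + 1) → E} (hΦ : Continuous Φ)
    (ρ : SigmaPw m P l 𝒯) : IntegrableOn (fun x => Φ (glue ρ x)) Ω :=
  integrableOn_comp_glue₂ h hΩr (Φ := fun A _ => Φ A) (hΦ.comp continuous_fst) ρ ρ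

lemma integral_comp_glue (h : IsTriangulation Ω 𝒯) (hΩr : interior (closure Ω) = Ω)
    {E : Type*} [NormedAddCommGroup E] [NormedSpace ℝ E] {Φ : Mat m (d + 1) → E}
    (hΦ : Continuous Φ) (ρ : SigmaPw m P l 𝒯) :
    ∫ x in Ω, Φ (glue ρ x) = ∑ T : 𝒯, ∫ x in cell T.1, Φ (mfun (ρ T) x) :=
  integral_comp_glue₂ h hΩr (Φ := fun A _ => Φ A) (hΦ.comp continuous_fst) ρ ρ

lemma memLp_of_integrable_rpow {α E : Type*} [MeasurableSpace α] {μ : Measure α}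
    [NormedAddCommGroup E] {g : α → E} {q : ℝ} (hq : 0 < q) (hg : Integrable g μ)
    (hi : Integrable (fun x => ‖g x‖ ^ q) μ) : MemLp g (ENNReal.ofReal q) μ := by
  refine (integrable_norm_rpow_iff hg.aestronglyMeasurable (by simpa using hq)
    ENNReal.ofReal_ne_top).1 ?_
  rwa [ENNReal.toReal_ofReal hq.le]

lemma eLpNorm_eq_ofReal {α E : Type*} [MeasurableSpace α] {μ : Measure α}
    [NormedAddCommGroup E] {g : α → E} {q : ℝ} (hq : 0 < q) (hg : MemLp g (ENNReal.ofReal q) μ) :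
    eLpNorm g (ENNReal.ofReal q) μ = ENNReal.ofReal ((∫ x, ‖g x‖ ^ q ∂μ) ^ q⁻¹) := by
  rw [hg.eLpNorm_eq_integral_rpow_norm (by simpa using hq) ENNReal.ofReal_ne_top,
    ENNReal.toReal_ofReal hq.le]

lemma memLp_glue (h : IsTriangulation Ω 𝒯) (hΩr : interior (closure Ω) = Ω) {q : ℝ} (hq : 0 < q)
    (ρ : SigmaPw m P l 𝒯) : MemLp (glue ρ) (ENNReal.ofReal q) (volume.restrict Ω) :=
  memLp_of_integrable_rpow hq (integrableOn_comp_glue h hΩr continuous_id ρ)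
    (integrableOn_comp_glue h hΩr (continuous_norm.rpow_const fun _ => Or.inr hq.le) ρ)

lemma integrableOn_comp_glue_poly (h : IsTriangulation Ω 𝒯) (hΩr : interior (closure Ω) = Ω)
    {E : Type*} [NormedAddCommGroup E] {Φ : Vec m → E} (hΦ : Continuous Φ)
    (v : PolyPw m l 𝒯) : IntegrableOn (fun x => Φ (glue v x)) Ω :=
  integrableOn_glue (m := m) h hΩr (isLocalSpace_poly (d + 1) l) v (fun _ y => Φ y)
    fun T => integrableOn_cell' T.1 (hΦ.comp (vfun_continuous (v T)))

lemma integral_comp_glue_poly (h : IsTriangulation Ω 𝒯) (hΩr : interior (closure Ω) = Ω)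
    {E : Type*} [NormedAddCommGroup E] [NormedSpace ℝ E] {Φ : Vec m → E} (hΦ : Continuous Φ)
    (v : PolyPw m l 𝒯) :
    ∫ x in Ω, Φ (glue v x) = ∑ T : 𝒯, ∫ x in cell T.1, Φ (vfun (v T) x) :=
  integral_glue (m := m) h hΩr (isLocalSpace_poly (d + 1) l) v (fun _ y => Φ y)
    fun T => integrableOn_cell' T.1 (hΦ.comp (vfun_continuous (v T)))

lemma memLp_glue_poly (h : IsTriangulation Ω 𝒯) (hΩr : interior (closure Ω) = Ω) {q : ℝ}
    (hq : 0 < q) (v : PolyPw m l 𝒯) : MemLp (glue v) (ENNReal.ofReal q) (volume.restrict Ω) :=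
  memLp_of_integrable_rpow hq (integrableOn_comp_glue_poly h hΩr continuous_id v)
    (integrableOn_comp_glue_poly h hΩr (continuous_norm.rpow_const fun _ => Or.inr hq.le) v)

lemma integrableOn_cell_of_integrableOn (h : IsTriangulation Ω 𝒯)
    (hΩr : interior (closure Ω) = Ω) {E : Type*} [NormedAddCommGroup E] {f : Vec (d + 1) → E}
    (hf : IntegrableOn f Ω) (T : 𝒯) : IntegrableOn f (cell T.1) := by
  rw [IntegrableOn, restrict_eq_sum h hΩr] at hf
  exact hf.mono_measure (Measure.le_sum _ T)

lemma integrableOn_of_memLp (hΩb : Bornology.IsBounded Ω) {E : Type*} [NormedAddCommGroup E]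
    {f : Vec (d + 1) → E} {q : ℝ} (hq : 1 ≤ q)
    (hf : MemLp f (ENNReal.ofReal q) (volume.restrict Ω)) : IntegrableOn f Ω := by
  have : IsFiniteMeasure ((volume : Measure (Vec (d + 1))).restrict Ω) :=
    ⟨by rw [Measure.restrict_apply_univ]; exact hΩb.measure_lt_top⟩
  exact hf.integrable (by rw [← ENNReal.ofReal_one]; exact ENNReal.ofReal_le_ofReal hq)

lemma integrableOn_inner_glue (h : IsTriangulation Ω 𝒯) (hΩr : interior (closure Ω) = Ω)
    {f : Vec (d + 1) → Vec m} (hf : IntegrableOn f Ω) (v : PolyPw m l 𝒯) :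
    IntegrableOn (fun x => inner ℝ (f x) (glue v x)) Ω :=
  integrableOn_glue (m := m) h hΩr (isLocalSpace_poly (d + 1) l) v (fun x y => inner ℝ (f x) y)
    fun T => integrableOn_inner (integrableOn_cell_of_integrableOn h hΩr hf T)
      (vfun_continuous (v T))

/-- The gradient reconstruction as a linear map. -/
noncomputable def Rlin (h : IsTriangulation Ω 𝒯) (hΩr : interior (closure Ω) = Ω) :
    Vh m P l Ω 𝒯 →ₗ[ℝ] SigmaPw m P l 𝒯 where
  toFun := R
  map_add' := R_add h hΩr
  map_smul' := R_smul h hΩr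

/-- The load functional. -/
noncomputable def load (h : IsTriangulation Ω 𝒯) (hΩr : interior (closure Ω) = Ω)
    {f : Vec (d + 1) → Vec m} (hf : IntegrableOn f Ω) : PolyPw m l 𝒯 →ₗ[ℝ] ℝ where
  toFun v := ∫ x in Ω, inner ℝ (f x) (glue v x)
  map_add' v w := by
    rw [← integral_add (integrableOn_inner_glue h hΩr hf v) (integrableOn_inner_glue h hΩr hf w)]
    simp only [← inner_add_right]
    congr 1
    ext x
    congr 1
    exact glue_add v w x
  map_smul' c v := by
    rw [smul_eq_mul, RingHom.id_apply, ← integral_const_mul]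
    congr 1
    ext x
    have : glue (c • v) x = c • glue v x := glue_smul c v x
    rw [this, inner_smul_right]

/-! ### Bounds for the load functional and the energy -/

lemma norm_rpow_le_sum_row {G : Type*} [NormedAddCommGroup G] [InnerProductSpace ℝ G] {p : ℝ}
    (hp : 1 ≤ p) (v : PiLp 2 fun _ : Fin m => G) :
    ‖v‖ ^ p ≤ (m : ℝ) ^ (p - 1) * ∑ i, ‖v i‖ ^ p := by
  have h1 := norm_rpow_le_sum hp (WithLp.toLp 2 fun i => ‖v i‖ : Vec m)
  have h2 : ‖(WithLp.toLp 2 fun i => ‖v i‖ : Vec m)‖ = ‖v‖ := by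
    simp [PiLp.norm_eq_of_L2]
  simpa [h2] using h1

lemma norm_row_rpow_le {G : Type*} [NormedAddCommGroup G] [InnerProductSpace ℝ G] {p : ℝ}
    (hp : 0 ≤ p) (v : PiLp 2 fun _ : Fin m => G) (i : Fin m) : ‖v i‖ ^ p ≤ ‖v‖ ^ p :=
  Real.rpow_le_rpow (norm_nonneg _) (PiLp.norm_apply_le v i) hp

theorem exists_poincare_norm (d m : ℕ) (P : Pairing) (l : ℕ) (γ D : ℝ) (hD : 0 ≤ D) {p : ℝ}
    (hp : 1 < p) :
    ∃ C : ℝ, 0 < C ∧ ∀ (Ω : Set (Vec (d + 1))), IsOpen Ω → interior (closure Ω) = Ω →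
      (Ω ⊆ Metric.closedBall 0 D) → ∀ 𝒯 : Finset (Finset (Vec (d + 1))), IsTriangulation Ω 𝒯 →
      ShapeRegular γ 𝒯 → ∀ v : Vh m P l Ω 𝒯,
      ∫ x in Ω, ‖glue v.1 x‖ ^ p ≤ C * ∫ x in Ω, ‖glue (R v) x‖ ^ p := by
  obtain ⟨C, hC, H⟩ := exists_poincare d P l γ D hD hp
  have hp0 : 0 ≤ p := by linarith
  refine ⟨(m : ℝ) ^ (p - 1) * (m * C) + 1, by positivity, fun Ω hΩo hΩr hΩD 𝒯 h hγ v => ?_⟩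
  have hcont : ∀ {E : Type} [NormedAddCommGroup E], Continuous fun y : E => ‖y‖ ^ p :=
    fun {E} _ => continuous_norm.rpow_const fun _ => Or.inr hp0
  rw [integral_comp_glue_poly h hΩr hcont, integral_comp_glue h hΩr hcont]
  set I := ∑ T : 𝒯, ∫ x in cell T.1, ‖mfun (R v T) x‖ ^ p with hI
  have hI0 : 0 ≤ I := Finset.sum_nonneg fun T _ =>
    setIntegral_nonneg (measurableSet_cell _) fun x _ => by positivity
  have h1 : ∀ i, ∑ T : 𝒯, ∫ x in cell T.1, |(vrow (v.1 T) i : Vec (d + 1) → ℝ) x| ^ p ≤ C * I :=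
    fun i => (H m Ω hΩo hΩr hΩD 𝒯 h hγ v i).trans (mul_le_mul_of_nonneg_left
      (Finset.sum_le_sum fun T _ => setIntegral_mono_on
        (integrableOn_cell T.1 (continuous_norm_rpow hp0 (rowSpace_continuous (mrow (R v T) i).2)))
        (integrableOn_cell T.1 (continuous_norm_rpow hp0 (mfun_continuous _)))
        (measurableSet_cell _) fun x _ => norm_row_rpow_le hp0 (mfun (R v T) x) i) hC.le)
  have h2 : ∀ T : 𝒯, ∫ x in cell T.1, ‖vfun (v.1 T) x‖ ^ p ≤ (m : ℝ) ^ (p - 1) *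
      ∑ i, ∫ x in cell T.1, |(vrow (v.1 T) i : Vec (d + 1) → ℝ) x| ^ p := fun T => by
    have hi : ∀ i, IntegrableOn (fun x => |(vrow (v.1 T) i : Vec (d + 1) → ℝ) x| ^ p) (cell T.1) :=
      fun i => integrableOn_cell T.1 (continuous_norm_rpow hp0 (vrow_continuous _ i))
    rw [← integral_finsetSum _ fun i _ => hi i, ← integral_const_mul]
    exact setIntegral_mono_on
      (integrableOn_cell T.1 (continuous_norm_rpow hp0 (vfun_continuous _)))
      ((integrable_finsetSum _ fun i _ => hi i).const_mul _) (measurableSet_cell _)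
      fun x _ => norm_rpow_le_sum_row hp.le (vfun (v.1 T) x)
  calc ∑ T : 𝒯, ∫ x in cell T.1, ‖vfun (v.1 T) x‖ ^ p
      ≤ ∑ T : 𝒯, (m : ℝ) ^ (p - 1) *
        ∑ i, ∫ x in cell T.1, |(vrow (v.1 T) i : Vec (d + 1) → ℝ) x| ^ p :=
        Finset.sum_le_sum fun T _ => h2 T
    _ = (m : ℝ) ^ (p - 1) *
        ∑ i, ∑ T : 𝒯, ∫ x in cell T.1, |(vrow (v.1 T) i : Vec (d + 1) → ℝ) x| ^ p := by
        rw [← Finset.mul_sum, Finset.sum_comm]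
    _ ≤ (m : ℝ) ^ (p - 1) * ∑ i : Fin m, C * I :=
        mul_le_mul_of_nonneg_left (Finset.sum_le_sum fun i _ => h1 i) (by positivity)
    _ = (m : ℝ) ^ (p - 1) * (m * C) * I := by simp; ring
    _ ≤ _ := by nlinarith

end

section

/-! ### Existence of minimisers and the Euler-Lagrange equations -/

variable {d m : ℕ} {P : Pairing} {l : ℕ} {Ω : Set (Vec (d + 1))}
  {𝒯 : Finset (Finset (Vec (d + 1)))} {W : Mat m (d + 1) → ℝ} {f : Vec (d + 1) → Vec m}
  {p p' r s c₁ c₂ c₃ c₄ c₅ M C : ℝ}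

lemma abs_load_le (h : IsTriangulation Ω 𝒯) (hΩr : interior (closure Ω) = Ω)
    (hpp' : p'.HolderConjugate p) (hf : MemLp f (ENNReal.ofReal p') (volume.restrict Ω))
    (hM : eLpNorm f (ENNReal.ofReal p') (volume.restrict Ω) ≤ ENNReal.ofReal M)
    (v : PolyPw m l 𝒯) :
    |∫ x in Ω, inner ℝ (f x) (glue v x)| ≤ max M 0 * (∫ x in Ω, ‖glue v x‖ ^ p) ^ (1 / p) := by
  have h1 := integral_mul_norm_le_Lp_mul_Lq hpp' hf (memLp_glue_poly h hΩr hpp'.symm.pos v)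
  -- For negative M the bound `ENNReal.ofReal M` is zero, hence the maximum with 0.
  have h2 : (∫ x in Ω, ‖f x‖ ^ p') ^ (1 / p') ≤ max M 0 := by
    rw [eLpNorm_eq_ofReal hpp'.pos hf, ENNReal.ofReal_le_ofReal_iff'] at hM
    rw [one_div]
    exact hM.elim (fun h => h.trans (le_max_left _ _)) fun h => h.trans (le_max_right _ _)
  have h3 : |∫ x in Ω, inner ℝ (f x) (glue v x)| ≤ ∫ x in Ω, ‖f x‖ * ‖glue v x‖ := by
    refine norm_integral_le_of_norm_le ?_
      (Filter.Eventually.of_forall fun x => norm_inner_le_norm (𝕜 := ℝ) (f x) (glue v x))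
    have := hpp'.ennrealOfReal
    exact MemLp.integrable_mul (p := ENNReal.ofReal p') (q := ENNReal.ofReal p) hf.norm (memLp_glue_poly h hΩr hpp'.symm.pos v).norm
  refine h3.trans (h1.trans (mul_le_mul_of_nonneg_right h2 ?_))
  exact Real.rpow_nonneg (integral_nonneg fun x => by positivity) _

lemma discreteEnergy_zero_le (h : IsTriangulation Ω 𝒯) (hΩr : interior (closure Ω) = Ω)
    (hp : p ≠ 0) (hg : TwoSidedGrowth p c₁ c₂ c₄ c₅ W) :
    discreteEnergy W f (0 : Vh m P l Ω 𝒯) ≤ c₅ * volume.real Ω := by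
  have h1 : R (0 : Vh m P l Ω 𝒯) = 0 := map_zero (Rlin h hΩr)
  have h2 : ∀ x, glue (0 : SigmaPw m P l 𝒯) x = 0 := fun x => by simp [glue]
  have h3 : ∀ x, glue (0 : Vh m P l Ω 𝒯).1 x = 0 := fun x => by simp [glue]
  have h4 := (hg 0).2
  rw [norm_zero, Real.zero_rpow hp, mul_zero, zero_add] at h4
  simp only [discreteEnergy, h1, h2, h3, inner_zero_right, integral_zero, sub_zero,
    setIntegral_const, smul_eq_mul]
  rw [mul_comm]
  exact mul_le_mul_of_nonneg_right h4 measureReal_nonneg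

lemma isFiniteMeasure_restrict (hΩb : Bornology.IsBounded Ω) :
    IsFiniteMeasure ((volume : Measure (Vec (d + 1))).restrict Ω) :=
  ⟨by rw [Measure.restrict_apply_univ]; exact hΩb.measure_lt_top⟩

/-- Coercivity: the lower growth bound gives the term of order p, while Hölder's and the Poincaré
inequality bound the load by a term of order one in the norm of R v. -/
lemma norm_rpow_le_energy (h : IsTriangulation Ω 𝒯) (hΩr : interior (closure Ω) = Ω)
    (hΩb : Bornology.IsBounded Ω) (hpp' : p'.HolderConjugate p)
    (hg : TwoSidedGrowth p c₁ c₂ c₄ c₅ W) (hW : Continuous W)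
    (hf : MemLp f (ENNReal.ofReal p') (volume.restrict Ω))
    (hM : eLpNorm f (ENNReal.ofReal p') (volume.restrict Ω) ≤ ENNReal.ofReal M) (hC : 0 ≤ C)
    (hpoin : ∀ v : Vh m P l Ω 𝒯, ∫ x in Ω, ‖glue v.1 x‖ ^ p ≤ C * ∫ x in Ω, ‖glue (R v) x‖ ^ p)
    (v : Vh m P l Ω 𝒯) :
    c₁ * (∫ x in Ω, ‖glue (R v) x‖ ^ p) ≤ discreteEnergy W f v + c₄ * volume.real Ω +
      max M 0 * C ^ (1 / p) * (∫ x in Ω, ‖glue (R v) x‖ ^ p) ^ (1 / p) := by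
  have := isFiniteMeasure_restrict hΩb
  have hp0 : 0 < p := hpp'.symm.pos
  have hcont : Continuous fun A : Mat m (d + 1) => ‖A‖ ^ p :=
    continuous_norm.rpow_const fun _ => Or.inr hp0.le
  have h1 : c₁ * (∫ x in Ω, ‖glue (R v) x‖ ^ p) - c₄ * volume.real Ω ≤
      ∫ x in Ω, W (glue (R v) x) := by
    have h2 : c₁ * (∫ x in Ω, ‖glue (R v) x‖ ^ p) - c₄ * volume.real Ω =
        ∫ x in Ω, (c₁ * ‖glue (R v) x‖ ^ p - c₄) := by
      rw [integral_sub ((integrableOn_comp_glue h hΩr hcont (R v)).const_mul _)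
        (integrable_const _), integral_const_mul, setIntegral_const, smul_eq_mul, mul_comm c₄]
    rw [h2]
    exact integral_mono (((integrableOn_comp_glue h hΩr hcont (R v)).const_mul _).sub
      (integrable_const _)) (integrableOn_comp_glue h hΩr hW (R v)) fun x => (hg _).1
  have h3 := abs_load_le h hΩr hpp' hf hM v.1
  have hI0 : 0 ≤ ∫ x in Ω, ‖glue (R v) x‖ ^ p := integral_nonneg fun x => by positivity
  have h4 : (∫ x in Ω, ‖glue v.1 x‖ ^ p) ^ (1 / p) ≤
      C ^ (1 / p) * (∫ x in Ω, ‖glue (R v) x‖ ^ p) ^ (1 / p) := by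
    rw [← Real.mul_rpow hC hI0]
    exact Real.rpow_le_rpow (integral_nonneg fun x => by positivity) (hpoin v) (by positivity)
  have h5 : |∫ x in Ω, inner ℝ (f x) (glue v.1 x)| ≤
      max M 0 * C ^ (1 / p) * (∫ x in Ω, ‖glue (R v) x‖ ^ p) ^ (1 / p) := by
    rw [mul_assoc]
    exact h3.trans (mul_le_mul_of_nonneg_left h4 (le_max_right _ _))
  have h6 := le_abs_self (∫ x in Ω, inner ℝ (f x) (glue v.1 x))
  rw [discreteEnergy]
  linarith

/-- Bound for the reconstruction on sublevel sets of the energy. -/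
lemma integral_norm_rpow_le (h : IsTriangulation Ω 𝒯) (hΩr : interior (closure Ω) = Ω)
    (hΩb : Bornology.IsBounded Ω) (hp : 1 < p) (hpp' : p'.HolderConjugate p) (hc₁ : 0 < c₁)
    (hc₄ : 0 ≤ c₄) (hc₅ : 0 ≤ c₅)
    (hg : TwoSidedGrowth p c₁ c₂ c₄ c₅ W) (hW : Continuous W)
    (hf : MemLp f (ENNReal.ofReal p') (volume.restrict Ω))
    (hM : eLpNorm f (ENNReal.ofReal p') (volume.restrict Ω) ≤ ENNReal.ofReal M) (hC : 0 ≤ C)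
    (hpoin : ∀ v : Vh m P l Ω 𝒯, ∫ x in Ω, ‖glue v.1 x‖ ^ p ≤ C * ∫ x in Ω, ‖glue (R v) x‖ ^ p)
    {v : Vh m P l Ω 𝒯} (hv : discreteEnergy W f v ≤ discreteEnergy W f (0 : Vh m P l Ω 𝒯)) :
    (∫ x in Ω, ‖glue (R v) x‖ ^ p) ^ (1 / p) ≤
      max 1 ((((c₄ + c₅) * volume.real Ω + max M 0 * C ^ (1 / p)) / c₁) ^ (1 / (p - 1))) := by
  have hI0 : 0 ≤ ∫ x in Ω, ‖glue (R v) x‖ ^ p := integral_nonneg fun x => by positivity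
  refine le_of_rpow_le_affine hp hc₁ (by positivity) (mul_nonneg (le_max_right _ _)
    (by positivity)) (Real.rpow_nonneg hI0 _) ?_
  rw [← Real.rpow_mul hI0, one_div_mul_cancel (by linarith), Real.rpow_one]
  have h1 := norm_rpow_le_energy h hΩr hΩb hpp' hg hW hf hM hC hpoin v
  have h2 := discreteEnergy_zero_le (P := P) (l := l) (f := f) h hΩr (by linarith : p ≠ 0) hg
  linarith

instance matSpace_finite {K : Set (Vec (d + 1))} : Module.Finite ℝ (P.matSpace m l K) :=
  rowsIn_finite (m := m) (isLocalSpace_rowSpace (d + 1) P l) K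

/-- Joint continuity in parameter and point is the input for continuity of integrals that depend on
a parameter. -/
lemma continuous_mfun_linear {K : Set (Vec (d + 1))} {N : ℕ}
    (L : (Fin N → ℝ) →ₗ[ℝ] P.matSpace m l K) :
    Continuous fun z : (Fin N → ℝ) × Vec (d + 1) => mfun (L z.1) z.2 := by
  let ev (y : Vec (d + 1)) : P.matSpace m l K →ₗ[ℝ] Mat m (d + 1) :=
    { toFun := fun τ => mfun τ y
      map_add' := fun τ τ' =>
        rowFun_add (m := m) (isLocalSpace_rowSpace (d + 1) P l) (K := K) τ τ' y
      map_smul' := fun c τ =>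
        rowFun_smul (m := m) (isLocalSpace_rowSpace (d + 1) P l) (K := K) c τ y }
  have h1 : ∀ z : (Fin N → ℝ) × Vec (d + 1),
      mfun (L z.1) z.2 = ∑ j, z.1 j • mfun (L fun i => if j = i then 1 else 0) z.2 := by
    intro z
    have h2 := LinearMap.pi_apply_eq_sum_univ (ev z.2 ∘ₗ L) z.1
    exact h2
  simp only [h1]
  exact continuous_finsetSum _ fun j _ =>
    ((continuous_apply j).comp continuous_fst).smul ((mfun_continuous _).comp continuous_snd)

lemma eq_zero_of_integral_norm_glue (h : IsTriangulation Ω 𝒯) (hΩr : interior (closure Ω) = Ω)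
    {ρ : SigmaPw m P l 𝒯} (h0 : ∫ x in Ω, ‖glue ρ x‖ = 0) : ρ = 0 := by
  rw [integral_comp_glue h hΩr continuous_norm, Finset.sum_eq_zero_iff_of_nonneg fun T _ =>
    setIntegral_nonneg (measurableSet_cell _) fun x _ => norm_nonneg _] at h0
  funext T
  have h1 := (setIntegral_eq_zero_iff_of_nonneg_ae
    (Filter.Eventually.of_forall fun x => norm_nonneg _)
    (integrableOn_cell T.1 (mfun_continuous (ρ T)).norm)).1 (h0 T (Finset.mem_univ _))
  refine rowsIn_ext (m := m) (isLocalSpace_rowSpace (d + 1) P l) (K := cell T.1) fun i => ?_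
  have h2 : mrow (ρ T) i = 0 := by
    refine eq_zero_of_integral_inner_self (isLocalSpace_rowSpace (d + 1) P l)
      (h.interior_nonempty T.1 T.2) ?_
    rw [← integral_zero (Vec (d + 1)) ℝ (μ := volume.restrict (cell T.1))]
    refine integral_congr_ae ?_
    filter_upwards [h1] with x hx
    have hx' : mfun (ρ T) x = 0 := norm_eq_zero.1 hx
    rw [← mfun_apply, hx']
    simp
  exact h2.trans (map_zero (row (m := m) (isLocalSpace_rowSpace (d + 1) P l) i)).symm

/-- Coordinates on the range of a linear map, controlled by a norm. -/
lemma exists_coordinates {X Y : Type*} [AddCommGroup X] [Module ℝ X] [AddCommGroup Y] [Module ℝ Y]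
    [FiniteDimensional ℝ Y] (L : X →ₗ[ℝ] Y) (ν : Y → ℝ) (hν0 : ∀ y, 0 ≤ ν y)
    (hsmul : ∀ (c : ℝ) y, ν (c • y) = |c| * ν y) (hadd : ∀ y z, ν (y + z) ≤ ν y + ν z)
    (hdef : ∀ y, ν y = 0 → y = 0) :
    ∃ (N : ℕ) (Ψ : (Fin N → ℝ) →ₗ[ℝ] X) (K : ℝ), 0 ≤ K ∧ (∀ v, ∃ x, L (Ψ x) = L v) ∧
      ∀ x j, |x j| ≤ K * ν (L (Ψ x)) := by
  obtain ⟨sec, hsec⟩ := LinearMap.exists_rightInverse_of_surjective L.rangeRestrict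
    L.range_rangeRestrict
  set b := Module.finBasis ℝ (LinearMap.range L) with hb
  obtain ⟨K, hK0, hK⟩ := exists_repr_bound (V := LinearMap.range L) (fun y => ν y)
    (fun y => hν0 _) (fun c y => hsmul c _) (fun y z => hadd _ _)
    (fun y hy => Subtype.ext (hdef _ hy))
  have hL : ∀ y : LinearMap.range L, L (sec y) = y := fun y =>
    congrArg Subtype.val (LinearMap.congr_fun hsec y)
  refine ⟨_, sec ∘ₗ b.equivFun.symm.toLinearMap, K, hK0, fun v => ?_,
    fun x j => ?_⟩
  · refine ⟨b.equivFun (L.rangeRestrict v), ?_⟩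
    refine (hL _).trans ?_
    rw [LinearEquiv.coe_coe, LinearEquiv.symm_apply_apply]
    rfl
  · have h1 := hK (b.equivFun.symm x) j
    have h2 : (b.repr (b.equivFun.symm x)) j = x j := by
      rw [← Module.Basis.equivFun_apply, LinearEquiv.apply_symm_apply]
    rw [← hb, h2] at h1
    refine h1.trans_eq (congrArg (fun y => K * ν y) ?_)
    exact (hL _).symm

/-- Injectivity of R is not needed: the energy depends on v only through R v, by `hload`. It is
therefore minimised in coordinates on the range of R, where it is continuous and its sublevel set at
the value for v = 0 is bounded. -/
theorem exists_isDiscreteMinimizer (h : IsTriangulation Ω 𝒯) (hΩr : interior (closure Ω) = Ω)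
    (hΩb : Bornology.IsBounded Ω) (hp : 1 < p) (hp' : 1 ≤ p') (hpp' : p'.HolderConjugate p)
    (hc₁ : 0 < c₁) (hc₄ : 0 ≤ c₄) (hc₅ : 0 ≤ c₅)
    (hg : TwoSidedGrowth p c₁ c₂ c₄ c₅ W) (hW : Continuous W)
    (hf : MemLp f (ENNReal.ofReal p') (volume.restrict Ω))
    (hM : eLpNorm f (ENNReal.ofReal p') (volume.restrict Ω) ≤ ENNReal.ofReal M) (hC : 0 ≤ C)
    (hpoin : ∀ v : Vh m P l Ω 𝒯, ∫ x in Ω, ‖glue v.1 x‖ ^ p ≤ C * ∫ x in Ω, ‖glue (R v) x‖ ^ p) :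
    ∃ u : Vh m P l Ω 𝒯, IsDiscreteMinimizer W f u := by
  have := isFiniteMeasure_restrict hΩb
  have hfi := integrableOn_of_memLp hΩb hp' hf
  set RL : Vh m P l Ω 𝒯 →ₗ[ℝ] SigmaPw m P l 𝒯 := Rlin h hΩr with hRL
  have hni : ∀ ρ : SigmaPw m P l 𝒯, IntegrableOn (fun x => ‖glue ρ x‖) Ω := fun ρ =>
    integrableOn_comp_glue h hΩr continuous_norm ρ
  obtain ⟨N, Ψ, K, hK0, hΨ, hK⟩ := exists_coordinates (Y := SigmaPw m P l 𝒯) RL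
    (fun ρ => ∫ x in Ω, ‖glue ρ x‖)
    (fun ρ => integral_nonneg fun x => norm_nonneg _)
    (fun c ρ => by
      rw [← integral_const_mul]
      congr 1
      ext x
      have : glue (c • ρ) x = c • glue ρ x := glue_smul c _ x
      rw [this, norm_smul, Real.norm_eq_abs])
    (fun ρ τ => by
      rw [← integral_add (hni _) (hni _)]
      refine integral_mono (hni _) ((hni _).add (hni _)) fun x => ?_
      have : glue (ρ + τ) x = glue ρ x + glue τ x := glue_add _ _ x
      simp only [this]
      exact norm_add_le _ _)
    (fun ρ hρ => eq_zero_of_integral_norm_glue h hΩr hρ)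
  -- If R v = R w, the Poincaré inequality shows that the simplex components of v - w have vanishing
  -- norm, so that the loads agree.
  have hload : ∀ v w : Vh m P l Ω 𝒯, R v = R w →
      ∫ x in Ω, inner ℝ (f x) (glue v.1 x) = ∫ x in Ω, inner ℝ (f x) (glue w.1 x) := by
    intro v w hvw
    have h0 : R (v - w) = 0 := by
      have : RL (v - w) = RL v - RL w := map_sub RL v w
      exact this.trans (sub_eq_zero.2 hvw)
    have h1 := hpoin (v - w)
    have hz : ∀ x, glue (0 : SigmaPw m P l 𝒯) x = 0 := fun x => by simp [glue]
    rw [h0] at h1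
    simp only [hz, norm_zero, Real.zero_rpow (by linarith : p ≠ 0), integral_zero, mul_zero] at h1
    have h2 := abs_load_le h hΩr hpp' hf hM (v - w).1
    rw [le_antisymm h1 (integral_nonneg fun x => by positivity),
      Real.zero_rpow (by simpa using (by linarith : p ≠ 0)), mul_zero] at h2
    have h3 : load h hΩr hfi (v.1 - w.1) = 0 := abs_eq_zero.1 (le_antisymm h2 (abs_nonneg _))
    rw [map_sub, sub_eq_zero] at h3
    exact h3
  have hsurj : ∀ v : Vh m P l Ω 𝒯, ∃ x, discreteEnergy W f (Ψ x) = discreteEnergy W f v := by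
    intro v
    obtain ⟨x, hx⟩ := hΨ v
    have hR : R (Ψ x) = R v := hx
    exact ⟨x, by rw [discreteEnergy, discreteEnergy, hR, hload _ _ hR]⟩
  have hcont : Continuous fun x => discreteEnergy W f (Ψ x) := by
    refine Continuous.sub ?_ ?_
    · have h1 : ∀ x, ∫ y in Ω, W (glue (R (Ψ x)) y) =
          ∑ T : 𝒯, ∫ y in cell T.1, W (mfun (R (Ψ x) T) y) := fun x =>
        integral_comp_glue h hΩr hW _
      simp only [h1]
      refine continuous_finsetSum _ fun T _ => ?_
      have h2 := continuous_mfun_linear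
        ((LinearMap.proj T : SigmaPw m P l 𝒯 →ₗ[ℝ] P.matSpace m l (cell T.1)) ∘ₗ RL ∘ₗ Ψ)
      exact continuous_parametric_integral_of_continuous
        (f := fun x y => W (mfun (R (Ψ x) T) y)) (hW.comp h2) (isCompact_cell T.1)
    · exact LinearMap.continuous_of_finiteDimensional
        (load h hΩr hfi ∘ₗ LinearMap.fst ℝ (PolyPw m l 𝒯) (PolySides m (P.k l) Ω 𝒯) ∘ₗ Ψ)
  set B := max 1 ((((c₄ + c₅) * volume.real Ω + max M 0 * C ^ (1 / p)) / c₁) ^ (1 / (p - 1)))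
    with hB
  have hB0 : 0 ≤ B := le_trans zero_le_one (le_max_left _ _)
  have hp0 : 0 ≤ p := by linarith
  set ρ₀ := K * (volume.real Ω + B ^ p) with hρ₀
  have hρ0 : 0 ≤ ρ₀ := by positivity
  have hbdd : ∀ x, discreteEnergy W f (Ψ x) ≤ discreteEnergy W f (0 : Vh m P l Ω 𝒯) →
      x ∈ Metric.closedBall (0 : Fin N → ℝ) ρ₀ := by
    intro x hx
    rw [mem_closedBall_zero_iff, pi_norm_le_iff_of_nonneg hρ0]
    intro j
    have h1 : |x j| ≤ K * ∫ y in Ω, ‖glue (R (Ψ x)) y‖ := hK x j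
    refine h1.trans (mul_le_mul_of_nonneg_left ?_ hK0)
    have h3 := integral_norm_rpow_le h hΩr hΩb hp hpp' hc₁ hc₄ hc₅ hg hW hf hM hC hpoin hx
    have hI0 : 0 ≤ ∫ y in Ω, ‖glue (R (Ψ x)) y‖ ^ p := integral_nonneg fun y => by positivity
    have h4 : ∫ y in Ω, ‖glue (R (Ψ x)) y‖ ^ p ≤ B ^ p := by
      have h5 := Real.rpow_le_rpow (Real.rpow_nonneg hI0 _) h3 hp0
      rwa [← Real.rpow_mul hI0, one_div_mul_cancel (by linarith), Real.rpow_one] at h5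
    have hpi : IntegrableOn (fun y => ‖glue (R (Ψ x)) y‖ ^ p) Ω :=
      integrableOn_comp_glue h hΩr (continuous_norm.rpow_const fun _ => Or.inr hp0) _
    -- The coordinates are controlled by the L¹ norm, which t ≤ 1 + t^p reduces to the p-th power.
    calc ∫ y in Ω, ‖glue (R (Ψ x)) y‖ ≤ ∫ y in Ω, (1 + ‖glue (R (Ψ x)) y‖ ^ p) := by
          refine integral_mono (hni _) ((integrable_const 1).add hpi) fun y => ?_
          rcases le_total ‖glue (R (Ψ x)) y‖ 1 with h6 | h6
          · have : 0 ≤ ‖glue (R (Ψ x)) y‖ ^ p := by positivity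
            simp only
            linarith
          · have := Real.self_le_rpow_of_one_le h6 hp.le
            simp only
            linarith
      _ = volume.real Ω + ∫ y in Ω, ‖glue (R (Ψ x)) y‖ ^ p := by
          rw [integral_add (integrable_const 1) hpi, setIntegral_const, smul_eq_mul, mul_one]
      _ ≤ _ := by linarith
  obtain ⟨x₀, hx₀, hmin⟩ := (isCompact_closedBall (0 : Fin N → ℝ) ρ₀).exists_isMinOn
    ⟨0, Metric.mem_closedBall_self hρ0⟩ hcont.continuousOn
  refine ⟨Ψ x₀, fun v => ?_⟩
  have hmin' : ∀ x ∈ Metric.closedBall (0 : Fin N → ℝ) ρ₀,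
      discreteEnergy W f (Ψ x₀) ≤ discreteEnergy W f (Ψ x) := fun x hx => hmin hx
  have h00 : Ψ 0 = 0 := map_zero Ψ
  obtain ⟨x, hx⟩ := hsurj v
  rw [← hx]
  -- Competitors with energy below that of 0 lie in the ball; the others are beaten by 0, which is
  -- in the ball as well.
  rcases le_total (discreteEnergy W f (Ψ x)) (discreteEnergy W f (0 : Vh m P l Ω 𝒯)) with h1 | h1
  · exact hmin' x (hbdd x h1)
  · have h2 := hmin' 0 (Metric.mem_closedBall_self hρ0)
    rw [h00] at h2
    exact h2.trans h1

/-- Convexity at u + t v gives ∫ W(R(u + t v)) - ∫ W(R u) ≤ t J(t), and minimality bounds the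
left-hand side from below by t times the load. Division by t and continuity of J as t decreases to 0
replace differentiation under the integral. The reverse inequality comes from -v. -/
lemma le_integral_inner_DW (h : IsTriangulation Ω 𝒯) (hΩr : interior (closure Ω) = Ω)
    (hfi : IntegrableOn f Ω) (hW : ContDiff ℝ 1 W) (hc₃ : 0 < c₃)
    (hc : ConvexityControl r s c₃ W) {u : Vh m P l Ω 𝒯} (hu : IsDiscreteMinimizer W f u)
    (v : Vh m P l Ω 𝒯) :
    ∫ x in Ω, inner ℝ (f x) (glue v.1 x) ≤
      ∫ x in Ω, inner ℝ (DW W (glue (R u) x)) (glue (R v) x) := by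
  have hDW := DW_continuous hW
  set J : ℝ → ℝ := fun t =>
    ∫ x in Ω, inner ℝ (DW W (glue (R u) x + t • glue (R v) x)) (glue (R v) x) with hJ
  have hΦ : ∀ t : ℝ, Continuous (Function.uncurry fun A B : Mat m (d + 1) =>
      inner ℝ (DW W (A + t • B)) B) := fun t =>
    (hDW.comp (continuous_fst.add (continuous_snd.const_smul t))).inner continuous_snd
  have hJc : Continuous J := by
    have h1 : ∀ t, J t = ∑ T : 𝒯, ∫ x in cell T.1,
        inner ℝ (DW W (mfun (R u T) x + t • mfun (R v T) x)) (mfun (R v T) x) := fun t =>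
      integral_comp_glue₂ h hΩr (hΦ t) (R u) (R v)
    have h2 : J = fun t => ∑ T : 𝒯, ∫ x in cell T.1,
        inner ℝ (DW W (mfun (R u T) x + t • mfun (R v T) x)) (mfun (R v T) x) := funext h1
    rw [h2]
    refine continuous_finsetSum _ fun T _ => ?_
    refine continuous_parametric_integral_of_continuous (f := fun (t : ℝ) x =>
      inner ℝ (DW W (mfun (R u T) x + t • mfun (R v T) x)) (mfun (R v T) x)) ?_
      (isCompact_cell T.1)
    have hu' := (mfun_continuous (R u T)).comp (continuous_snd (X := ℝ))
    have hv' := (mfun_continuous (R v T)).comp (continuous_snd (X := ℝ))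
    exact (hDW.comp (hu'.add (continuous_fst.smul hv'))).inner hv'
  have hpos : ∀ t : ℝ, 0 < t → ∫ x in Ω, inner ℝ (f x) (glue v.1 x) ≤ J t := by
    intro t ht
    have h1 := hu (u + t • v)
    have hR : ∀ x, glue (R (u + t • v)) x = glue (R u) x + t • glue (R v) x := fun x => by
      rw [R_add h hΩr, R_smul h hΩr]
      exact (glue_add (R u) (t • R v) x).trans
        (congrArg (glue (R u) x + ·) (glue_smul t (R v) x))
    have hL : ∫ x in Ω, inner ℝ (f x) (glue (u + t • v).1 x) =
        (∫ x in Ω, inner ℝ (f x) (glue u.1 x)) + t * ∫ x in Ω, inner ℝ (f x) (glue v.1 x) := by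
      have h2 : load h hΩr hfi (u.1 + t • v.1) = load h hΩr hfi u.1 + t * load h hΩr hfi v.1 := by
        rw [map_add, map_smul, smul_eq_mul]
      exact h2
    have hW1 : IntegrableOn (fun x => W (glue (R u) x + t • glue (R v) x)) Ω :=
      integrableOn_comp_glue₂ h hΩr (Φ := fun A B => W (A + t • B))
        (hW.continuous.comp (continuous_fst.add (continuous_snd.const_smul t))) (R u) (R v)
    have hW0 : IntegrableOn (fun x => W (glue (R u) x)) Ω :=
      integrableOn_comp_glue h hΩr hW.continuous (R u)
    have hJi : IntegrableOn (fun x =>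
        inner ℝ (DW W (glue (R u) x + t • glue (R v) x)) (glue (R v) x)) Ω :=
      integrableOn_comp_glue₂ h hΩr (hΦ t) (R u) (R v)
    have h3 : (∫ x in Ω, W (glue (R u) x + t • glue (R v) x)) - ∫ x in Ω, W (glue (R u) x) ≤
        t * J t := by
      rw [← integral_sub hW1 hW0, hJ, ← integral_const_mul]
      refine integral_mono (hW1.sub hW0) (hJi.const_mul t) fun x => ?_
      have h4 := hc.nonneg hc₃ (glue (R u) x + t • glue (R v) x) (glue (R u) x)
      have h5 : glue (R u) x - (glue (R u) x + t • glue (R v) x) = -(t • glue (R v) x) := by abel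
      rw [h5, inner_neg_right, inner_smul_right] at h4
      simp only
      linarith
    simp only [discreteEnergy, hR] at h1
    rw [hL] at h1
    refine le_of_mul_le_mul_left ?_ ht
    linarith
  have hlim : Filter.Tendsto J (nhdsWithin 0 (Ioi 0)) (nhds (J 0)) :=
    (hJc.tendsto 0).mono_left nhdsWithin_le_nhds
  have h6 := ge_of_tendsto hlim (Filter.eventually_of_mem self_mem_nhdsWithin fun t ht => hpos t ht)
  simpa [hJ] using h6

/-- The discrete Euler-Lagrange equations. -/
theorem integral_inner_DW_eq (h : IsTriangulation Ω 𝒯) (hΩr : interior (closure Ω) = Ω)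
    (hfi : IntegrableOn f Ω) (hW : ContDiff ℝ 1 W) (hc₃ : 0 < c₃)
    (hc : ConvexityControl r s c₃ W) {u : Vh m P l Ω 𝒯} (hu : IsDiscreteMinimizer W f u)
    (v : Vh m P l Ω 𝒯) :
    ∫ x in Ω, inner ℝ (DW W (glue (R u) x)) (glue (R v) x) =
      ∫ x in Ω, inner ℝ (f x) (glue v.1 x) := by
  refine le_antisymm ?_ (le_integral_inner_DW h hΩr hfi hW hc₃ hc hu v)
  have h1 := le_integral_inner_DW h hΩr hfi hW hc₃ hc hu (-v)
  have hL : ∫ x in Ω, inner ℝ (f x) (glue (-v).1 x) = -∫ x in Ω, inner ℝ (f x) (glue v.1 x) :=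
    map_neg (load h hΩr hfi) v.1
  have hR : ∀ x, glue (R (-v)) x = -glue (R v) x := fun x => by
    have h2 : R (-v) = -R v := map_neg (Rlin h hΩr) v
    rw [h2]
    simp [glue]
  simp only [hR, inner_neg_right, integral_neg] at h1
  rw [hL] at h1
  linarith

/-- Uniqueness of the derivative of the energy density at discrete minimisers. -/
theorem DW_ae_eq (h : IsTriangulation Ω 𝒯) (hΩr : interior (closure Ω) = Ω)
    (hfi : IntegrableOn f Ω) (hW : ContDiff ℝ 1 W) (hc₃ : 0 < c₃) (hr : r ≠ 0)
    (hc : ConvexityControl r s c₃ W) {u₁ u₂ : Vh m P l Ω 𝒯} (hu₁ : IsDiscreteMinimizer W f u₁)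
    (hu₂ : IsDiscreteMinimizer W f u₂) :
    ∀ᵐ x ∂volume.restrict Ω, DW W (glue (R u₁) x) = DW W (glue (R u₂) x) := by
  have hDW := DW_continuous hW
  have hE : discreteEnergy W f u₁ = discreteEnergy W f u₂ := le_antisymm (hu₁ u₂) (hu₂ u₁)
  have hEL := integral_inner_DW_eq h hΩr hfi hW hc₃ hc hu₁ (u₂ - u₁)
  have hR : ∀ x, glue (R (u₂ - u₁)) x = glue (R u₂) x - glue (R u₁) x := fun x => by
    have h2 : R (u₂ - u₁) = R u₂ - R u₁ := map_sub (Rlin h hΩr) u₂ u₁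
    rw [h2]
    simp [glue]
  have hL : ∫ x in Ω, inner ℝ (f x) (glue (u₂ - u₁).1 x) =
      (∫ x in Ω, inner ℝ (f x) (glue u₂.1 x)) - ∫ x in Ω, inner ℝ (f x) (glue u₁.1 x) :=
    map_sub (load h hΩr hfi) u₂.1 u₁.1
  simp only [hR] at hEL
  rw [hL] at hEL
  have hi2 : IntegrableOn (fun x => W (glue (R u₂) x)) Ω :=
    integrableOn_comp_glue h hΩr hW.continuous (R u₂)
  have hi1 : IntegrableOn (fun x => W (glue (R u₁) x)) Ω :=
    integrableOn_comp_glue h hΩr hW.continuous (R u₁)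
  have hi3 : IntegrableOn (fun x =>
      inner ℝ (DW W (glue (R u₁) x)) (glue (R u₂) x - glue (R u₁) x)) Ω :=
    integrableOn_comp_glue₂ h hΩr (Φ := fun A B => inner ℝ (DW W A) (B - A))
      ((hDW.comp continuous_fst).inner (continuous_snd.sub continuous_fst)) (R u₁) (R u₂)
  -- The energies are equal, and the Euler-Lagrange equation tested with u₂ - u₁ turns the DW term
  -- into the difference of the loads. A nonnegative integrand with zero integral vanishes almost
  -- everywhere.
  have h0 : ∫ x in Ω, (W (glue (R u₂) x) - W (glue (R u₁) x) -
      inner ℝ (DW W (glue (R u₁) x)) (glue (R u₂) x - glue (R u₁) x)) = 0 := by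
    have hi21 : IntegrableOn (fun x => W (glue (R u₂) x) - W (glue (R u₁) x)) Ω := hi2.sub hi1
    rw [integral_sub hi21 hi3, integral_sub hi2 hi1, hEL]
    simp only [discreteEnergy] at hE
    linarith
  rw [integral_eq_zero_iff_of_nonneg (fun x => hc.nonneg hc₃ _ _) ((hi2.sub hi1).sub hi3)] at h0
  filter_upwards [h0] with x hx
  exact hc.eq_of_eq_zero hr hx

/-- The defining predicates coincide, so the same element is chosen; uniqueness of the projection
plays no role. -/
lemma projSigma_congr {g₁ g₂ : Vec (d + 1) → Mat m (d + 1)}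
    (hg : ∀ᵐ x ∂volume.restrict Ω, g₁ x = g₂ x) :
    projSigma P l Ω 𝒯 g₁ = projSigma P l Ω 𝒯 g₂ := by
  unfold projSigma
  congr 1
  funext q
  unfold IsL2Proj
  refine propext (forall_congr' fun φ => ?_)
  rw [integral_congr_ae]
  filter_upwards [hg] with x hx
  rw [hx]

end

section

variable {d m : ℕ} {P : Pairing} {l : ℕ} {Ω : Set (Vec (d + 1))}
  {𝒯 : Finset (Finset (Vec (d + 1)))} {W : Mat m (d + 1) → ℝ} {f : Vec (d + 1) → Vec m}
  {p p' r s c₁ c₂ c₃ c₄ c₅ M C : ℝ}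

/-! ### The discrete stress -/

/-- The normal component of a function in the row space is a polynomial of degree `k` on sides. -/
lemma exists_normalTrace {T : Finset (Vec (d + 1))} (hT : IsSimplex T) (a : T)
    {σ : Vec (d + 1) → Vec (d + 1)} (hσ : σ ∈ P.rowSpace l univ) :
    ∃ u ∈ poly (P.k l) univ, ∀ x ∈ cell (T.erase a.1),
      inner ℝ (σ x) (outerNormal T (T.erase a.1)) = u x := by
  cases P with
  | bdm => exact ⟨_, poly_inner hσ _, fun x _ => rfl⟩
  | rt =>
    obtain ⟨g, hg, b, hb, rfl⟩ := hσ
    set ν := outerNormal T (T.erase a.1) with hν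
    -- On the hyperplane of the side x·ν is constant, so the summand x b has a normal component of
    -- degree l only.
    refine ⟨(fun x => inner ℝ (g x) ν) + (height T a.1 + inner ℝ a.1 ν) • b,
      (poly _ univ).add_mem (poly_inner hg ν) ((poly _ univ).smul_mem _ hb), fun x hx => ?_⟩
    have h1 := inner_sub_normal_of_side hT a hx
    rw [← hν, inner_sub_left] at h1
    simp only [inner_add_left, inner_smul_left, conj_trivial, Pi.add_apply, Pi.smul_apply,
      smul_eq_mul]
    have h2 : inner ℝ x ν = height T a.1 + inner ℝ a.1 ν := by linarith
    rw [h2]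
    ring

lemma exists_poly_normalJump (h : IsTriangulation Ω 𝒯) (τ : SigmaPw m P l 𝒯)
    {F : Finset (Vec (d + 1))} (hF : F ∈ sides 𝒯) (i : Fin m) :
    ∃ u ∈ poly (P.k l) univ, ∀ x ∈ cell F, normalJump τ F x i = u x := by
  classical
  have h1 : ∀ T : 𝒯, ∃ u ∈ poly (n := d + 1) (P.k l) univ, ∀ x ∈ cell F, (if F ⊆ T.1 then
      inner ℝ ((mrow (τ T) i : Vec (d + 1) → Vec (d + 1)) x) (outerNormal T.1 F) else 0) = u x := by
    intro T
    by_cases hFT : F ⊆ T.1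
    · obtain ⟨a, rfl⟩ := eq_erase_of_subset (h.isSimplex T.2) (sides_card hF) hFT
      obtain ⟨u, hu, hux⟩ := exists_normalTrace (h.isSimplex T.2) a (mrow (τ T) i).2
      exact ⟨u, hu, fun x hx => by rw [if_pos hFT]; exact hux x hx⟩
    · exact ⟨0, Submodule.zero_mem _, fun x _ => by rw [if_neg hFT]; rfl⟩
  choose u hu hux using h1
  refine ⟨fun x => ∑ T, u T x, poly_sum _ fun T _ => hu T, fun x hx => ?_⟩
  rw [normalJump_apply τ F hx]
  refine Finset.sum_congr rfl fun T _ => ?_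
  rw [← hux T x hx]

/-- If a piecewise function is orthogonal to the side components, then its normal jumps vanish. -/
lemma normalJump_ae_eq_zero (h : IsTriangulation Ω 𝒯) (τ : SigmaPw m P l 𝒯)
    (H : ∀ w : PolySides m (P.k l) Ω 𝒯, ∑ F : interiorSides Ω 𝒯, (∫ x in cell F.1,
      inner ℝ ((w F : Vec (d + 1) → Vec m) x) (normalJump τ F.1 x) ∂μHE[d]) = 0)
    {F : Finset (Vec (d + 1))} (hF : F ∈ interiorSides Ω 𝒯) :
    ∀ᵐ x ∂(μHE[d] : Measure (Vec (d + 1))).restrict (cell F), normalJump τ F x = 0 := by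
  have hs : ∀ F : interiorSides Ω 𝒯, F.1 ∈ sides 𝒯 := fun F => (mem_interiorSides.1 F.2).1
  choose u hu hux using fun (F : interiorSides Ω 𝒯) (i : Fin m) =>
    exists_poly_normalJump h τ (hs F) i
  -- The jumps themselves are admissible side components, since they are polynomials of degree k.
  let w : PolySides m (P.k l) Ω 𝒯 := fun F =>
    ofRows (m := m) (isLocalSpace_poly (d + 1) (P.k l)) (cell F.1) fun i => ⟨u F i, hu F i⟩
  have hw : ∀ F : interiorSides Ω 𝒯, ∀ x ∈ cell F.1,
      inner ℝ ((w F : Vec (d + 1) → Vec m) x) (normalJump τ F.1 x) = ∑ i, u F i x ^ 2 := by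
    intro F x hx
    simp only [PiLp.inner_apply]
    refine Finset.sum_congr rfl fun i _ => ?_
    have h1 : (w F : Vec (d + 1) → Vec m) x i = u F i x :=
      ofRows_apply (isLocalSpace_poly (d + 1) (P.k l)) _ hx i
    rw [h1, hux F i x hx]
    simp [sq]
  have hm : ∀ F : Finset (Vec (d + 1)), MeasurableSet (cell F) := measurableSet_cell
  have h0 := H w
  rw [Finset.sum_congr rfl fun F _ => setIntegral_congr_fun (hm F.1) (hw F),
    Finset.sum_eq_zero_iff_of_nonneg fun F _ => setIntegral_nonneg (hm F.1) fun x _ =>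
      Finset.sum_nonneg fun i _ => sq_nonneg _] at h0
  have h1 := (setIntegral_eq_zero_iff_of_nonneg_ae
    (Filter.Eventually.of_forall fun x => Finset.sum_nonneg fun i _ => sq_nonneg _)
    (integrableOn_of_mem_sides h (hs ⟨F, hF⟩) (continuous_finsetSum _ fun i _ =>
      (poly_continuous (hu ⟨F, hF⟩ i)).pow 2))).1 (h0 ⟨F, hF⟩ (Finset.mem_univ _))
  filter_upwards [h1, ae_restrict_mem (hm F)] with x hx hxF
  have h2 : ∑ i, u ⟨F, hF⟩ i x ^ 2 = 0 := hx
  rw [Finset.sum_eq_zero_iff_of_nonneg fun i _ => sq_nonneg _] at h2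
  ext i
  rw [hux ⟨F, hF⟩ i x hxF, pow_eq_zero_iff two_ne_zero |>.1 (h2 i (Finset.mem_univ i))]
  rfl

lemma integrableOn_DW_cell (h : IsTriangulation Ω 𝒯) (hΩr : interior (closure Ω) = Ω)
    (hW : ContDiff ℝ 1 W) (ρ : SigmaPw m P l 𝒯) (T : 𝒯) :
    IntegrableOn (fun x => DW W (glue ρ x)) (cell T.1) :=
  integrableOn_cell_of_integrableOn h hΩr (integrableOn_comp_glue h hΩr (DW_continuous hW) ρ) T

theorem existsUnique_projSigma (h : IsTriangulation Ω 𝒯) (hΩr : interior (closure Ω) = Ω)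
    (hW : ContDiff ℝ 1 W) (ρ : SigmaPw m P l 𝒯) : ∃! q : SigmaPw m P l 𝒯,
      IsL2Proj (fun T : 𝒯 => P.matSpace m l (cell T.1)) Ω (fun x => DW W (glue ρ x)) q :=
  existsUnique_isL2Proj (m := m) h hΩr (isLocalSpace_rowSpace (d + 1) P l)
    (integrableOn_DW_cell h hΩr hW ρ)

theorem existsUnique_projPoly (h : IsTriangulation Ω 𝒯) (hΩr : interior (closure Ω) = Ω)
    (hf : IntegrableOn f Ω) : ∃! q : PolyPw m l 𝒯,
      IsL2Proj (fun T : 𝒯 => polyVec m l (cell T.1)) Ω f q :=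
  existsUnique_isL2Proj (m := m) h hΩr (isLocalSpace_poly (d + 1) l)
    (integrableOn_cell_of_integrableOn h hΩr hf)

lemma isL2Proj_discreteStress (h : IsTriangulation Ω 𝒯) (hΩr : interior (closure Ω) = Ω)
    (hW : ContDiff ℝ 1 W) (u : Vh m P l Ω 𝒯) :
    IsL2Proj (fun T : 𝒯 => P.matSpace m l (cell T.1)) Ω (fun x => DW W (glue (R u) x))
      (discreteStress W u) :=
  Classical.epsilon_spec (existsUnique_projSigma h hΩr hW (R u)).exists

lemma isL2Proj_projPoly (h : IsTriangulation Ω 𝒯) (hΩr : interior (closure Ω) = Ω)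
    (hf : IntegrableOn f Ω) :
    IsL2Proj (fun T : 𝒯 => polyVec m l (cell T.1)) Ω f (projPoly l Ω 𝒯 f) :=
  Classical.epsilon_spec (existsUnique_projPoly h hΩr hf).exists

/-- The discrete equilibrium of the discrete stress. -/
lemma load_eq_discreteStress (h : IsTriangulation Ω 𝒯) (hΩr : interior (closure Ω) = Ω)
    (hfi : IntegrableOn f Ω) (hW : ContDiff ℝ 1 W) (hc₃ : 0 < c₃)
    (hc : ConvexityControl r s c₃ W) {u : Vh m P l Ω 𝒯} (hu : IsDiscreteMinimizer W f u)
    (v : Vh m P l Ω 𝒯) :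
    ∫ x in Ω, inner ℝ (f x) (glue v.1 x) =
      - (∫ x in Ω, inner ℝ (glue v.1 x) (divPw (discreteStress W u) x))
      + ∑ F : interiorSides Ω 𝒯, (∫ x in cell F.1, inner ℝ ((v.2 F : Vec (d + 1) → Vec m) x)
        (normalJump (discreteStress W u) F.1 x) ∂μHE[d]) := by
  have h1 := integral_inner_DW_eq h hΩr hfi hW hc₃ hc hu v
  -- R v belongs to Σ(𝒯), so DW(R u) may be replaced by its projection; the definition of R, tested
  -- with this projection, then moves the equation to v.
  have h2 := isL2Proj_discreteStress h hΩr hW u (R v)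
  have h3 : (∫ x in Ω, inner ℝ (glue (R v) x) (glue (discreteStress W u) x)) =
      - (∫ x in Ω, inner ℝ (glue v.1 x) (divPw (discreteStress W u) x))
      + ∑ F : interiorSides Ω 𝒯, (∫ x in cell F.1, inner ℝ ((v.2 F : Vec (d + 1) → Vec m) x)
        (normalJump (discreteStress W u) F.1 x) ∂μHE[d]) :=
    isGradRec_R h hΩr v (discreteStress W u)
  have hi1 : IntegrableOn (fun x => inner ℝ (DW W (glue (R u) x)) (glue (R v) x)) Ω :=
    integrableOn_comp_glue₂ h hΩr (Φ := fun A B => inner ℝ (DW W A) B)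
      (((DW_continuous hW).comp continuous_fst).inner continuous_snd) (R u) (R v)
  have hi2 : IntegrableOn (fun x => inner ℝ (glue (discreteStress W u) x) (glue (R v) x)) Ω :=
    integrableOn_comp_glue₂ h hΩr (Φ := fun A B => inner ℝ A B) continuous_inner _ (R v)
  have h4 : (∫ x in Ω, inner ℝ (DW W (glue (R u) x)) (glue (R v) x)) =
      ∫ x in Ω, inner ℝ (glue (discreteStress W u) x) (glue (R v) x) := by
    rw [← sub_eq_zero, ← integral_sub hi1 hi2, ← h2]
    refine integral_congr_ae (Filter.Eventually.of_forall fun x => ?_)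
    exact (inner_sub_left _ _ _).symm
  rw [← h1, h4, ← h3]
  exact integral_congr_ae (Filter.Eventually.of_forall fun x => real_inner_comm _ _)

lemma normalJump_discreteStress (h : IsTriangulation Ω 𝒯) (hΩr : interior (closure Ω) = Ω)
    (hfi : IntegrableOn f Ω) (hW : ContDiff ℝ 1 W) (hc₃ : 0 < c₃)
    (hc : ConvexityControl r s c₃ W) {u : Vh m P l Ω 𝒯} (hu : IsDiscreteMinimizer W f u)
    {F : Finset (Vec (d + 1))} (hF : F ∈ interiorSides Ω 𝒯) :
    ∀ᵐ x ∂(μHE[d] : Measure (Vec (d + 1))).restrict (cell F),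
      normalJump (discreteStress W u) F x = 0 := by
  refine normalJump_ae_eq_zero h _ (fun w => ?_) hF
  have h1 := load_eq_discreteStress h hΩr hfi hW hc₃ hc hu ((0, w) : Vh m P l Ω 𝒯)
  have h2 : ∀ x, glue (0 : PolyPw m l 𝒯) x = 0 := fun x => by simp [glue]
  simp only [h2, inner_zero_left, inner_zero_right, integral_zero, neg_zero, zero_add] at h1
  exact h1.symm

/-- Discrete equilibrium tested with (q, 0) shows that -div σ_h and f have the same moments against
polynomials of degree l. As the divergence is itself such a polynomial, it is -Π f. -/
lemma rowDiv_discreteStress (h : IsTriangulation Ω 𝒯) (hΩr : interior (closure Ω) = Ω)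
    (hfi : IntegrableOn f Ω) (hW : ContDiff ℝ 1 W) (hc₃ : 0 < c₃)
    (hc : ConvexityControl r s c₃ W) {u : Vh m P l Ω 𝒯} (hu : IsDiscreteMinimizer W f u)
    (T : 𝒯) (i : Fin m) (x : Vec (d + 1)) :
    rowDiv (mrow (discreteStress W u T) i : Vec (d + 1) → Vec (d + 1)) x =
      -(vrow (projPoly l Ω 𝒯 f T) i : Vec (d + 1) → ℝ) x := by
  have hp := isLocalSpace_poly (d + 1) l
  have hfc := integrableOn_cell_of_integrableOn h hΩr hfi
  have hv : ∀ (q : PolyPw m l 𝒯) (T : 𝒯), IntegrableOn (fun x => glue q x) (cell T.1) := fun q T => by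
    refine (integrableOn_cell' T.1 (vfun_continuous (q T))).congr ?_
    filter_upwards [glue_ae_vfun h q T] with x hx
    exact hx.symm
  have h1 : ∀ q : PolyPw m l 𝒯, ∑ T : 𝒯, ∑ i, ((∫ x in cell T.1, inner ℝ (f x i)
      ((vrow (q T) i : Vec (d + 1) → ℝ) x)) + ∫ x in cell T.1, (vrow (q T) i : Vec (d + 1) → ℝ) x *
      rowDiv (mrow (discreteStress W u T) i : Vec (d + 1) → Vec (d + 1)) x) = 0 := by
    intro q
    have h2 := load_eq_discreteStress h hΩr hfi hW hc₃ hc hu ((q, 0) : Vh m P l Ω 𝒯)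
    have h3 : ∫ x in Ω, inner ℝ (f x) (glue q x) = ∑ T : 𝒯, ∑ i, ∫ x in cell T.1,
        inner ℝ (f x i) ((vrow (q T) i : Vec (d + 1) → ℝ) x) :=
      integral_inner_glue (m := m) h hΩr hp hfc q
    have h4 : ∫ x in Ω, inner ℝ (glue q x) (divPw (discreteStress W u) x) =
        ∑ T : 𝒯, ∑ i, ∫ x in cell T.1, (vrow (q T) i : Vec (d + 1) → ℝ) x *
        rowDiv (mrow (discreteStress W u T) i : Vec (d + 1) → Vec (d + 1)) x := by
      refine (integral_inner_divPw h hΩr (hv q) _).trans (Finset.sum_congr rfl fun T _ =>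
        Finset.sum_congr rfl fun i _ => integral_congr_ae ?_)
      filter_upwards [glue_ae_vfun h q T] with x hx
      have hx' : glue q x = _ := hx
      rw [hx']
      rfl
    have h5 : ∀ (F : interiorSides Ω 𝒯) (x : Vec (d + 1)),
        ((0 : PolySides m (P.k l) Ω 𝒯) F : Vec (d + 1) → Vec m) x = 0 := fun _ _ => rfl
    simp only [h5, inner_zero_left, integral_zero, Finset.sum_const_zero, add_zero] at h2
    rw [h3, h4] at h2
    simp only [Finset.sum_add_distrib]
    linarith
  have h6 := (forall_sum_eq_zero_iff (m := m) h hp (fun T i w => (∫ x in cell T.1, inner ℝ (f x i)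
      ((w : Vec (d + 1) → ℝ) x)) + ∫ x in cell T.1, (w : Vec (d + 1) → ℝ) x *
      rowDiv (mrow (discreteStress W u T) i : Vec (d + 1) → Vec (d + 1)) x)
      (fun T i => by simp)).1 h1 T i
  have h7 := (isL2Proj_iff (m := m) h hΩr hp hfc (projPoly l Ω 𝒯 f)).1
    (isL2Proj_projPoly h hΩr hfi) T i
  set D : poly (n := d + 1) l univ := ⟨_, rowDiv_mem_poly (mrow (discreteStress W u T) i).2⟩ with hD
  set q : poly (n := d + 1) l univ := vrow (projPoly l Ω 𝒯 f T) i with hq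
  -- The sum of projection and divergence is orthogonal to the polynomial space and a member of it.
  have h8 : q + D = 0 := by
    refine eq_zero_of_integral_inner_self hp (h.interior_nonempty T.1 T.2) ?_
    have h9 := h6 (q + D)
    rw [← h7 (q + D)] at h9
    rw [← integral_add] at h9
    · rw [← h9]
      refine integral_congr_ae (Filter.Eventually.of_forall fun x => ?_)
      simp only [Submodule.coe_add, Pi.add_apply, RCLike.inner_apply, conj_trivial]
      rw [mul_add ((q : Vec (d + 1) → ℝ) x + (D : Vec (d + 1) → ℝ) x)]
    · exact integrableOn_inner (integrableOn_cell' T.1 (poly_continuous q.2))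
        (poly_continuous (q + D).2)
    · exact integrableOn_cell T.1 ((poly_continuous (q + D).2).mul (poly_continuous D.2))
  have h10 := congrFun (congrArg Subtype.val h8) x
  have h11 : (q : Vec (d + 1) → ℝ) x + (D : Vec (d + 1) → ℝ) x = 0 := h10
  exact eq_neg_of_add_eq_zero_right h11

/-- The weak divergence of a piecewise function with vanishing normal jumps. -/
theorem hasWeakDiv_of_normalJump (h : IsTriangulation Ω 𝒯) (hΩo : IsOpen Ω)
    (hΩr : interior (closure Ω) = Ω) {τ : SigmaPw m P l 𝒯}
    (hτ : ∀ F ∈ interiorSides Ω 𝒯, ∀ᵐ x ∂(μHE[d] : Measure (Vec (d + 1))).restrict (cell F),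
      normalJump τ F x = 0) {q : PolyPw m l 𝒯}
    (hq : ∀ (T : 𝒯) (i : Fin m) (x : Vec (d + 1)),
      rowDiv (mrow (τ T) i : Vec (d + 1) → Vec (d + 1)) x =
        -(vrow (q T) i : Vec (d + 1) → ℝ) x) :
    HasWeakDiv Ω (glue τ) (fun x => -glue q x) := by
  classical
  intro i φ hφ hφc hφΩ
  have hφ1 : ContDiff ℝ 1 φ := hφ.of_le (by exact_mod_cast le_top)
  have hgrad : Continuous (gradient φ) :=
    (InnerProductSpace.toDual ℝ (Vec (d + 1))).symm.continuous.comp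
      (hφ1.continuous_fderiv one_ne_zero)
  have hinner : ∀ x e, inner ℝ e (gradient φ x) = fderiv ℝ φ x e := fun x e => by
    rw [real_inner_comm, gradient, InnerProductSpace.toDual_symm_apply]
  have hL : ∫ x in Ω, inner ℝ (glue τ x i) (gradient φ x) = ∑ T : 𝒯, ∫ x in cell T.1,
      fderiv ℝ φ x ((mrow (τ T) i : Vec (d + 1) → Vec (d + 1)) x) := by
    have h1 := integral_glue (m := m) h hΩr (isLocalSpace_rowSpace (d + 1) P l) τ
      (fun x y => inner ℝ (y i) (gradient φ x)) fun T =>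
        integrableOn_cell T.1 ((row_continuous _ i _).inner hgrad)
    refine h1.trans (Finset.sum_congr rfl fun T _ => ?_)
    simp only [hinner]
    rfl
  have hRt : ∫ x in Ω, (-glue q x) i * φ x = ∑ T : 𝒯, ∫ x in cell T.1,
      φ x * rowDiv (mrow (τ T) i : Vec (d + 1) → Vec (d + 1)) x := by
    have h1 := integral_glue (m := m) h hΩr (isLocalSpace_poly (d + 1) l) q
      (fun x y => (-y) i * φ x) fun T => integrableOn_cell T.1
        ((row_continuous (isLocalSpace_poly (d + 1) l) i _).neg.mul hφ1.continuous)
    refine h1.trans (Finset.sum_congr rfl fun T _ => ?_)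
    refine integral_congr_ae (Filter.Eventually.of_forall fun x => ?_)
    simp only [hq, mul_comm (φ x)]
    rfl
  -- On interior sides the normal jump vanishes; on boundary sides φ does, as its support lies in
  -- the open set Ω.
  have hsides : ∑ T : 𝒯, ∑ a : T.1, ∫ x in cell (T.1.erase a.1), φ x *
      inner ℝ ((mrow (τ T) i : Vec (d + 1) → Vec (d + 1)) x)
        (outerNormal T.1 (T.1.erase a.1)) ∂μHE[d] = 0 := by
    rw [sum_simplices_sides h (fun T F => ∫ x in cell F, φ x *
      inner ℝ ((mrow (τ T) i : Vec (d + 1) → Vec (d + 1)) x) (outerNormal T.1 F) ∂μHE[d])]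
    refine Finset.sum_eq_zero fun F hF => ?_
    by_cases hFi : F ∈ interiorSides Ω 𝒯
    · have hint : ∀ T : 𝒯, IntegrableOn (fun x => φ x *
          inner ℝ ((mrow (τ T) i : Vec (d + 1) → Vec (d + 1)) x) (outerNormal T.1 F))
          (cell F) μHE[d] := fun T => integrableOn_of_mem_sides h hF
        (hφ1.continuous.mul ((rowSpace_continuous (mrow (τ T) i).2).inner continuous_const))
      have h2 : ∑ T : 𝒯, (if F ⊆ T.1 then ∫ x in cell F, φ x *
          inner ℝ ((mrow (τ T) i : Vec (d + 1) → Vec (d + 1)) x) (outerNormal T.1 F) ∂μHE[d]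
          else 0) = ∫ x in cell F, ∑ T : 𝒯, (if F ⊆ T.1 then φ x *
          inner ℝ ((mrow (τ T) i : Vec (d + 1) → Vec (d + 1)) x) (outerNormal T.1 F)
          else 0) ∂μHE[d] := by
        rw [integral_finsetSum]
        · refine Finset.sum_congr rfl fun T _ => ?_
          split_ifs <;> simp
        · intro T _
          split_ifs
          · exact hint T
          · exact integrable_zero _ _ _
      have h3 : (∫ x in cell F, ∑ T : 𝒯, (if F ⊆ T.1 then φ x *
          inner ℝ ((mrow (τ T) i : Vec (d + 1) → Vec (d + 1)) x) (outerNormal T.1 F)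
          else 0) ∂μHE[d]) = 0 := by
        refine integral_eq_zero_of_ae ?_
        filter_upwards [hτ F hFi, ae_restrict_mem (measurableSet_cell F)] with x hx hxF
        have h4 := normalJump_apply τ F hxF i
        rw [hx] at h4
        have h5 : ∑ T : 𝒯, (if F ⊆ T.1 then φ x *
            inner ℝ ((mrow (τ T) i : Vec (d + 1) → Vec (d + 1)) x) (outerNormal T.1 F) else 0) =
            φ x * ∑ T : 𝒯, (if F ⊆ T.1 then
            inner ℝ ((mrow (τ T) i : Vec (d + 1) → Vec (d + 1)) x) (outerNormal T.1 F) else 0) := by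
          rw [Finset.mul_sum]
          exact Finset.sum_congr rfl fun T _ => by split_ifs <;> simp
        have h6 : ∑ T : 𝒯, (if F ⊆ T.1 then
            inner ℝ ((mrow (τ T) i : Vec (d + 1) → Vec (d + 1)) x) (outerNormal T.1 F) else 0) = 0 := by
          exact h4.symm
        rw [h5, h6, mul_zero]
        rfl
      exact h2.trans h3
    · have hFf : cell F ⊆ frontier Ω := by
        by_contra hcon
        exact hFi (mem_interiorSides.2 ⟨hF, hcon⟩)
      refine Finset.sum_eq_zero fun T _ => ?_
      split_ifs
      · refine setIntegral_eq_zero_of_forall_eq_zero fun x hx => ?_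
        have hxΩ : x ∉ Ω := by
          have := hFf hx
          rw [hΩo.frontier_eq] at this
          exact this.2
        rw [image_eq_zero_of_notMem_tsupport fun hh => hxΩ (hφΩ hh), zero_mul]
      · rfl
  rw [hL, hRt, eq_neg_iff_add_eq_zero, ← Finset.sum_add_distrib, ← hsides]
  exact Finset.sum_congr rfl fun T _ =>
    integral_fderiv_add_rowDiv (h.isSimplex T.2) (mrow (τ T) i).2 hφ1

theorem discreteStress_mem_Q (h : IsTriangulation Ω 𝒯) (hΩo : IsOpen Ω)
    (hΩr : interior (closure Ω) = Ω) (hp' : 0 < p')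
    (hfi : IntegrableOn f Ω) (hW : ContDiff ℝ 1 W) (hc₃ : 0 < c₃)
    (hc : ConvexityControl r s c₃ W) {u : Vh m P l Ω 𝒯} (hu : IsDiscreteMinimizer W f u) :
    discreteStress W u ∈ Q P l p' Ω 𝒯 f := by
  have h1 := hasWeakDiv_of_normalJump h hΩo hΩr
    (fun F hF => normalJump_discreteStress h hΩr hfi hW hc₃ hc hu hF)
    (rowDiv_discreteStress h hΩr hfi hW hc₃ hc hu)
  exact ⟨⟨memLp_glue h hΩr hp' _, _, (memLp_glue_poly h hΩr hp' _).neg, h1⟩, h1⟩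

/-! ### Stability of the local projection -/

/-- Testing with σ itself gives ∫ |σ|² ≤ G max |σ| |T|, and the inverse estimate bounds |T| (max
|σ|)² by a multiple of the left-hand side. One factor max |σ| is divided out. -/
lemma exists_projection_bound (d : ℕ) (P : Pairing) (l : ℕ) :
    ∃ C : ℝ, 0 < C ∧ ∀ T : Finset (Vec (d + 1)), IsSimplex T → ∀ σ ∈ P.rowSpace l univ,
      ∀ g : Vec (d + 1) → Vec (d + 1), ∀ G : ℝ, 0 ≤ G →
      (∀ᵐ x ∂volume.restrict (cell T), ‖g x‖ ≤ G) →
      (∫ x in cell T, inner ℝ (σ x) (σ x) = ∫ x in cell T, inner ℝ (g x) (σ x)) →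
      ∀ x ∈ cell T, ‖σ x‖ ≤ C * G := by
  obtain ⟨C, hC, H⟩ := exists_cell_bound_rowSpace d P l (p := 2) one_le_two
  set κ := (volume : Measure (Vec (d + 1))).real (refSimplex (d + 1)) with hκ
  have hκ0 : 0 ≤ κ := measureReal_nonneg
  refine ⟨C * κ + 1, by positivity, fun T hT σ hσ g G hG hg heq x hx => ?_⟩
  have hJ := jac_pos hT
  obtain ⟨y, hy, hmax⟩ := (isCompact_cell T).exists_isMaxOn ⟨x, hx⟩
    (rowSpace_continuous hσ).norm.continuousOn
  have hmax' : ∀ z ∈ cell T, ‖σ z‖ ≤ ‖σ y‖ := fun z hz => hmax hz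
  refine (hmax' x hx).trans ?_
  have h1 := H T hT σ hσ y hy
  have h2 : ∫ x in cell T, ‖σ x‖ ^ (2 : ℝ) = ∫ x in cell T, inner ℝ (g x) (σ x) := by
    rw [← heq]
    refine integral_congr_ae (Filter.Eventually.of_forall fun z => ?_)
    simp
  have h3 : ‖∫ x in cell T, inner ℝ (g x) (σ x)‖ ≤ G * ‖σ y‖ * volume.real (cell T) := by
    refine norm_setIntegral_le_of_norm_le_const_ae (isCompact_cell T).measure_lt_top ?_
    filter_upwards [hg, ae_restrict_mem (measurableSet_cell T)] with z hz hzT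
    exact (norm_inner_le_norm _ _).trans (mul_le_mul hz (hmax' z hzT) (norm_nonneg _) hG)
  rw [h2] at h1
  have h4 := (le_abs_self _).trans h3
  rw [measure_cell_eq hT, ← hκ] at h4
  have h5 : jac T * ‖σ y‖ ^ 2 ≤ C * (G * ‖σ y‖ * (jac T * κ)) := by
    have : ‖σ y‖ ^ (2 : ℝ) = ‖σ y‖ ^ 2 := by norm_cast
    rw [← this]
    exact h1.trans (mul_le_mul_of_nonneg_left h4 hC.le)
  rcases (norm_nonneg (σ y)).eq_or_lt with h0 | h0
  · rw [← h0]; positivity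
  · have h6 : ‖σ y‖ ≤ C * κ * G := by
      refine le_of_mul_le_mul_left ?_ (mul_pos hJ h0)
      nlinarith
    nlinarith

lemma exists_cell_bound_matSpace (d m : ℕ) (P : Pairing) (l : ℕ) {p : ℝ} (hp : 1 ≤ p) :
    ∃ C : ℝ, 0 < C ∧ ∀ T : Finset (Vec (d + 1)), IsSimplex T →
      ∀ σ : P.matSpace m l (cell T), ∀ x ∈ cell T,
      jac T * ‖mfun σ x‖ ^ p ≤ C * ∫ x in cell T, ‖mfun σ x‖ ^ p := by
  obtain ⟨C, hC, H⟩ := exists_cell_bound_rowSpace d P l hp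
  have hp0 : 0 ≤ p := by linarith
  refine ⟨(m : ℝ) ^ (p - 1) * (m * C) + 1, by positivity, fun T hT σ x hx => ?_⟩
  set I := ∫ x in cell T, ‖mfun σ x‖ ^ p with hI
  have hI0 : 0 ≤ I := setIntegral_nonneg (measurableSet_cell T) fun x _ => by positivity
  have h1 : ∀ i, jac T * ‖(mrow σ i : Vec (d + 1) → Vec (d + 1)) x‖ ^ p ≤ C * I := fun i =>
    (H T hT _ (mrow σ i).2 x hx).trans (mul_le_mul_of_nonneg_left
      (setIntegral_mono_on
        (integrableOn_cell T (continuous_norm_rpow hp0 (rowSpace_continuous (mrow σ i).2)))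
        (integrableOn_cell T (continuous_norm_rpow hp0 (mfun_continuous σ)))
        (measurableSet_cell T) fun y _ => norm_row_rpow_le hp0 (mfun σ y) i) hC.le)
  calc jac T * ‖mfun σ x‖ ^ p
      ≤ jac T * ((m : ℝ) ^ (p - 1) * ∑ i, ‖mfun σ x i‖ ^ p) :=
        mul_le_mul_of_nonneg_left (norm_rpow_le_sum_row hp _) (jac_pos hT).le
    _ = (m : ℝ) ^ (p - 1) * ∑ i, jac T * ‖(mrow σ i : Vec (d + 1) → Vec (d + 1)) x‖ ^ p := by
        rw [← Finset.mul_sum]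
        simp only [mfun_apply]
        ring
    _ ≤ (m : ℝ) ^ (p - 1) * ∑ i : Fin m, C * I :=
        mul_le_mul_of_nonneg_left (Finset.sum_le_sum fun i _ => h1 i) (by positivity)
    _ = (m : ℝ) ^ (p - 1) * (m * C) * I := by simp; ring
    _ ≤ _ := by nlinarith

/-- The discrete stress is bounded in terms of the gradient reconstruction. -/
theorem exists_stress_bound (d m : ℕ) (P : Pairing) (l : ℕ) {p p' K : ℝ} (hp : 1 < p)
    (hp' : 1 < p') (hpp' : (p - 1) * p' = p) (hK : 0 ≤ K) :
    ∃ C : ℝ, 0 < C ∧ ∀ (Ω : Set (Vec (d + 1))), interior (closure Ω) = Ω →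
      ∀ 𝒯 : Finset (Finset (Vec (d + 1))), IsTriangulation Ω 𝒯 →
      ∀ W : Mat m (d + 1) → ℝ, ContDiff ℝ 1 W → (∀ A, ‖DW W A‖ ≤ K * (1 + ‖A‖) ^ (p - 1)) →
      ∀ u : Vh m P l Ω 𝒯, ∫ x in Ω, ‖glue (discreteStress W u) x‖ ^ p' ≤
        C * (volume.real Ω + ∫ x in Ω, ‖glue (R u) x‖ ^ p) := by
  obtain ⟨C₀, hC₀, hproj⟩ := exists_projection_bound d P l
  obtain ⟨C₁, hC₁, hcell⟩ := exists_cell_bound_matSpace d m P l hp.le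
  have hp0 : 0 ≤ p := by linarith
  have hp'0 : 0 ≤ p' := by linarith
  set κ := (volume : Measure (Vec (d + 1))).real (refSimplex (d + 1)) with hκ
  have hκ0 : 0 ≤ κ := measureReal_nonneg
  set B := (m : ℝ) ^ (p' - 1) * (m * (C₀ * K) ^ p') * 2 ^ p with hB
  have hB0 : 0 ≤ B := by positivity
  refine ⟨B * (1 + κ * C₁) + 1, by positivity, fun Ω hΩr 𝒯 h W hW hDW u => ?_⟩
  set σ := discreteStress W u with hσ
  have hpr := (isL2Proj_iff (m := m) h hΩr (isLocalSpace_rowSpace (d + 1) P l)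
    (integrableOn_DW_cell h hΩr hW (R u)) σ).1 (isL2Proj_discreteStress h hΩr hW u)
  have hcont : ∀ q : ℝ, 0 ≤ q → Continuous fun A : Mat m (d + 1) => ‖A‖ ^ q :=
    fun q hq => continuous_norm.rpow_const fun _ => Or.inr hq
  have hvol : volume.real Ω = ∑ T : 𝒯, volume.real (cell T.1) := by
    have h1 := integral_comp_glue h hΩr (Φ := fun _ : Mat m (d + 1) => (1 : ℝ)) continuous_const σ
    simpa using h1
  have hT : ∀ T : 𝒯, ∫ x in cell T.1, ‖mfun (σ T) x‖ ^ p' ≤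
      B * (1 + κ * C₁) * (volume.real (cell T.1) + ∫ x in cell T.1, ‖mfun (R u T) x‖ ^ p) := by
    intro T
    have hS := h.isSimplex T.2
    have hJ := jac_pos hS
    obtain ⟨y, hy, hmax⟩ := (isCompact_cell T.1).exists_isMaxOn
      ((nonempty_interior_cell hS).mono interior_subset) (mfun_continuous (R u T)).norm.continuousOn
    have hmax' : ∀ z ∈ cell T.1, ‖mfun (R u T) z‖ ≤ ‖mfun (R u T) y‖ := fun z hz => hmax hz
    set S := ‖mfun (R u T) y‖ with hSd
    have hS0 : 0 ≤ S := norm_nonneg _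
    set G := K * (1 + S) ^ (p - 1) with hG
    have hG0 : 0 ≤ G := by positivity
    have hg : ∀ᵐ x ∂volume.restrict (cell T.1), ‖DW W (glue (R u) x)‖ ≤ G := by
      filter_upwards [glue_ae_mfun h (R u) T, ae_restrict_mem (measurableSet_cell T.1)] with x hx hxT
      rw [hx]
      refine (hDW _).trans (mul_le_mul_of_nonneg_left ?_ hK)
      exact Real.rpow_le_rpow (by positivity) (by linarith [hmax' x hxT]) (by linarith)
    have hrow : ∀ i, ∀ x ∈ cell T.1, ‖mfun (σ T) x i‖ ≤ C₀ * G := fun i =>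
      hproj T.1 hS _ (mrow (σ T) i).2 (fun x => DW W (glue (R u) x) i) G hG0
        (by filter_upwards [hg] with x hx using (PiLp.norm_apply_le _ i).trans hx)
        (hpr T i (mrow (σ T) i))
    -- The growth of order p - 1 raised to the power p' is growth of order p.
    have hGp : (C₀ * G) ^ p' = (C₀ * K) ^ p' * (1 + S) ^ p := by
      rw [hG, ← mul_assoc, Real.mul_rpow (by positivity) (by positivity),
        ← Real.rpow_mul (by positivity), hpp']
    have hSp : (1 + S) ^ p ≤ 2 ^ p * (1 + S ^ p) := by
      have hSpos : 0 ≤ S ^ p := by positivity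
      rcases le_total S 1 with h1 | h1
      · calc (1 + S) ^ p ≤ 2 ^ p := Real.rpow_le_rpow (by positivity) (by linarith) hp0
          _ ≤ 2 ^ p * (1 + S ^ p) := le_mul_of_one_le_right (by positivity) (by linarith)
      · calc (1 + S) ^ p ≤ (2 * S) ^ p := Real.rpow_le_rpow (by positivity) (by linarith) hp0
          _ = 2 ^ p * S ^ p := Real.mul_rpow (by norm_num) hS0
          _ ≤ 2 ^ p * (1 + S ^ p) := mul_le_mul_of_nonneg_left (by linarith) (by positivity)
    have hpt : ∀ x ∈ cell T.1, ‖mfun (σ T) x‖ ^ p' ≤ B * (1 + S ^ p) := fun x hx => by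
      calc ‖mfun (σ T) x‖ ^ p' ≤ (m : ℝ) ^ (p' - 1) * ∑ i, ‖mfun (σ T) x i‖ ^ p' :=
            norm_rpow_le_sum_row hp'.le _
        _ ≤ (m : ℝ) ^ (p' - 1) * ∑ i : Fin m, (C₀ * G) ^ p' :=
            mul_le_mul_of_nonneg_left (Finset.sum_le_sum fun i _ =>
              Real.rpow_le_rpow (norm_nonneg _) (hrow i x hx) hp'0) (by positivity)
        _ = (m : ℝ) ^ (p' - 1) * (m * (C₀ * K) ^ p') * (1 + S) ^ p := by
            rw [hGp]; simp; ring
        _ ≤ (m : ℝ) ^ (p' - 1) * (m * (C₀ * K) ^ p') * (2 ^ p * (1 + S ^ p)) :=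
            mul_le_mul_of_nonneg_left hSp (by positivity)
        _ = B * (1 + S ^ p) := by rw [hB]; ring
    have hint : ∫ x in cell T.1, ‖mfun (σ T) x‖ ^ p' ≤
        B * (1 + S ^ p) * volume.real (cell T.1) := by
      have h1 := setIntegral_mono_on
        (integrableOn_cell T.1 (continuous_norm_rpow hp'0 (mfun_continuous (σ T))))
        (integrableOn_cell T.1 (continuous_const (y := B * (1 + S ^ p))))
        (measurableSet_cell T.1) hpt
      rwa [setIntegral_const, smul_eq_mul, mul_comm] at h1
    have hSc := hcell T.1 hS (R u T) y hy
    have hI0 : 0 ≤ ∫ x in cell T.1, ‖mfun (R u T) x‖ ^ p :=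
      setIntegral_nonneg (measurableSet_cell _) fun x _ => by positivity
    have hv0 : 0 ≤ volume.real (cell T.1) := measureReal_nonneg
    -- An inverse estimate returns from the maximum of |R u| on T to its L^p integral.
    have hvS : S ^ p * volume.real (cell T.1) ≤
        κ * C₁ * ∫ x in cell T.1, ‖mfun (R u T) x‖ ^ p := by
      rw [measure_cell_eq hS, ← hκ]
      calc S ^ p * (jac T.1 * κ) = κ * (jac T.1 * S ^ p) := by ring
        _ ≤ κ * (C₁ * ∫ x in cell T.1, ‖mfun (R u T) x‖ ^ p) :=
            mul_le_mul_of_nonneg_left hSc hκ0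
        _ = _ := by ring
    refine hint.trans ?_
    have hκC : 0 ≤ κ * C₁ := by positivity
    calc B * (1 + S ^ p) * volume.real (cell T.1)
        = B * (volume.real (cell T.1) + S ^ p * volume.real (cell T.1)) := by ring
      _ ≤ B * ((1 + κ * C₁) *
          (volume.real (cell T.1) + ∫ x in cell T.1, ‖mfun (R u T) x‖ ^ p)) :=
          mul_le_mul_of_nonneg_left (by nlinarith) hB0
      _ = _ := by ring
  rw [integral_comp_glue h hΩr (hcont p' hp'0), integral_comp_glue h hΩr (hcont p hp0), hvol,
    ← Finset.sum_add_distrib]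
  have hsum := Finset.sum_le_sum fun (T : 𝒯) (_ : T ∈ Finset.univ) => hT T
  rw [← Finset.mul_sum] at hsum
  refine hsum.trans (mul_le_mul_of_nonneg_right (by linarith) ?_)
  exact Finset.sum_nonneg fun T _ => add_nonneg measureReal_nonneg
    (setIntegral_nonneg (measurableSet_cell _) fun x _ => by positivity)

end

end HHO

/-! ### The main theorem: assembly with constants independent of the triangulation -/

theorem theorem3p2
    -- dimensions, exponents, constants of the energy density, polynomial degrees
    (m n : ℕ) (hm : 1 ≤ m) (hn : 1 ≤ n)
    (p p' r s : ℝ) (hp : 1 < p) (hpp' : 1 / p + 1 / p' = 1) (hr : 1 < r) (hs : 0 ≤ s)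
    (c₁ c₂ c₃ c₄ c₅ : ℝ) (hc₁ : 0 < c₁) (hc₂ : 0 < c₂) (hc₃ : 0 < c₃) (hc₄ : 0 ≤ c₄) (hc₅ : 0 ≤ c₅)
    (P : HHO.Pairing) (ℓ : ℕ)
    -- the domain, the shape regularity parameter, a bound for the norm of the right-hand side
    (Ω : Set (HHO.Vec n)) (hΩo : IsOpen Ω) (hΩb : Bornology.IsBounded Ω)
    (hΩr : interior (closure Ω) = Ω) (γ M : ℝ) :
    ∃ C₁ C₂ : ℝ, 0 < C₁ ∧ 0 < C₂ ∧
      ∀ 𝒯 : Finset (Finset (HHO.Vec n)), HHO.IsTriangulation Ω 𝒯 → HHO.ShapeRegular γ 𝒯 →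
      ∀ W : HHO.Mat m n → ℝ, ContDiff ℝ 1 W → HHO.TwoSidedGrowth p c₁ c₂ c₄ c₅ W →
        HHO.ConvexityControl r s c₃ W →
      ∀ f : HHO.Vec n → HHO.Vec m, MemLp f (ENNReal.ofReal p') (volume.restrict Ω) →
        eLpNorm f (ENNReal.ofReal p') (volume.restrict Ω) ≤ ENNReal.ofReal M →
        -- the operators `R`, `Π_𝒯^ℓ` and `Π_Σ` are well defined
        ((∀ v : HHO.Vh m P ℓ Ω 𝒯, ∃! ρ : HHO.SigmaPw m P ℓ 𝒯, HHO.IsGradRec v ρ) ∧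
          (∃! q : HHO.PolyPw m ℓ 𝒯,
            HHO.IsL2Proj (fun T : 𝒯 => HHO.polyVec m ℓ (HHO.cell T.1)) Ω f q) ∧
          (∀ v : HHO.Vh m P ℓ Ω 𝒯, ∃! q : HHO.SigmaPw m P ℓ 𝒯,
            HHO.IsL2Proj (fun T : 𝒯 => P.matSpace m ℓ (HHO.cell T.1)) Ω
              (fun x => HHO.DW W (HHO.glue (HHO.R v) x)) q)) ∧
        -- the minimum is attained
        (∃ u : HHO.Vh m P ℓ Ω 𝒯, HHO.IsDiscreteMinimizer W f u) ∧
        -- (a)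
        (∀ u₁ u₂ : HHO.Vh m P ℓ Ω 𝒯,
          HHO.IsDiscreteMinimizer W f u₁ → HHO.IsDiscreteMinimizer W f u₂ →
            (∀ᵐ x ∂(volume.restrict Ω),
              HHO.DW W (HHO.glue (HHO.R u₁) x) = HHO.DW W (HHO.glue (HHO.R u₂) x)) ∧
            HHO.discreteStress W u₁ = HHO.discreteStress W u₂) ∧
        -- (b) and (c)
        (∀ u : HHO.Vh m P ℓ Ω 𝒯, HHO.IsDiscreteMinimizer W f u →
          HHO.discreteStress W u ∈ HHO.Q P ℓ p' Ω 𝒯 f ∧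
          eLpNorm (HHO.glue (HHO.R u)) (ENNReal.ofReal p) (volume.restrict Ω)
            ≤ ENNReal.ofReal C₁ ∧
          eLpNorm (HHO.glue (HHO.discreteStress W u)) (ENNReal.ofReal p') (volume.restrict Ω)
            ≤ ENNReal.ofReal C₂) := by
  -- With n = d + 1 the surface measure `μHE[n - 1]` becomes `μHE[d]`, and a simplex has d + 2
  -- vertices.
  obtain ⟨d, rfl⟩ : ∃ d, n = d + 1 := ⟨n - 1, by omega⟩
  have hp0 : 0 < p := by linarith
  have hconj : p.HolderConjugate p' :=
    Real.holderConjugate_iff.2 ⟨hp, by simpa [one_div] using hpp'⟩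
  have hp'1 : 1 < p' := hconj.symm.lt
  have hp'0 : 0 < p' := by linarith
  have hpp1 : (p - 1) * p' = p := hconj.sub_one_mul_conj
  obtain ⟨D₀, hD₀⟩ := hΩb.subset_closedBall 0
  -- The Poincaré argument uses a bound for the coordinate x_0 on Ω; the maximum with 0 makes the
  -- radius nonnegative.
  have hΩD : Ω ⊆ Metric.closedBall 0 (max D₀ 0) :=
    hD₀.trans (Metric.closedBall_subset_closedBall (le_max_left _ _))
  obtain ⟨C, hC, hpoin⟩ := HHO.exists_poincare_norm d m P ℓ γ (max D₀ 0) (le_max_right _ _) hp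
  obtain ⟨C', hC', hstress⟩ := HHO.exists_stress_bound d m P ℓ (K := c₂ * 2 ^ p + c₄ + c₅) hp hp'1
    hpp1 (by positivity)
  -- The bound on sublevel sets of the energy, which contain every minimiser by comparison with v =
  -- 0. It involves only the data; the second constant follows from it by the stress bound.
  set B := max 1 ((((c₄ + c₅) * volume.real Ω + max M 0 * C ^ (1 / p)) / c₁) ^ (1 / (p - 1)))
    with hB
  have hB1 : 1 ≤ B := le_max_left _ _
  refine ⟨B, (C' * (volume.real Ω + B ^ p)) ^ p'⁻¹, by linarith, by positivity, ?_⟩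
  intro 𝒯 h hγ W hW hg hc f hf hM
  have hfi := HHO.integrableOn_of_memLp hΩb hp'1.le hf
  have hpo := hpoin Ω hΩo hΩr hΩD 𝒯 h hγ
  refine ⟨⟨HHO.existsUnique_isGradRec h hΩr, HHO.existsUnique_projPoly h hΩr hfi,
    fun v => HHO.existsUnique_projSigma h hΩr hW (HHO.R v)⟩,
    HHO.exists_isDiscreteMinimizer h hΩr hΩb hp hp'1.le hconj.symm hc₁ hc₄ hc₅ hg hW.continuous
      hf hM hC.le hpo, fun u₁ u₂ hu₁ hu₂ => ?_, fun u hu => ?_⟩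
  · have hae := HHO.DW_ae_eq h hΩr hfi hW hc₃ (by linarith : r ≠ 0) hc hu₁ hu₂
    exact ⟨hae, HHO.projSigma_congr hae⟩
  · have hI0 : 0 ≤ ∫ x in Ω, ‖HHO.glue (HHO.R u) x‖ ^ p := integral_nonneg fun x => by positivity
    have h1 := HHO.integral_norm_rpow_le h hΩr hΩb hp hconj.symm hc₁ hc₄ hc₅ hg hW.continuous
      hf hM hC.le hpo (hu 0)
    refine ⟨HHO.discreteStress_mem_Q h hΩo hΩr hp'0 hfi hW hc₃ hc hu, ?_, ?_⟩
    · rw [HHO.eLpNorm_eq_ofReal hp0 (HHO.memLp_glue h hΩr hp0 _), ← one_div]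
      exact ENNReal.ofReal_le_ofReal h1
    · rw [HHO.eLpNorm_eq_ofReal hp'0 (HHO.memLp_glue h hΩr hp'0 _)]
      refine ENNReal.ofReal_le_ofReal (Real.rpow_le_rpow (integral_nonneg fun x => by positivity)
        ((hstress Ω hΩr 𝒯 h W hW
          (HHO.norm_DW_le hp hc₁ hc₂ hc₄ hc₅ hc₃ hg hc) u).trans ?_) (by positivity))
      refine mul_le_mul_of_nonneg_left (add_le_add le_rfl ?_) hC'.le
      have h2 := Real.rpow_le_rpow (Real.rpow_nonneg hI0 _) h1 hp0.le
      rwa [← Real.rpow_mul hI0, one_div_mul_cancel hp0.ne', Real.rpow_one] at h2
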